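/- Let $q>0$ be real, $[x]=(q^x-q^{-x})/(q-q^{-1})$ (with $[x]=x$ if $q=1$), $[n]!=[n][n-1]\cdots[1]$, $1/[-n]!=0$ for $n=1,2,\dots$, $Z_{j_1\dots j_n}=-\sum_i j_i(j_i+1)$, $$\nabla[abc]=\left(\frac{[a+b-c]!\,[a-b+c]!\,[a+b+c+1]!}{[b+c-a]!}\right)^{1/2},\qquad \Delta[abc]=\left(\frac{[a+b-c]!\,[a-b+c]!\,[b+c-a]!}{[a+b+c+1]!}\right)^{1/2}.$$ The $q$-$6j$ coefficient of $u_q(2)$ is, when $(a,b,e),(a,c,f),(d,b,f),(d,c,e)$ satisfy the triangular conditions, $$\begin{Bmatrix}a&b&e\\d&c&f\end{Bmatrix}_q=\Delta[abe]\Delta[acf]\Delta[dbf]\Delta[dce]\sum_z\frac{(-1)^z[z+1]!}{[z-a-b-e]!\,[z-a-c-f]!\,[z-d-b-f]!\,[z-d-c-e]!}\,\frac{1}{[a+b+c+d-z]!\,[a+d+e+f-z]!\,[b+c+e+f-z]!}$$ and $0$ otherwise, and the $q$-$9j$ coefficient is $$\begin{Bmatrix}a&b&e\\c&d&f\\h&k&g\end{Bmatrix}_q=\sum_j(-1)^{2j}q^{Z_{deh}-j(j+1)}[2j+1]\begin{Bmatrix}a&c&h\\k&g&j\end{Bmatrix}_q\begin{Bmatrix}k&j&c\\f&d&b\end{Bmatrix}_q\begin{Bmatrix}a&g&j\\f&b&e\end{Bmatrix}_q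 .$$ Let $a,b,e,c,d,f,h,k,g\in\{0,\frac12,1,\dots\}$ be such that the rows $(a,b,e),(c,d,f),(h,k,g)$ and the columns $(a,c,h),(b,d,k),(e,f,g)$ satisfy the triangular conditions, and let $g=e+f$ (stretched case). Put $N=\left([2e]!\,[2f]!/[2g+1]!\right)^{1/2}$. Then the $q$-$9j$ coefficient $\begin{Bmatrix}a&b&e\\c&d&f\\h&k&e+f\end{Bmatrix}_q$ is equal to each of the following five double sums, over all non-negative integers $s,z$ for which no argument of a denominator factorial is negative: (a) $$N\frac{\nabla[ghk]\nabla[bdk]\nabla[cah]}{\nabla[eab]\nabla[fcd]}q^{(h-b-c-e)(b+c+f-k)+2bc+Z_{efhk}}\sum_{s,z}\frac{(-1)^{s+z}[a-c+h+s]!\,[k-b+d+z]!}{[s]!\,[a+c-h-s]!\,[b-c-e+h+s]!\,[2h+s+1]!}\cdot\frac{q^{s(b+c+f-k-z)+z(b+c+e-h)}[h-g+k+s+z]!}{[z]!\,[b+d-k-z]!\,[k-b+c-f+z]!\,[2k+z+1]!};$$ (b) $$(-1)^{b-a+f+h-k}N\frac{\nabla[ghk]\nabla[bdk]\nabla[cah]}{\nabla[eab]\nabla[fcd]}q^{(b+c-f)(k-g-h)+k(g+h+1)-2fh+Z_{bcf}+Z_{ghk}}\sum_{s,z}\frac{(-1)^{s}[2h-s]!\,[e+h-b+c-s]!\,[k-b+d+z]!}{[s]!\,[c+h-a-s]!\,[a+c+h-s+1]!\,[g+h-k-s-z]!}\cdot\frac{q^{s(b+c+f-k-z)+z(b+c+e+h+1)}}{[z]!\,[b+d-k-z]!\,[c-b-f+k+z]!\,[2k+z+1]!};$$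 (c) $$(-1)^{d+f-c}N\frac{\nabla[cah]\nabla[ghk]}{\nabla[fcd]\nabla[eab]\nabla[bdk]}q^{(b-c+e+h+1)(g-h+k)-(e+k)(e+k+1)+Z_{bcg}}\sum_{s,z}\frac{(-1)^{s+z}[a-c+h+s]!\,[b+c+e-h-s]!}{[s]!\,[a+c-h-s]!\,[2h+s+1]!\,[g-h+k-s-z]!}\cdot\frac{q^{s(c-b+f+k-z)-z(b-c-e+h+1)}[b+d-k+z]!\,[2k-z]!}{[z]!\,[d+k-b-z]!\,[b+c-f-k+z]!};$$ (d) $$q^{2af-(a+b-e)(a+d+f-h)+Z_{bdgh}}N\frac{\nabla[ghk]\nabla[dbk]}{\nabla[hac]\nabla[fcd]\nabla[eab]}\sum_{s,z}\frac{(-1)^{a+c-h+s+z}[2b-z]!\,[b+d-g+h-z]!}{[z]!\,[b+d-k-z]!\,[b+d+k-z+1]!\,[s]!}\cdot\frac{q^{z(a+d+f-h-s)-s(g+h-b-d+1)}[2a-s]!\,[h-a+c+s]!}{[a+b-e-z-s]!\,[a+c-h-s]!\,[d-a-f+h+s]!};$$ (e) $$q^{k(2f-2b+k-1)+(g-h+k)(a+b-f-h-k)+Z_{cdeh}}N\frac{\nabla[ghk]\nabla[kbd]\nabla[ach]}{\nabla[fcd]\nabla[eab]}\sum_{s,z}\frac{(-1)^{c-d+e-g+z}q^{-s(a+b+e+z+1)-z(h-g+k)}}{[s]!\,[g-h+k-s]!\,[a+c-h-s]!\,[2h+s+1]!}\cdot\frac{[c+h-a+s]!\,[b+d-k+z]!\,[b+e-a+z]!}{[z]!\,[d+k-b-z]!\,[b-a-f+h-k+s+z]!\,[2b+z+1]!}.$$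 Moreover, each of these is a composition of two series of type $_3F_2$: with either summation parameter fixed, the terms $t_n$ of the sum over the other one satisfy, for some $\alpha_1,\alpha_2,\alpha_3,\beta_1,\beta_2$ and $x=q^{p+1}$ or $x=q^{-(p+1)}$, $p=\alpha_1+\alpha_2+\alpha_3-\beta_1-\beta_2$, $$t_{n+1}[\beta_1+n][\beta_2+n][1+n]=t_n[\alpha_1+n][\alpha_2+n][\alpha_3+n]\,x\qquad(n=0,1,2,\dots),$$ where terms with a negative argument in a denominator factorial are $0$. Finally, the separate sum over $z$ in (b) and the separate sum over $s$ in (e) do not alternate: all terms of the former have the sign $(-1)^s$ and all terms of the latter have the sign $(-1)^{c-d+e-g+z}$, or vanish. -/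

import Mathlib

open Finset

noncomputable section

namespace QNineJ

/-- The symmetric `q`-number `[x] = (q^x - q^(-x)) / (q - q⁻¹)`, with its limit `[x] = x` at
`q = 1`. -/
def qNum (q x : ℝ) : ℝ :=
  if q = 1 then x else (q ^ x - q ^ (-x)) / (q - q⁻¹)

/-- The `q`-factorial `[x]! = [x][x-1]⋯[2][1]` of a non-negative integer `x` (given as a real
number).  The value `0` at negative arguments encodes, through `1 / 0 = 0`, the usual convention
that a term with the factorial of a negative integer in its denominator vanishes. -/
def qFact (q x : ℝ) : ℝ :=
  if 0 ≤ x then ∏ i ∈ range ⌊x⌋₊, qNum q ((i : ℝ) + 1) else 0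

/-- The sign `(-1)^x` for an integer `x` given as a real number. -/
def sgn (x : ℝ) : ℝ := (-1 : ℝ) ^ ⌊x⌋

/-- Angular momenta: `0, 1/2, 1, 3/2, …`. -/
def IsSpin (j : ℝ) : Prop := ∃ n : ℕ, j = (n : ℝ) / 2

/-- The triangular condition on three angular momenta. -/
def Triad (a b c : ℝ) : Prop :=
  IsSpin a ∧ IsSpin b ∧ IsSpin c ∧ |a - b| ≤ c ∧ c ≤ a + b ∧ ∃ n : ℕ, a + b + c = n

/-- The symmetric triangle coefficient `Δ[abc]`. -/
def triDelta (q a b c : ℝ) : ℝ :=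
  √(qFact q (a + b - c) * qFact q (a - b + c) * qFact q (b + c - a) / qFact q (a + b + c + 1))

/-- The asymmetric triangle coefficient `∇[abc]`. -/
def nabla (q a b c : ℝ) : ℝ :=
  √(qFact q (a + b - c) * qFact q (a - b + c) * qFact q (a + b + c + 1) / qFact q (b + c - a))

open Classical in
/-- The `q`-`6j` coefficient `{a b e; d c f}_q` of `u_q(2)` in Racah's form. -/
def sixJ (q a b e d c f : ℝ) : ℝ :=
  if Triad a b e ∧ Triad a c f ∧ Triad d b f ∧ Triad d c e then
    triDelta q a b e * triDelta q a c f * triDelta q d b f * triDelta q d c e *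
      ∑ z ∈ range (⌊a + b + c + d⌋₊ + 1),
        (-1 : ℝ) ^ z * qFact q ((z : ℝ) + 1) /
          (qFact q (z - a - b - e) * qFact q (z - a - c - f) *
            qFact q (z - d - b - f) * qFact q (z - d - c - e) *
            qFact q (a + b + c + d - z) * qFact q (a + d + e + f - z) *
            qFact q (b + c + e + f - z))
  else 0

/-- `Z_{j₁ … jₙ} = -j₁(j₁+1) - ⋯ - jₙ(jₙ+1)`. -/
def Z (l : List ℝ) : ℝ := -(l.map fun j => j * (j + 1)).sum

/-- The `q`-`9j` coefficient `{a b e; c d f; h k g}_q` of `u_q(2)` (arguments row by row), as the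
sum over `j = n / 2` of products of three `q`-`6j` coefficients; the sum over `j` is restricted by
the triangular conditions for `(a, g, j)`, `(k, c, j)`, `(f, b, j)`, off which `sixJ` vanishes. -/
def nineJ (q a b e c d f h k g : ℝ) : ℝ :=
  ∑ n ∈ range (⌊2 * (a + g)⌋₊ + 1),
    (-1 : ℝ) ^ n * q ^ (Z [d, e, h] - (n / 2 : ℝ) * ((n / 2 : ℝ) + 1)) * qNum q ((n : ℝ) + 1) *
      sixJ q a c h k g (n / 2) * sixJ q k (n / 2) c f d b * sixJ q a g (n / 2) f b e

/-- `t` is the sequence of terms of a basic series of type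
`₃F₂[α₁, α₂, α₃; β₁, β₂; q, x] = ∑ₙ (α₁|q)ₙ (α₂|q)ₙ (α₃|q)ₙ / ((β₁|q)ₙ (β₂|q)ₙ (1|q)ₙ) xⁿ` with
`x = q^(±(p+1))`, `p = α₁ + α₂ + α₃ - β₁ - β₂`, up to normalization: consecutive terms satisfy the
term-ratio relation of that series (in cleared form, as `[βᵢ + n]` may vanish). -/
def IsThreeFTwo (q : ℝ) (t : ℕ → ℝ) : Prop :=
  ∃ α₁ α₂ α₃ β₁ β₂ x : ℝ,
    (x = q ^ (α₁ + α₂ + α₃ - β₁ - β₂ + 1) ∨ x = q ^ (-(α₁ + α₂ + α₃ - β₁ - β₂ + 1))) ∧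
    ∀ n : ℕ,
      t (n + 1) * (qNum q (β₁ + n) * qNum q (β₂ + n) * qNum q (1 + n)) =
        t n * (qNum q (α₁ + n) * qNum q (α₂ + n) * qNum q (α₃ + n)) * x

/-- Summand of the first double sum. -/
def termA (q a b e c d f h k g : ℝ) (s z : ℕ) : ℝ :=
  (-1 : ℝ) ^ (s + z) * qFact q (a - c + h + s) * qFact q (k - b + d + z) /
      (qFact q s * qFact q (a + c - h - s) * qFact q (b - c - e + h + s) *
        qFact q (2 * h + s + 1)) *
    (q ^ (s * (b + c + f - k - z) + z * (b + c + e - h)) * qFact q (h - g + k + s + z) /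
      (qFact q z * qFact q (b + d - k - z) * qFact q (k - b + c - f + z) *
        qFact q (2 * k + z + 1)))

/-- Summand of the second double sum. -/
def termB (q a b e c d f h k g : ℝ) (s z : ℕ) : ℝ :=
  (-1 : ℝ) ^ s * qFact q (2 * h - s) * qFact q (e + h - b + c - s) * qFact q (k - b + d + z) /
      (qFact q s * qFact q (c + h - a - s) * qFact q (a + c + h - s + 1) *
        qFact q (g + h - k - s - z)) *
    (q ^ (s * (b + c + f - k - z) + z * (b + c + e + h + 1)) /
      (qFact q z * qFact q (b + d - k - z) * qFact q (c - b - f + k + z) *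
        qFact q (2 * k + z + 1)))

/-- Summand of the third double sum. -/
def termC (q a b e c d f h k g : ℝ) (s z : ℕ) : ℝ :=
  (-1 : ℝ) ^ (s + z) * qFact q (a - c + h + s) * qFact q (b + c + e - h - s) /
      (qFact q s * qFact q (a + c - h - s) * qFact q (2 * h + s + 1) *
        qFact q (g - h + k - s - z)) *
    (q ^ (s * (c - b + f + k - z) - z * (b - c - e + h + 1)) * qFact q (b + d - k + z) *
        qFact q (2 * k - z) /
      (qFact q z * qFact q (d + k - b - z) * qFact q (b + c - f - k + z)))

/-- Summand of the fourth double sum. -/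
def termD (q a b e c d f h k g : ℝ) (s z : ℕ) : ℝ :=
  sgn (a + c - h + s + z) * qFact q (2 * b - z) * qFact q (b + d - g + h - z) /
      (qFact q z * qFact q (b + d - k - z) * qFact q (b + d + k - z + 1) * qFact q s) *
    (q ^ (z * (a + d + f - h - s) - s * (g + h - b - d + 1)) * qFact q (2 * a - s) *
        qFact q (h - a + c + s) /
      (qFact q (a + b - e - z - s) * qFact q (a + c - h - s) * qFact q (d - a - f + h + s)))

/-- Summand of the fifth double sum. -/
def termE (q a b e c d f h k g : ℝ) (s z : ℕ) : ℝ :=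
  sgn (c - d + e - g + z) * q ^ (-s * (a + b + e + z + 1) - z * (h - g + k)) /
      (qFact q s * qFact q (g - h + k - s) * qFact q (a + c - h - s) * qFact q (2 * h + s + 1)) *
    (qFact q (c + h - a + s) * qFact q (b + d - k + z) * qFact q (b + e - a + z) /
      (qFact q z * qFact q (d + k - b - z) * qFact q (b - a - f + h - k + s + z) *
        qFact q (2 * b + z + 1)))

end QNineJ

end

/-! For `g = e + f` the third `6j` coefficient in the sum over `j` has the same number `a + g + j`
as a lower and as an upper limit of Racah's sum, so it is a single product (`racah_stretched`). The
other two are terminating balanced series of type `₄F₃`. Two applications of the Pfaff–Saalschütz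
sum bring each of them to a form in which few factorials under the summation sign involve `j`
(`racah_eq_desc`, `racah_eq_asc`). Every triangle coefficient containing `j` occurs twice, so these
square roots disappear, and almost all `j`-dependent factorials outside the two remaining sums
cancel (`racah_mul_racah_mul_racah`). With the weight `[2j+1] q^(-j(j+1))` the sum over `j` is then
very well poised, a limiting case of the summable `₆φ₅`, and has a closed form (`well_poised_sum`).
A double sum is left; one `₃F₂` transformation of its inner sum turns it into the fifth expression
(`sum_descPart_mul_ascPart`).

The other four expressions follow from the fifth by transforming one of the two sums while the other
variable is fixed. All the `₃F₂` transformations come from one mechanism: part of the summand is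
expanded by the `q`-Vandermonde sum, the sums are exchanged, and the inner one is an alternating
`q`-Vandermonde sum (`altSum_eq`, `mixSum_eq`). They are combined with `q → q⁻¹`, under which
`q`-numbers are invariant, and with reversal or shift of the summation variable.

The computation takes place in the integers `α = 2a`, `β = 2b`, `n₁ = a + b - e`, `n₃ = c + d - f`,
`s₀ = a + c - h`, `s₁ = c + h - a`, `z₀ = b + d - k`, `z₁ = d + k - b`, with `j = g - a + i`.
Reciprocal factorials of negative integers are zero, which lets the identities extend to degenerate
ranges; most case distinctions verify that both sides vanish there.

The `₃F₂` property is read off from ratios of consecutive terms, and the sign statements from the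
nonnegativity of factorials and powers of `q`. -/

namespace QNineJ

/-! ### Symmetric `q`-numbers and `q`-factorials at integers -/

/-- The symmetric `q`-number of an integer. -/
noncomputable def qInt (q : ℝ) (n : ℤ) : ℝ := qNum q n

/-- The `q`-factorial of an integer, `0` at negative integers. -/
noncomputable def fac (q : ℝ) (n : ℤ) : ℝ := qFact q n

/-- The reciprocal `q`-factorial of an integer, `0` at negative integers. -/
noncomputable def ifac (q : ℝ) (n : ℤ) : ℝ := (qFact q n)⁻¹

lemma sub_inv_ne_zero {q : ℝ} (hq : 0 < q) (h1 : q ≠ 1) : q - q⁻¹ ≠ 0 := by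
  intro h
  have h2 : q * q = 1 := by
    have : q = q⁻¹ := by linarith
    field_simp at this
    nlinarith
  have : (q - 1) * (q + 1) = 0 := by linarith
  rcases mul_eq_zero.1 this with h | h
  · exact h1 (by linarith)
  · linarith

/-- Inverting `q` changes the sign of both numerator and denominator. Because of this symmetry every
series identity below has a companion in which all powers of `q` are inverted. -/
lemma qNum_inv {q : ℝ} (hq : 0 < q) (x : ℝ) : qNum q⁻¹ x = qNum q x := by
  unfold qNum
  by_cases h : q = 1
  · simp [h]
  · have h' : q⁻¹ ≠ 1 := by simpa using h
    have h2 := sub_inv_ne_zero hq h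
    have h3 : q⁻¹ - q ≠ 0 := by intro h4; apply h2; linarith
    simp only [h, h', if_false, inv_inv]
    rw [Real.inv_rpow hq.le, Real.inv_rpow hq.le, ← Real.rpow_neg hq.le, ← Real.rpow_neg hq.le,
      neg_neg, div_eq_div_iff h3 h2]
    ring

lemma qNum_pos {q : ℝ} (hq : 0 < q) {x : ℝ} (hx : 0 < x) : 0 < qNum q x := by
  have key : ∀ r : ℝ, 1 < r → 0 < (r ^ x - r ^ (-x)) / (r - r⁻¹) := by
    intro r hr
    apply div_pos
    · have := Real.rpow_lt_rpow_of_exponent_lt hr (show -x < x by linarith)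
      linarith
    · have : r⁻¹ < 1 := inv_lt_one_of_one_lt₀ hr
      linarith
  rcases lt_trichotomy q 1 with h | h | h
  · rw [← qNum_inv hq]
    have h1 : 1 < q⁻¹ := (one_lt_inv₀ hq).2 h
    unfold qNum
    rw [if_neg h1.ne']
    exact key _ h1
  · simpa [qNum, h] using hx
  · unfold qNum
    rw [if_neg h.ne']
    exact key _ h

lemma qFact_inv {q : ℝ} (hq : 0 < q) (x : ℝ) : qFact q⁻¹ x = qFact q x := by
  simp [qFact, qNum_inv hq]

lemma fac_inv {q : ℝ} (hq : 0 < q) (n : ℤ) : fac q⁻¹ n = fac q n := qFact_inv hq _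
lemma ifac_inv {q : ℝ} (hq : 0 < q) (n : ℤ) : ifac q⁻¹ n = ifac q n := by
  rw [ifac, ifac, qFact_inv hq]

lemma qInt_eq {q : ℝ} (h1 : q ≠ 1) (n : ℤ) :
    qInt q n = (q ^ n - q ^ (-n)) / (q - q⁻¹) := by
  unfold qInt qNum
  rw [if_neg h1, ← Real.rpow_intCast, ← Real.rpow_intCast]
  push_cast
  rfl

@[simp] lemma qInt_zero (q : ℝ) : qInt q 0 = 0 := by
  unfold qInt qNum
  simp

lemma qInt_neg (q : ℝ) (n : ℤ) : qInt q (-n) = -qInt q n := by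
  by_cases h1 : q = 1
  · simp [qInt, qNum, h1]
  · rw [qInt_eq h1, qInt_eq h1, neg_neg]
    ring

lemma qInt_pos {q : ℝ} (hq : 0 < q) {n : ℤ} (hn : 0 < n) : 0 < qInt q n :=
  qNum_pos hq (by exact_mod_cast hn)

/-- This replaces additivity of integers: it splits a factor `[m + 1]` into two pieces in the
Pascal-type recurrences for the Vandermonde sums. -/
lemma qInt_add {q : ℝ} (hq : 0 < q) (m n : ℤ) :
    qInt q (m + n) = q ^ n * qInt q m + q ^ (-m) * qInt q n := by
  by_cases h1 : q = 1
  · simp [qInt, qNum, h1]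
  · rw [qInt_eq h1, qInt_eq h1, qInt_eq h1]
    have h2 := sub_inv_ne_zero hq h1
    have hq0 := hq.ne'
    rw [neg_add, zpow_add₀ hq0, zpow_add₀ hq0]
    field_simp
    ring

lemma qInt_split {q : ℝ} (hq : 0 < q) {k m n : ℤ} (h : k = m + n) :
    qInt q k = q ^ n * qInt q m + q ^ (-m) * qInt q n := h ▸ qInt_add hq m n

/-- The `q`-form of `a(c + d - a) - cd = (a - c)(d - a)`. The telescoping proofs of the balanced
sums need no algebra beyond this relation and its variant `qInt_mul_sub'`. -/
lemma qInt_mul_sub {q : ℝ} (hq : 0 < q) {a b c d x y : ℤ} (h : a + b = c + d)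
    (hx : x = a - c) (hy : y = d - a) :
    qInt q a * qInt q b - qInt q c * qInt q d = qInt q x * qInt q y := by
  subst hx hy
  have hb : b = c + d - a := by omega
  subst hb
  by_cases h1 : q = 1
  · simp [qInt, qNum, h1]; ring
  · simp only [qInt_eq h1]
    have h2 := sub_inv_ne_zero hq h1
    have hq0 := hq.ne'
    simp only [neg_sub, zpow_add₀ hq0, zpow_sub₀ hq0, zpow_neg]
    have ha : q ^ a ≠ 0 := zpow_ne_zero _ hq0
    have hc : q ^ c ≠ 0 := zpow_ne_zero _ hq0
    have hd : q ^ d ≠ 0 := zpow_ne_zero _ hq0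
    field_simp
    ring

lemma fac_pos {q : ℝ} (hq : 0 < q) {n : ℤ} (hn : 0 ≤ n) : 0 < fac q n := by
  unfold fac qFact
  rw [if_pos (by exact_mod_cast hn)]
  exact Finset.prod_pos fun i _ => qNum_pos hq (by positivity)

lemma fac_neg (q : ℝ) {n : ℤ} (hn : n < 0) : fac q n = 0 := by
  unfold fac qFact
  rw [if_neg]
  rw [not_le]; exact_mod_cast hn

lemma fac_nonneg {q : ℝ} (hq : 0 < q) (n : ℤ) : 0 ≤ fac q n := by
  rcases lt_or_ge n 0 with h | h
  · rw [fac_neg q h]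
  · exact (fac_pos hq h).le

lemma ifac_eq (q : ℝ) (n : ℤ) : ifac q n = (fac q n)⁻¹ := rfl

lemma ifac_neg (q : ℝ) {n : ℤ} (hn : n < 0) : ifac q n = 0 := by
  rw [ifac_eq, fac_neg q hn, inv_zero]

lemma ifac_nonneg {q : ℝ} (hq : 0 < q) (n : ℤ) : 0 ≤ ifac q n := inv_nonneg.2 (fac_nonneg hq n)

lemma fac_mul_ifac {q : ℝ} (hq : 0 < q) {n : ℤ} (hn : 0 ≤ n) : fac q n * ifac q n = 1 :=
  mul_inv_cancel₀ (fac_pos hq hn).ne'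

lemma fac_step (q : ℝ) {m n : ℤ} (hm : 0 ≤ m) (h : n = m + 1) :
    fac q n = qInt q n * fac q m := by
  subst h
  obtain ⟨k, rfl⟩ := Int.eq_ofNat_of_zero_le hm
  unfold fac qFact qInt
  have h1 : ((k : ℤ) : ℝ) = (k : ℝ) := by simp
  have h2 : (((k : ℤ) + 1 : ℤ) : ℝ) = ((k + 1 : ℕ) : ℝ) := by push_cast; rfl
  rw [h1, h2, if_pos (by positivity), if_pos (by positivity), Nat.floor_natCast,
    Nat.floor_natCast, Finset.prod_range_succ, mul_comm]
  push_cast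
  rfl

lemma fac_zero (q : ℝ) : fac q 0 = 1 := by
  simp [fac, qFact]

lemma ifac_zero (q : ℝ) : ifac q 0 = 1 := by
  rw [ifac_eq, fac_zero, inv_one]

/-- No sign condition is needed: at `m = -1` both sides are zero because `[0] = 0`, and below that
both reciprocals are zero. In contrast `fac_step` fails at `m = -1`, which is the source of many
case distinctions below. -/
lemma ifac_step {q : ℝ} (hq : 0 < q) {m n : ℤ} (h : n = m + 1) :
    ifac q m = qInt q n * ifac q n := by
  rcases lt_trichotomy m (-1) with hm | hm | hm
  · rw [ifac_neg q (by omega : m < 0), ifac_neg q (by omega : n < 0), mul_zero]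
  · have : n = 0 := by omega
    subst this
    rw [ifac_neg q (by omega : m < 0), qInt_zero, zero_mul]
  · rw [ifac_eq, ifac_eq, fac_step q (by omega : 0 ≤ m) h]
    have := (qInt_pos hq (by omega : 0 < n)).ne'
    have := (fac_pos hq (by omega : 0 ≤ m)).ne'
    field_simp

/-! ### `q`-Vandermonde summations -/

/-- Pascal recursion in `m`: one part of `[m + 1]` cancels against `[m + 1 - i]!` and gives the sum
for `(r, l)`, the other cancels against `[i]!` and, after a shift of `i`, gives the sum for `(r - 1,
l + 1)`. The number `r + l` is the same in both. -/
theorem vandermonde {q : ℝ} (hq : 0 < q) (m : ℕ) (r l : ℤ) :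
    ∑ i ∈ range (m + 1), q ^ ((i : ℤ) * (m + r + l) - m * r) *
        (ifac q i * ifac q (m - i) * ifac q (r - i) * ifac q (l + i)) =
      fac q (m + r + l) * (ifac q r * ifac q m * ifac q (m + l) * ifac q (r + l)) := by
  have hq0 := hq.ne'
  induction m generalizing r l with
  | zero =>
    simp only [zero_add, sum_range_one, Nat.cast_zero, zero_mul, sub_zero, add_zero, zpow_zero,
      one_mul, ifac_zero]
    rcases lt_or_ge (r + l) 0 with h | h
    · rw [ifac_neg q h]
      rcases lt_or_ge r 0 with h' | h'
      · rw [ifac_neg q h']; ring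
      · rw [ifac_neg q (by omega : l < 0)]; ring
    · linear_combination (-ifac q r * ifac q l) * fac_mul_ifac hq h
  | succ m ih =>
    have hm : qInt q (m + 1) ≠ 0 := (qInt_pos hq (by omega)).ne'
    apply mul_left_cancel₀ hm
    have e1 : qInt q (m + 1) * ∑ i ∈ range (m + 1 + 1),
        q ^ ((i : ℤ) * ((m + 1 : ℕ) + r + l) - (m + 1 : ℕ) * r) *
        (ifac q i * ifac q ((m + 1 : ℕ) - i) * ifac q (r - i) * ifac q (l + i)) =
        (∑ i ∈ range (m + 1 + 1), q ^ (-r) * (q ^ ((i : ℤ) * (m + r + l) - m * r) *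
          (ifac q i * ifac q (m - i) * ifac q (r - i) * ifac q (l + i)))) +
        ∑ i ∈ range (m + 1 + 1), q ^ (m - i + 1 + (i : ℤ) * (m + 1 + r + l) - (m + 1) * r) *
          (ifac q (i - 1) * ifac q (m + 1 - i) * ifac q (r - i) * ifac q (l + i)) := by
      rw [mul_sum, ← sum_add_distrib]
      refine sum_congr rfl fun i _ => ?_
      rw [qInt_split hq (show (m : ℤ) + 1 = i + (m + 1 - i) by ring),
        ifac_step hq (show (m + 1 - i : ℤ) = (m - i) + 1 by ring),
        ifac_step hq (show (i : ℤ) = (i - 1) + 1 by ring)]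
      rw [show ((i : ℤ) * ((m + 1 : ℕ) + r + l) - (m + 1 : ℕ) * r) =
          i + ((i : ℤ) * (m + r + l) - m * r) - r by push_cast; ring,
        show (m - i + 1 + (i : ℤ) * (m + 1 + r + l) - (m + 1) * r) =
          (m + 1 - i) + i + ((i : ℤ) * (m + r + l) - m * r) - r by ring]
      simp only [zpow_add₀ hq0, zpow_sub₀ hq0, zpow_neg]
      have := zpow_ne_zero i hq0
      push_cast
      field_simp
      ring
    rw [e1, sum_range_succ, sum_range_succ' _ (m + 1)]
    rw [ifac_neg q (show (m : ℤ) - (m + 1 : ℕ) < 0 by push_cast; omega)]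
    rw [ifac_neg q (show ((0 : ℕ) : ℤ) - 1 < 0 by simp)]
    rw [← mul_sum, ih r l]
    have e2 : ∑ i ∈ range (m + 1), q ^ (m - (i + 1 : ℕ) + 1 +
          ((i + 1 : ℕ) : ℤ) * (m + 1 + r + l) - (m + 1) * r) *
          (ifac q ((i + 1 : ℕ) - 1) * ifac q (m + 1 - (i + 1 : ℕ)) * ifac q (r - (i + 1 : ℕ)) *
            ifac q (l + (i + 1 : ℕ))) =
        q ^ (m + 1 + l) * (fac q (m + (r - 1) + (l + 1)) *
          (ifac q (r - 1) * ifac q m * ifac q (m + (l + 1)) * ifac q (r - 1 + (l + 1)))) := by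
      rw [← ih (r - 1) (l + 1), mul_sum]
      refine sum_congr rfl fun i _ => ?_
      rw [← mul_assoc (q ^ _) (q ^ _), ← zpow_add₀ hq0]
      push_cast
      congr 1
      · congr 1; ring
      · congr 1
        · congr 1
          · congr 2 <;> ring
          · congr 1; ring
        · congr 1; ring
    rw [e2]
    simp only [mul_zero, zero_mul, add_zero]
    -- If `r + l < 0`, all closed forms contain `1/[r + l]! = 0`; otherwise `m + r + l ≥ 0`, as the
    -- recursion of the numerator factorial requires.
    rcases lt_or_ge (r + l) 0 with h | h
    · rw [ifac_neg q h, ifac_neg q (show r - 1 + (l + 1) < 0 by omega)]; ring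
    · rw [show (m : ℤ) + (r - 1) + (l + 1) = m + r + l by ring,
        show r - 1 + (l + 1) = r + l by ring,
        ifac_step hq (show r = (r - 1) + 1 by ring),
        ifac_step hq (show (m : ℤ) + (l + 1) = (m + l) + 1 by ring),
        ifac_step hq (show (m + 1 : ℤ) = m + 1 by ring),
        fac_step q (show 0 ≤ (m : ℤ) + r + l by omega)
          (show (m + 1 : ℕ) + r + l = m + r + l + 1 by push_cast; ring)]
      rw [qInt_split hq (show ((m + 1 : ℕ) : ℤ) + r + l = r + (m + (l + 1)) by push_cast; ring)]
      rw [show ((m + 1 : ℕ) : ℤ) + l = m + (l + 1) by push_cast; ring,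
        show (m : ℤ) + 1 + l = m + (l + 1) by ring]
      push_cast
      ring

/-- The same recursion, except that the shift of `i` raises `x` and `y` together, so that `y - x`
and the product over `range m` are preserved. That product is not written with factorials because
its form depends on the sign of `y - x`; `prod_qInt_pos` and `prod_qInt_nonpos` treat the two cases.
-/
theorem vandermonde_alternating {q : ℝ} (hq : 0 < q) (m : ℕ) {x : ℤ} (hx : 0 ≤ x) (y : ℤ) :
    ∑ i ∈ range (m + 1), (-1) ^ i * q ^ ((i : ℤ) * (x - y - m + 1)) *
        (fac q (x + i) * ifac q i * ifac q (m - i) * ifac q (y + i)) =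
      q ^ ((m : ℤ) * (x + 1)) * (fac q x * ifac q m * ifac q (y + m)) *
        ∏ i ∈ range m, qInt q (y - x + i) := by
  have hq0 := hq.ne'
  induction m generalizing x y with
  | zero => simp [ifac_zero]
  | succ m ih =>
    have hm : qInt q (m + 1) ≠ 0 := (qInt_pos hq (by omega)).ne'
    apply mul_left_cancel₀ hm
    have e1 : qInt q (m + 1) * ∑ i ∈ range (m + 1 + 1),
        (-1) ^ i * q ^ ((i : ℤ) * (x - y - (m + 1 : ℕ) + 1)) *
        (fac q (x + i) * ifac q i * ifac q ((m + 1 : ℕ) - i) * ifac q (y + i)) =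
        (∑ i ∈ range (m + 1 + 1), (-1) ^ i * q ^ ((i : ℤ) * (x - y - m + 1)) *
          (fac q (x + i) * ifac q i * ifac q (m - i) * ifac q (y + i))) +
        ∑ i ∈ range (m + 1 + 1), (-1) ^ i * q ^ ((i : ℤ) * (x - y - m + 1) - (m + 1)) *
          (fac q (x + i) * ifac q (i - 1) * ifac q (m + 1 - i) * ifac q (y + i)) := by
      rw [mul_sum, ← sum_add_distrib]
      refine sum_congr rfl fun i _ => ?_
      rw [qInt_split hq (show (m : ℤ) + 1 = (m + 1 - i) + i by ring),
        ifac_step hq (show (m + 1 - i : ℤ) = (m - i) + 1 by ring),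
        ifac_step hq (show (i : ℤ) = (i - 1) + 1 by ring)]
      rw [show (i : ℤ) * (x - y - (m + 1 : ℕ) + 1) = (i : ℤ) * (x - y - m + 1) - i by
            push_cast; ring,
          show -((m : ℤ) + 1 - i) = i - (m + 1) by ring]
      simp only [zpow_sub₀ hq0]
      have := zpow_ne_zero i hq0
      push_cast
      field_simp
    rw [e1, sum_range_succ, sum_range_succ' _ (m + 1)]
    rw [ifac_neg q (show (m : ℤ) - (m + 1 : ℕ) < 0 by push_cast; omega)]
    rw [ifac_neg q (show ((0 : ℕ) : ℤ) - 1 < 0 by simp)]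
    rw [ih hx y]
    have e2 : ∑ i ∈ range (m + 1), (-1) ^ (i + 1) *
          q ^ (((i + 1 : ℕ) : ℤ) * (x - y - m + 1) - (m + 1)) *
          (fac q (x + (i + 1 : ℕ)) * ifac q ((i + 1 : ℕ) - 1) * ifac q (m + 1 - (i + 1 : ℕ)) *
            ifac q (y + (i + 1 : ℕ))) =
        -q ^ (x - y - 2 * m) * (q ^ ((m : ℤ) * (x + 1 + 1)) * (fac q (x + 1) * ifac q m *
          ifac q (y + 1 + m)) * ∏ i ∈ range m, qInt q (y + 1 - (x + 1) + i)) := by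
      rw [← ih (by omega : 0 ≤ x + 1) (y + 1), mul_sum]
      refine sum_congr rfl fun i _ => ?_
      rw [show (((i + 1 : ℕ) : ℤ) * (x - y - m + 1) - (m + 1)) =
        (x - y - 2 * m) + (i : ℤ) * (x + 1 - (y + 1) - m + 1) by push_cast; ring,
        zpow_add₀ hq0]
      push_cast
      rw [show x + ((i : ℤ) + 1) = x + 1 + i by ring, show (i : ℤ) + 1 - 1 = i by ring,
        show (m : ℤ) + 1 - (i + 1) = m - i by ring, show y + ((i : ℤ) + 1) = y + 1 + i by ring]
      ring
    rw [e2]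
    simp only [mul_zero, zero_mul, add_zero, add_sub_add_right_eq_sub]
    rw [fac_step q hx rfl, prod_range_succ,
      ifac_step hq (show (y + 1 + m : ℤ) = (y + m) + 1 by ring),
      ifac_step hq (show (m + 1 : ℤ) = m + 1 by ring),
      show ((m + 1 : ℕ) : ℤ) * (x + 1) = m * (x + 1) + (x + 1) by push_cast; ring,
      show (m : ℤ) * (x + 1 + 1) = m * (x + 1) + m by ring,
      qInt_split hq (show (y + 1 + m : ℤ) = (y - x + m) + (x + 1) by ring),
      show x - y - 2 * (m : ℤ) = x - y - m - m by ring]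
    rw [show y - x + (m : ℤ) = -(x - y - m) by ring]
    push_cast
    rw [show y + ((m : ℤ) + 1) = y + 1 + m by ring]
    simp only [zpow_add₀ hq0, zpow_sub₀ hq0, zpow_neg, zpow_mul, zpow_one]
    have := zpow_ne_zero x hq0
    have := zpow_ne_zero y hq0
    have := zpow_ne_zero m hq0
    field_simp
    ring

lemma prod_qInt_pos {q : ℝ} (hq : 0 < q) (m : ℕ) {w : ℤ} (hw : 0 < w) :
    ∏ i ∈ range m, qInt q (w + i) = fac q (w + m - 1) * ifac q (w - 1) := by
  induction m with
  | zero => simp [fac_mul_ifac hq (show 0 ≤ w - 1 by omega)]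
  | succ m ih =>
    rw [prod_range_succ, ih, fac_step q (show 0 ≤ w + m - 1 by omega)
      (show w + (m + 1 : ℕ) - 1 = w + m - 1 + 1 by push_cast; ring)]
    push_cast
    rw [show w + ((m : ℤ) + 1) - 1 = w + m by ring]
    ring

lemma prod_qInt_nonpos {q : ℝ} (hq : 0 < q) (m : ℕ) {w : ℤ} (hw : w ≤ 0) :
    ∏ i ∈ range m, qInt q (w + i) = (-1) ^ m * (fac q (-w) * ifac q (-w - m)) := by
  induction m with
  | zero => simp [fac_mul_ifac hq (show 0 ≤ -w by omega)]
  | succ m ih =>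
    rw [prod_range_succ, ih, ifac_step hq (show -w - (m : ℤ) = -w - (m + 1 : ℕ) +
      1 by push_cast; ring),
      show w + (m : ℤ) = -(-w - m) by ring, qInt_neg]
    ring

/-! ### Transformations of terminating `₃F₂` series -/

lemma sum_range_shift {f : ℕ → ℝ} {n t : ℕ} (ht : t ≤ n) (h : ∀ s < t, f s = 0) :
    ∑ s ∈ range (n + 1), f s = ∑ r ∈ range (n - t + 1), f (t + r) := by
  rw [show n + 1 = t + (n - t + 1) by omega, sum_range_add,
    sum_eq_zero fun s hs => h s (mem_range.1 hs), zero_add]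

lemma sum_range_extend {f : ℕ → ℝ} {m n : ℕ} (hmn : m ≤ n) (h : ∀ s, m < s → f s = 0) :
    ∑ s ∈ range (m + 1), f s = ∑ s ∈ range (n + 1), f s := by
  apply sum_subset (range_subset_range.2 (by omega))
  intro s _ hs
  exact h s (by simpa using hs)

/-- The alternating terminating `₃F₂` with two numerator factorials increasing in `s`. -/
noncomputable def altSum (q : ℝ) (A B C D : ℤ) (n : ℕ) : ℝ :=
  ∑ s ∈ range (n + 1), (-1) ^ s * q ^ ((s : ℤ) * (A + B - C - D - n + 1)) *
    (fac q (A + s) * fac q (B + s) * ifac q s * ifac q (n - s) * ifac q (C + s) * ifac q (D + s))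

/-- The alternating terminating `₃F₂` with numerator factorials in both directions. -/
noncomputable def mixSum (q : ℝ) (x y C m : ℤ) (n : ℕ) : ℝ :=
  ∑ s ∈ range (n + 1), (-1) ^ s * q ^ ((s : ℤ) * (x + y + 1 - C - m - n)) *
    (fac q (y + s) * fac q (x - s) * ifac q s * ifac q (C + s) * ifac q (m - s) * ifac q (n - s))

/-- The terminating `₃F₂` with a single numerator factorial. -/
noncomputable def posSum (q : ℝ) (e x C l m : ℤ) (n : ℕ) : ℝ :=
  ∑ t ∈ range (n + 1), q ^ ((t : ℤ) * e) *
    (fac q (x + t) * ifac q t * ifac q (C + t) * ifac q (l + t) * ifac q (m - t) * ifac q (n - t))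

/-- The alternating terminating `₃F₂` without numerator factorials. -/
noncomputable def vdwSum (q : ℝ) (e C l m p : ℤ) (n : ℕ) : ℝ :=
  ∑ t ∈ range (n + 1), (-1) ^ t * q ^ ((t : ℤ) * e) *
    (ifac q t * ifac q (C + t) * ifac q (l + t) * ifac q (m - t) * ifac q (p - t) * ifac q (n - t))

/-- The quotient `[A + s]! / ([s]! [C + s]!)` is expanded by `vandermonde` into a sum over `t`
containing `1/[s - t]!`. After exchange, the sum over `s` starts at `t` and is an alternating
Vandermonde sum. The sign of `D - B` decides which kind of series results. -/
theorem altSum_eq {q : ℝ} (hq : 0 < q) {A B C : ℤ} (D : ℤ) (n : ℕ) (hA : 0 ≤ A) (hB : 0 ≤ B)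
    (hAC : C ≤ A) :
    altSum q A B C D n = q ^ ((n : ℤ) * (B + 1)) * (fac q (A - C) * fac q A * ifac q (D + n)) *
      ∑ t ∈ range (n + 1), (-1) ^ t * q ^ ((t : ℤ) * (A - D)) *
        (fac q (B + t) * ifac q t * ifac q (A - C - t) * ifac q (C + t) * ifac q (n - t) *
          ∏ i ∈ range (n - t), qInt q (D - B + i)) := by
  have hq0 := hq.ne'
  have e1 : ∀ s ∈ range (n + 1), (-1 : ℝ) ^ s * q ^ ((s : ℤ) * (A + B - C - D - n + 1)) *
      (fac q (A + s) * fac q (B + s) * ifac q s * ifac q (n - s) * ifac q (C + s) *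
        ifac q (D + s)) =
      ∑ t ∈ range (n + 1), (fac q (A - C) * fac q A) *
        (ifac q t * ifac q (A - C - t) * ifac q (C + t) * (q ^ ((t : ℤ) * A) * ((-1 : ℝ) ^ s *
          q ^ ((s : ℤ) * (B - D - n + t + 1)) *
          (fac q (B + s) * ifac q (s - t) * ifac q (n - s) * ifac q (D + s))))) := by
    intro s hs
    have hv := vandermonde hq s (A - C) C
    rw [show (s : ℤ) + (A - C) + C = A + s by ring, show A - C + C = A by ring] at hv
    -- The range of `t` is made independent of `s`, so that the sums can be exchanged; the added
    -- terms contain `1/[s - t]! = 0`.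
    rw [sum_range_extend (Nat.lt_succ_iff.1 (mem_range.1 hs))] at hv
    · have h1 := fac_mul_ifac hq (show 0 ≤ A - C by omega)
      have h2 := fac_mul_ifac hq hA
      have h4 : fac q (A + s) * ifac q s * ifac q (C + s) = fac q (A - C) * fac q A *
        (fac q (A + s) * (ifac q (A - C) * ifac q s * ifac q (s + C) * ifac q A)) := by
        rw [show (s : ℤ) + C = C + s by ring]
        linear_combination (-fac q (A + s) * ifac q s * ifac q (C + s)) * h1 -
          (fac q (A + s) * ifac q s * ifac q (C + s) * fac q (A - C) * ifac q (A - C)) * h2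
      rw [← hv] at h4
      have h5 : (-1 : ℝ) ^ s * q ^ ((s : ℤ) * (A + B - C - D - n + 1)) *
        (fac q (A + s) * fac q (B + s) * ifac q s * ifac q (n - s) * ifac q (C + s) *
          ifac q (D + s)) = (-1 : ℝ) ^ s * q ^ ((s : ℤ) * (A + B - C - D - n + 1)) *
        (fac q (B + s) * ifac q (n - s) * ifac q (D + s)) *
        (fac q (A + s) * ifac q s * ifac q (C + s)) := by ring
      rw [h5, h4, mul_sum, mul_sum]
      refine sum_congr rfl fun t _ => ?_
      have hz : q ^ ((s : ℤ) * (A + B - C - D - n + 1)) * q ^ ((t : ℤ) * (A + s) - s * (A - C)) =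
          q ^ ((t : ℤ) * A) * q ^ ((s : ℤ) * (B - D - n + t + 1)) := by
        rw [← zpow_add₀ hq0, ← zpow_add₀ hq0]
        congr 1
        ring
      linear_combination ((-1) ^ s * (fac q (B + s) * ifac q (n - s) * ifac q (D + s)) *
        (fac q (A - C) * fac q A) *
        (ifac q t * ifac q (s - t) * ifac q (A - C - t) * ifac q (C + t))) * hz
    · intro t ht
      rw [ifac_neg q (show (s : ℤ) - t < 0 by omega)]
      ring
  rw [altSum, sum_congr rfl e1, sum_comm, mul_sum]
  refine sum_congr rfl fun t ht => ?_
  have htn : t ≤ n := Nat.lt_succ_iff.1 (mem_range.1 ht)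
  rw [← mul_sum, ← mul_sum, ← mul_sum, sum_range_shift htn]
  · have hv := vandermonde_alternating hq (n - t) (show 0 ≤ B + t by omega) (D + t)
    rw [Nat.cast_sub htn] at hv
    rw [show D + t - (B + t) = D - B by ring, show D + (t : ℤ) + (n - t) = D + n by ring] at hv
    have e2 : ∑ r ∈ range (n - t + 1), (-1 : ℝ) ^ (t + r) *
          q ^ (((t + r : ℕ) : ℤ) * (B - D - n + t + 1)) *
          (fac q (B + (t + r : ℕ)) * ifac q ((t + r : ℕ) - t) * ifac q (n - (t + r : ℕ)) *
            ifac q (D + (t + r : ℕ))) =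
        (-1) ^ t * q ^ ((t : ℤ) * (B - D - n + t + 1)) *
        ∑ i ∈ range (n - t + 1), (-1) ^ i * q ^ ((i : ℤ) * (B + t - (D + t) - (n - t) + 1)) *
        (fac q (B + t + i) * ifac q i * ifac q (n - t - i) * ifac q (D + t + i)) := by
      rw [mul_sum]
      refine sum_congr rfl fun r _ => ?_
      push_cast
      rw [show (t + r : ℤ) * (B - D - n + t + 1) = t * (B - D - n + t + 1) +
        r * (B + t - (D + t) - (n - t) + 1) by ring, zpow_add₀ hq0, pow_add,
        show B + ((t : ℤ) + r) = B + t + r by ring, show (t : ℤ) + r - t = r by ring,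
        show (n : ℤ) - (t + r) = n - t - r by ring, show D + ((t : ℤ) + r) = D + t + r by ring]
      ring
    rw [e2, hv]
    have hz : q ^ ((n : ℤ) * (B + 1)) * q ^ ((t : ℤ) * (A - D)) =
        q ^ ((t : ℤ) * A) * q ^ ((t : ℤ) * (B - D - n + t + 1)) *
          q ^ (((n : ℤ) - t) * (B + t + 1)) := by
      rw [← zpow_add₀ hq0, ← zpow_add₀ hq0, ← zpow_add₀ hq0]
      congr 1
      ring
    linear_combination (-(fac q (A - C) * fac q A * ifac q (D + n)) * (-1) ^ t *
        (fac q (B + t) * ifac q t * ifac q (A - C - t) * ifac q (C + t) * ifac q (n - t) *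
          ∏ i ∈ range (n - t), qInt q (D - B + i))) * hz
  · intro s hs
    rw [ifac_neg q (show (s : ℤ) - t < 0 by omega)]
    ring

/-- The same mechanism, with `[x - s]! / ([m - s]! [n - s]!)` as the expanded quotient. The new
variable `t` runs upward from `s`, so the inner alternating sum is over `s ≤ t`. -/
theorem mixSum_eq {q : ℝ} (hq : 0 < q) {x y m : ℤ} (C : ℤ) (n : ℕ) (hy : 0 ≤ y)
    (hxm : m ≤ x) (hxn : n ≤ x) :
    mixSum q x y C m n = q ^ (-(n : ℤ) * m) * (fac q (x - m) * fac q (x - n) * fac q y) *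
      ∑ t ∈ range (n + 1), q ^ ((t : ℤ) * (x + y + 1)) *
        (ifac q t * ifac q (n - t) * ifac q (m - t) * ifac q (x - n - m + t) * ifac q (C + t) *
          ∏ i ∈ range t, qInt q (C - y + i)) := by
  have hq0 := hq.ne'
  have e1 : ∀ s ∈ range (n + 1), (-1 : ℝ) ^ s * q ^ ((s : ℤ) * (x + y + 1 - C - m - n)) *
      (fac q (y + s) * fac q (x - s) * ifac q s * ifac q (C + s) * ifac q (m - s) *
        ifac q (n - s)) =
      ∑ t ∈ range (n + 1), (fac q (x - m) * fac q (x - n)) *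
        (ifac q (n - t) * ifac q (m - t) * ifac q (x - n - m + t) * (q ^ ((t : ℤ) * x - n * m) *
          ((-1 : ℝ) ^ s * q ^ ((s : ℤ) * (y - C - t + 1)) *
          (fac q (y + s) * ifac q s * ifac q (t - s) * ifac q (C + s))))) := by
    intro s hs
    have hsn : s ≤ n := Nat.lt_succ_iff.1 (mem_range.1 hs)
    have hv := vandermonde hq (n - s) (m - s) (x - n - m + s)
    rw [Nat.cast_sub hsn] at hv
    have hsub : ∑ i ∈ range (n - s + 1),
        q ^ ((i : ℤ) * (n - s + (m - s) + (x - n - m + s)) - (n - s) * (m - s)) *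
        (ifac q i * ifac q (n - s - i) * ifac q (m - s - i) * ifac q (x - n - m + s + i)) =
        ∑ t ∈ range (n + 1), q ^ (((t : ℤ) - s) * (x - s) - (n - s) * (m - s)) *
        (ifac q (t - s) * ifac q (n - t) * ifac q (m - t) * ifac q (x - n - m + t)) := by
      rw [sum_range_shift (f := fun t : ℕ => q ^ (((t : ℤ) - s) * (x - s) - (n - s) * (m - s)) *
        (ifac q (t - s) * ifac q (n - t) * ifac q (m - t) * ifac q (x - n - m + t))) hsn]
      · refine sum_congr rfl fun i _ => ?_
        push_cast
        rw [show (n : ℤ) - s + (m - s) + (x - n - m + s) = x - s by ring,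
          show (s : ℤ) + i - s = i by ring, show (n : ℤ) - (s + i) = n - s - i by ring,
          show m - ((s : ℤ) + i) = m - s - i by ring,
          show x - n - m + ((s : ℤ) + i) = x - n - m + s + i by ring]
      · intro t ht
        rw [ifac_neg q (show (t : ℤ) - s < 0 by omega)]
        ring
    rw [hsub, show (n : ℤ) - s + (m - s) + (x - n - m + s) = x - s by ring,
      show (n : ℤ) - s + (x - n - m + s) = x - m by ring,
      show m - (s : ℤ) + (x - n - m + s) = x - n by ring] at hv
    have h1 := fac_mul_ifac hq (show 0 ≤ x - m by omega)
    have h2 := fac_mul_ifac hq (show 0 ≤ x - n by omega)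
    have h4 : fac q (x - s) * ifac q (m - s) * ifac q (n - s) = fac q (x - m) * fac q (x - n) *
        (fac q (x - s) * (ifac q (m - s) * ifac q (n - s) * ifac q (x - m) * ifac q (x - n))) := by
      linear_combination (-fac q (x - s) * ifac q (m - s) * ifac q (n - s)) * h1 -
          (fac q (x - s) * ifac q (m - s) * ifac q (n - s) * fac q (x - m) * ifac q (x - m)) * h2
    rw [← hv] at h4
    have h5 : (-1 : ℝ) ^ s * q ^ ((s : ℤ) * (x + y + 1 - C - m - n)) *
      (fac q (y + s) * fac q (x - s) * ifac q s * ifac q (C + s) * ifac q (m - s) *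
        ifac q (n - s)) = (-1 : ℝ) ^ s * q ^ ((s : ℤ) * (x + y + 1 - C - m - n)) *
      (fac q (y + s) * ifac q s * ifac q (C + s)) *
      (fac q (x - s) * ifac q (m - s) * ifac q (n - s)) := by ring
    rw [h5, h4, mul_sum, mul_sum]
    refine sum_congr rfl fun t _ => ?_
    have hz : q ^ ((s : ℤ) * (x + y + 1 - C - m - n)) *
        q ^ (((t : ℤ) - s) * (x - s) - (n - s) * (m - s)) =
        q ^ ((t : ℤ) * x - n * m) * q ^ ((s : ℤ) * (y - C - t + 1)) := by
      rw [← zpow_add₀ hq0, ← zpow_add₀ hq0]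
      congr 1
      ring
    linear_combination ((-1) ^ s * (fac q (y + s) * ifac q s * ifac q (C + s)) *
      (fac q (x - m) * fac q (x - n)) *
      (ifac q (t - s) * ifac q (n - t) * ifac q (m - t) * ifac q (x - n - m + t))) * hz
  rw [mixSum, sum_congr rfl e1, sum_comm, mul_sum]
  refine sum_congr rfl fun t ht => ?_
  have htn : t ≤ n := Nat.lt_succ_iff.1 (mem_range.1 ht)
  have hv := vandermonde_alternating hq t hy C
  rw [sum_range_extend htn] at hv
  · rw [← mul_sum, ← mul_sum, ← mul_sum, hv]
    rw [show (t : ℤ) * x - n * m = -(n : ℤ) * m + t * x by ring,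
      show (t : ℤ) * (x + y + 1) = t * x + t * (y + 1) by ring, zpow_add₀ hq0, zpow_add₀ hq0]
    ring
  · intro s hs
    rw [ifac_neg q (show (t : ℤ) - s < 0 by omega)]
    ring

/-- The case `D ≤ B` of `altSum_eq`. -/
theorem altSum_eq_posSum {q : ℝ} (hq : 0 < q) {A B C D : ℤ} (n : ℕ) (hA : 0 ≤ A) (hB : 0 ≤ B)
    (hAC : C ≤ A) (hBD : D ≤ B) :
    altSum q A B C D n = (-1) ^ n * q ^ ((n : ℤ) * (B + 1)) *
      (fac q (A - C) * fac q A * fac q (B - D) * ifac q (D + n)) *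
      posSum q (A - D) B C (B - D - n) (A - C) n := by
  rw [altSum_eq hq D n hA hB hAC, posSum, mul_sum, mul_sum]
  refine sum_congr rfl fun t ht => ?_
  have htn : t ≤ n := Nat.lt_succ_iff.1 (mem_range.1 ht)
  rw [prod_qInt_nonpos hq _ (show D - B ≤ 0 by omega), Nat.cast_sub htn, neg_sub,
    show B - D - ((n : ℤ) - t) = B - D - n + t by ring]
  have : (-1 : ℝ) ^ n = (-1) ^ t * (-1) ^ (n - t) := by rw [← pow_add]; congr 1; omega
  rw [this]
  ring

/-- The case `B < D` of `altSum_eq`. -/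
theorem altSum_eq_mixSum {q : ℝ} (hq : 0 < q) {A B C D : ℤ} (n : ℕ) (hA : 0 ≤ A) (hB : 0 ≤ B)
    (hAC : C ≤ A) (hBD : B < D) :
    altSum q A B C D n = q ^ ((n : ℤ) * (B + 1)) *
      (fac q (A - C) * fac q A * ifac q (D - B - 1) * ifac q (D + n)) *
      mixSum q⁻¹ (D - B - 1 + n) B C (A - C) n := by
  rw [altSum_eq hq D n hA hB hAC, mixSum, mul_sum, mul_sum]
  refine sum_congr rfl fun t ht => ?_
  have htn : t ≤ n := Nat.lt_succ_iff.1 (mem_range.1 ht)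
  rw [prod_qInt_pos hq _ (show 0 < D - B by omega), Nat.cast_sub htn, inv_zpow', 
    show D - B + ((n : ℤ) - t) - 1 = D - B - 1 + n - t by ring]
  simp only [fac_inv hq, ifac_inv hq]
  rw [show -((t : ℤ) * (D - B - 1 + n + B + 1 - C - (A - C) - n)) = t * (A - D) by ring]
  ring

/-- The case `y < C` of `mixSum_eq`. -/
theorem mixSum_eq_posSum {q : ℝ} (hq : 0 < q) {x y C m : ℤ} (n : ℕ) (hy : 0 ≤ y)
    (hxm : m ≤ x) (hxn : n ≤ x) (hyC : y < C) :
    mixSum q x y C m n = q ^ (-(n : ℤ) * m) *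
      (fac q (x - m) * fac q (x - n) * fac q y * ifac q (C - y - 1)) *
      posSum q (x + y + 1) (C - y - 1) C (x - n - m) m n := by
  rw [mixSum_eq hq C n hy hxm hxn, posSum, mul_sum, mul_sum]
  refine sum_congr rfl fun t ht => ?_
  rw [prod_qInt_pos hq _ (show 0 < C - y by omega), 
    show C - y + (t : ℤ) - 1 = C - y - 1 + t by ring]
  ring

/-- The case `C ≤ y` of `mixSum_eq`. -/
theorem mixSum_eq_vdwSum {q : ℝ} (hq : 0 < q) {x y C m : ℤ} (n : ℕ) (hy : 0 ≤ y)
    (hxm : m ≤ x) (hxn : n ≤ x) (hyC : C ≤ y) :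
    mixSum q x y C m n = q ^ (-(n : ℤ) * m) *
      (fac q (x - m) * fac q (x - n) * fac q y * fac q (y - C)) *
      vdwSum q (x + y + 1) C (x - n - m) m (y - C) n := by
  rw [mixSum_eq hq C n hy hxm hxn, vdwSum, mul_sum, mul_sum]
  refine sum_congr rfl fun t ht => ?_
  rw [prod_qInt_nonpos hq _ (show C - y ≤ 0 by omega), neg_sub]
  ring

/-- Two transformations in succession, `altSum` to `mixSum` at `q⁻¹` and then to `vdwSum`, with the
pairs `(A, C)` and `(B, D)` exchanged beforehand. A series without numerator factorials is easily
reversed or shifted, and so serves as a common normal form for comparing different `altSum`s. -/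
theorem altSum_eq_vdwSum {q : ℝ} (hq : 0 < q) {A B C D : ℤ} (n : ℕ) (hA : 0 ≤ A) (hB : 0 ≤ B)
    (hAC : A < C) (hAD : D ≤ A) (hBD : D ≤ B) (h : B - D ≤ C - A - 1 + n) :
    altSum q A B C D n = q ^ ((n : ℤ) * (A + B - D + 1)) *
      (fac q A * fac q B * fac q (A - D) * fac q (B - D) * fac q (C - A - 1 + n - (B - D)) *
        ifac q (C + n)) *
      vdwSum q (-(C + n)) D (C - A - 1 - (B - D)) (B - D) (A - D) n := by
  have hq0 := hq.ne'
  have e1 : altSum q A B C D n = altSum q B A D C n := by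
    unfold altSum
    refine sum_congr rfl fun s _ => ?_
    rw [show B + A - D - C - (n : ℤ) + 1 = A + B - C - D - n + 1 by ring]
    ring
  have e2 : ∀ e C l m p : ℤ, vdwSum q⁻¹ e C l m p n = vdwSum q (-e) C l m p n := by
    intro e C l m p
    unfold vdwSum
    refine sum_congr rfl fun s _ => ?_
    simp only [ifac_inv hq]
    rw [inv_zpow', mul_neg]
  rw [e1, altSum_eq_mixSum hq n hB hA hBD hAC,
    mixSum_eq_vdwSum (inv_pos.2 hq) n hA h (by omega) hAD, e2]
  simp only [fac_inv hq]
  rw [show C - A - 1 + (n : ℤ) - n = C - A - 1 by ring, inv_zpow',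
    show -(-(n : ℤ) * (B - D)) = n * (B - D) by ring,
    show (n : ℤ) * (A + B - D + 1) = n * (A + 1) + n * (B - D) by ring, zpow_add₀ hq0,
    show -(C - A - 1 + n + A + 1) = -(C + (n : ℤ)) by ring]
  linear_combination (q ^ (↑n * (A + 1)) * q ^ (↑n * (B - D)) *
      (fac q A * fac q B * fac q (A - D) * fac q (B - D) * fac q (C - A - 1 + n - (B - D)) *
        ifac q (C + n)) *
      vdwSum q (-(C + n)) D (C - A - 1 - (B - D)) (B - D) (A - D) n) *
      fac_mul_ifac hq (show 0 ≤ C - A - 1 by omega)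

/-! ### Balanced and well-poised summations -/

lemma qInt_mul_sub' {q : ℝ} (hq : 0 < q) {a b c d x y : ℤ} (h : a + d = b + c)
    (hx : x = a - c) (hy : y = a + d) :
    qInt q a * qInt q b - qInt q c * qInt q d = qInt q x * qInt q y := by
  have := qInt_mul_sub hq (a := a) (b := -b) (c := c) (d := -d) (x := x) (y := -y)
    (by omega) hx (by omega)
  simp only [qInt_neg] at this
  linarith

/-- The pattern of a Wilf–Zeilberger proof: each closed form of this part follows from a first-order
recurrence in one parameter, whose certificate is `G`. -/
lemma sum_telescope {f G : ℕ → ℝ} {n : ℕ} (h : ∀ r ≤ n, f r = G r - G (r + 1)) (h0 : G 0 = 0)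
    (h1 : G (n + 1) = 0) : ∑ r ∈ range (n + 1), f r = 0 := by
  rw [sum_congr rfl fun r hr => h r (Nat.lt_succ_iff.1 (mem_range.1 hr)), sum_range_sub', h0, h1,
    sub_zero]

/-- The sums for `(N + 1, Q)` and `(N, Q + 1)` have the same numerator factorial and satisfy a
first-order recurrence by telescoping; hence the induction on `N` with `Q` left general. -/
theorem saalschutz_nat {q : ℝ} (hq : 0 < q) (N : ℕ) (K P Q : ℤ) :
    ∑ r ∈ range (N + 1), fac q (N + K + P + Q + r) *
        (ifac q r * ifac q (N - r) * ifac q (K - r) * ifac q (P + r) * ifac q (Q + r)) =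
      fac q (N + K + P + Q) * fac q (N + K + P) * fac q (N + K + Q) *
        (ifac q N * ifac q K * ifac q (N + P) * ifac q (N + Q) * ifac q (K + P) *
          ifac q (K + Q)) := by
  rcases lt_or_ge (N + K + P + Q) 0 with hM | hM
  · rw [fac_neg q hM, zero_mul, zero_mul, zero_mul]
    refine sum_eq_zero fun r _ => ?_
    rcases lt_or_ge ((N : ℤ) - r) 0 with h | h1
    · rw [ifac_neg q h]; ring
    rcases lt_or_ge (K - r) 0 with h | h2
    · rw [ifac_neg q h]; ring
    rcases lt_or_ge (P + r) 0 with h | h3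
    · rw [ifac_neg q h]; ring
    · rw [ifac_neg q (show Q + r < 0 by omega)]; ring
  rcases lt_or_ge K 0 with hK | hK
  · rw [ifac_neg q hK]
    simp only [mul_zero, zero_mul]
    refine sum_eq_zero fun r _ => ?_
    rw [ifac_neg q (show K - r < 0 by omega)]
    ring
  induction N generalizing Q with
  | zero =>
    simp only [zero_add, sum_range_one, Nat.cast_zero, sub_zero, add_zero, ifac_zero, one_mul]
    rw [Nat.cast_zero, zero_add] at hM
    rcases lt_or_ge P 0 with hP | hP
    · rw [ifac_neg q hP]; ring
    rcases lt_or_ge Q 0 with hQ | hQ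
    · rw [ifac_neg q hQ]; ring
    · linear_combination (-fac q (K + P + Q) * ifac q K * ifac q P * ifac q Q) *
        (fac_mul_ifac hq (show 0 ≤ K + P by omega) + fac q (K + P) * ifac q (K + P) *
          fac_mul_ifac hq (show 0 ≤ K + Q by omega))
  | succ N ih =>
    -- The recurrence determines the sum only if `[N + 1][N + 1 + P] ≠ 0`. For `N + 1 + P < 0` both
    -- sides vanish, and for `N + 1 + P = 0` only the last term survives.
    rcases lt_trichotomy ((N : ℤ) + 1 + P) 0 with hP | hP | hP
    · rw [ifac_neg q (show ((N + 1 : ℕ) : ℤ) + P < 0 by push_cast; omega)]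
      simp only [mul_zero, zero_mul]
      refine sum_eq_zero fun r hr => ?_
      have := mem_range.1 hr
      rw [ifac_neg q (show P + r < 0 by omega)]
      ring
    · rw [sum_eq_single_of_mem (N + 1) (by simp)]
      · have hP' : P = -(N + 1) := by omega
        subst hP'
        push_cast at hM ⊢
        rw [show (N : ℤ) + 1 + K + -(N + 1) + Q = K + Q by ring,
          show (N : ℤ) + 1 - (N + 1) = 0 by ring, show -((N : ℤ) + 1) + (N + 1) = 0 by ring,
          show (N : ℤ) + 1 + K + -(N + 1) = K by ring, show (N : ℤ) + 1 + -(N + 1) = 0 by ring,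
          ifac_zero, show K + Q + ((N : ℤ) + 1) = N + 1 + K + Q by ring,
          show K - ((N : ℤ) + 1) = K + -(N + 1) by ring, show Q + ((N : ℤ) + 1) = N + 1 + Q by ring]
        linear_combination (-fac q (N + 1 + K + Q) * ifac q (N + 1) * ifac q (K + -(N + 1)) *
          ifac q (N + 1 + Q)) * (fac_mul_ifac hq hK + fac q K * ifac q K *
          fac_mul_ifac hq (show 0 ≤ K + Q by omega))
      · intro r hr hr'
        have := mem_range.1 hr
        rw [ifac_neg q (show P + r < 0 by omega)]
        ring
    · have hih := ih (Q + 1) (by push_cast at hM; omega)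
      have h1 : qInt q (N + 1) * qInt q (N + 1 + P) ≠ 0 :=
        mul_ne_zero (qInt_pos hq (by omega)).ne' (qInt_pos hq (by omega)).ne'
      apply mul_left_cancel₀ h1
      have key : qInt q (N + 1) * qInt q (N + 1 + P) * ∑ r ∈ range (N + 1 + 1),
          fac q ((N + 1 : ℕ) + K + P + Q + r) *
          (ifac q r * ifac q ((N + 1 : ℕ) - r) * ifac q (K - r) * ifac q (P + r) *
            ifac q (Q + r)) - qInt q (N + K + P + 1) * qInt q (K + Q + 1) *
          ∑ r ∈ range (N + 1 + 1), fac q (N + K + P + (Q + 1) + r) *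
          (ifac q r * ifac q (N - r) * ifac q (K - r) * ifac q (P + r) *
            ifac q (Q + 1 + r)) = 0 := by
        rw [mul_sum, mul_sum, ← sum_sub_distrib]
        -- The certificate is essentially the common summand with `[r]!` and `[P + r]!` lowered by
        -- one step; the telescoping relation then reduces to two instances, `i1` and `i2`, of the
        -- quadratic relation.
        apply sum_telescope (G := fun r : ℕ => fac q (N + K + P + (Q + 1) + r) *
          (ifac q (r - 1) * ifac q (N + 1 - r) * ifac q (K - r) * ifac q (P + r - 1) *
            ifac q (Q + r)))
        · intro r _
          push_cast
          rw [show (N : ℤ) + 1 + K + P + Q + r = N + K + P + (Q + 1) + r by ring,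
            show (r : ℤ) + 1 - 1 = r by ring, show P + ((r : ℤ) + 1) - 1 = P + r by ring,
            show Q + ((r : ℤ) + 1) = Q + 1 + r by ring]
          push_cast at hM
          rw [fac_step q (show 0 ≤ N + K + P + (Q + 1) + (r : ℤ) by omega)
              (show N + K + P + (Q + 1) + ((r : ℤ) + 1) = N + K + P + (Q + 1) + r + 1 by ring),
            ifac_step hq (show (r : ℤ) = r - 1 + 1 by ring),
            ifac_step hq (show (N : ℤ) + 1 - r = (N - r) + 1 by ring),
            ifac_step hq (show (N : ℤ) + 1 - r = (N + 1 - (r + 1)) + 1 by ring),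
            ifac_step hq (show K - (r : ℤ) = K - (r + 1) + 1 by ring),
            ifac_step hq (show P + (r : ℤ) = P + r - 1 + 1 by ring),
            ifac_step hq (show Q + 1 + (r : ℤ) = Q + r + 1 by ring)]
          have i1 := qInt_mul_sub hq (a := N + K + P + 1) (b := K + Q + 1)
            (c := N + K + P + (Q + 1) + r + 1) (d := K - r) (by ring)
            (show -(Q + 1 + r) = _ by ring) (show -(N + P + 1 + r) = _ by ring)
          have i2 := qInt_mul_sub hq (a := N + 1) (b := N + 1 + P)
            (c := N + 1 - r) (d := N + P + 1 + r) (by ring)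
            (show (r : ℤ) = _ by ring) (show P + r = _ by ring)
          rw [qInt_neg, qInt_neg] at i1
          rw [show N + K + P + (Q + 1) + ((r : ℤ) + 1) = N + K + P + (Q + 1) + r + 1 by ring]
          linear_combination (fac q (N + K + P + (Q + 1) + r) * ifac q r * ifac q (N + 1 - r) *
            ifac q (K - r) * ifac q (P + r) * ifac q (Q + 1 + r)) *
            (qInt q (Q + 1 + r) * i2 - qInt q (N + 1 - r) * i1)
        · simp [ifac_neg]
        · push_cast
          rw [ifac_neg q (show (N : ℤ) + 1 - (N + 1 + 1) < 0 by omega)]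
          ring
      have e1 : ∑ r ∈ range (N + 1 + 1), fac q (N + K + P + (Q + 1) + r) *
          (ifac q r * ifac q (N - r) * ifac q (K - r) * ifac q (P + r) *
            ifac q (Q + 1 + r)) = ∑ r ∈ range (N + 1), fac q (N + K + P + (Q + 1) + r) *
          (ifac q r * ifac q (N - r) * ifac q (K - r) * ifac q (P + r) *
            ifac q (Q + 1 + r)) := by
        rw [sum_range_succ, ifac_neg q (show (N : ℤ) - (N + 1 : ℕ) < 0 by push_cast; omega)]
        ring
      rw [e1, hih, sub_eq_zero] at key
      rw [key]
      push_cast at hM ⊢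
      rw [show (N : ℤ) + 1 + K + P + Q = N + K + P + (Q + 1) by ring,
        show (N : ℤ) + 1 + K + Q = N + K + (Q + 1) by ring,
        show (N : ℤ) + 1 + Q = N + (Q + 1) by ring,
        ifac_step hq (show (N : ℤ) + 1 = N + 1 by ring),
        ifac_step hq (show (N : ℤ) + 1 + P = N + P + 1 by ring),
        ifac_step hq (show K + (Q + 1) = K + Q + 1 by ring),
        show K + Q + 1 = K + (Q + 1) by ring]
      rcases lt_or_ge (K + P) 0 with h | h
      · rw [ifac_neg q h]; ring
      · rw [fac_step q (show 0 ≤ N + K + P by omega)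
          (show (N : ℤ) + 1 + K + P = N + K + P + 1 by ring)]
        ring_nf

/-- The `q`-Pfaff–Saalschütz sum. -/
theorem saalschutz {q : ℝ} (hq : 0 < q) {L : ℕ} {N : ℤ} (K P Q : ℤ) (hL : N ≤ L) {M : ℤ}
    (hM : M = N + K + P + Q) :
    ∑ r ∈ range (L + 1), fac q (M + r) *
        (ifac q r * ifac q (N - r) * ifac q (K - r) * ifac q (P + r) * ifac q (Q + r)) =
      fac q M * fac q (N + K + P) * fac q (N + K + Q) *
        (ifac q N * ifac q K * ifac q (N + P) * ifac q (N + Q) * ifac q (K + P) *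
          ifac q (K + Q)) := by
  subst hM
  rcases lt_or_ge N 0 with hN | hN
  · rw [ifac_neg q hN]
    simp only [mul_zero, zero_mul]
    refine sum_eq_zero fun r _ => ?_
    rw [ifac_neg q (show N - r < 0 by omega)]
    ring
  · obtain ⟨N, rfl⟩ := Int.eq_ofNat_of_zero_le hN
    rw [← saalschutz_nat hq, ← sum_range_extend (by exact_mod_cast hL)]
    intro r hr
    rw [ifac_neg q (show (N : ℤ) - r < 0 by omega)]
    ring

/-- A balanced sum with decreasing numerator factorials, proved by a recurrence in `k`. It is meant
to be read from right to left, as an expansion that introduces a new summation variable into Racah's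
sum. -/
theorem saalschutz_desc {q : ℝ} (hq : 0 < q) (k : ℕ) {A B C D : ℤ} (hB : B = C + D - 1 - A)
    (hB0 : 0 ≤ B) (hAC : C ≤ A) (hAD : D ≤ A) (hk : k ≤ A) :
    ∑ u ∈ range (k + 1), (-1) ^ u * (fac q (A - u) * fac q (B + k - u) *
        (ifac q u * ifac q (k - u) * ifac q (C - u) * ifac q (D - u))) =
      (-1) ^ k * (fac q (A - k) * fac q B * fac q (A - C) * fac q (A - D) *
        (ifac q k * ifac q (A - C - k) * ifac q (A - D - k) * ifac q C * ifac q D)) := by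
  induction k with
  | zero =>
    simp only [zero_add, sum_range_one, Nat.cast_zero, sub_zero, add_zero, ifac_zero, pow_zero]
    linear_combination (-fac q A * fac q B * ifac q C * ifac q D) *
      (fac_mul_ifac hq (show 0 ≤ A - C by omega) + fac q (A - C) * ifac q (A - C) *
        fac_mul_ifac hq (show 0 ≤ A - D by omega))
  | succ k ih =>
    push_cast at hk
    have hih := ih (by omega)
    have h1 : qInt q (k + 1) * qInt q (A - k) ≠ 0 :=
        mul_ne_zero (qInt_pos hq (by omega)).ne' (qInt_pos hq (by omega)).ne'
    apply mul_left_cancel₀ h1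
    have key : qInt q (k + 1) * qInt q (A - k) * ∑ u ∈ range (k + 1 + 1),
        (-1) ^ u * (fac q (A - u) * fac q (B + (k + 1 : ℕ) - u) *
        (ifac q u * ifac q ((k + 1 : ℕ) - u) * ifac q (C - u) * ifac q (D - u))) +
        qInt q (A - C - k) * qInt q (A - D - k) * ∑ u ∈ range (k + 1 + 1),
        (-1) ^ u * (fac q (A - u) * fac q (B + k - u) *
        (ifac q u * ifac q (k - u) * ifac q (C - u) * ifac q (D - u))) = 0 := by
      rw [mul_sum, mul_sum, ← sum_add_distrib]
      apply sum_telescope (G := fun u : ℕ => (-1) ^ u * (fac q (A + 1 - u) *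
        fac q (B + k + 1 - u) *
        (ifac q (u - 1) * ifac q (k + 1 - u) * ifac q (C - u) * ifac q (D - u))))
      · intro u hu
        push_cast
        have i1 := qInt_mul_sub hq (a := k + 1) (b := A - k) (c := u) (d := A + 1 - u) (by ring)
          (show (k : ℤ) + 1 - u = _ by ring) (show A - u - k = _ by ring)
        rw [show (u : ℤ) + 1 - 1 = u by ring,
          fac_step q (show 0 ≤ A - (u : ℤ) by omega) (show A + 1 - (u : ℤ) = A - u + 1 by ring),
          ifac_step hq (show (u : ℤ) = u - 1 + 1 by ring),
          ifac_step hq (show C - (u : ℤ) = C - (u + 1) + 1 by ring),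
          ifac_step hq (show D - (u : ℤ) = D - (u + 1) + 1 by ring),
          show A + 1 - ((u : ℤ) + 1) = A - u by ring,
          show B + ((k : ℤ) + 1) - u = B + k + 1 - u by ring,
          show (k : ℤ) + 1 - (u + 1) = k - u by ring,
          show B + (k : ℤ) + 1 - (u + 1) = B + k - u by ring]
        -- At `u = k + 1` the argument `B + k - u` may equal `-1`, where the factorial recursion
        -- fails; the term of the shorter sum is zero there because of `1/[k - u]!`.
        rcases Nat.lt_or_ge k u with hku | hku
        · have : u = k + 1 := by omega
          subst this
          push_cast
          rw [ifac_neg q (show (k : ℤ) - (k + 1) < 0 by omega)] at *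
          push_cast at i1
          rw [show (k : ℤ) + 1 - (k + 1) = 0 by ring, qInt_zero] at i1
          linear_combination ((-1) ^ (k + 1) * fac q (A - (k + 1)) *
            fac q (B + k + 1 - (k + 1)) * ifac q (k + 1) * ifac q (k + 1 - (k + 1)) *
            ifac q (C - (k + 1)) * ifac q (D - (k + 1))) * i1
        · rw [fac_step q (show 0 ≤ B + k - (u : ℤ) by omega)
              (show B + k + 1 - (u : ℤ) = B + k - u + 1 by ring),
            ifac_step hq (show (k : ℤ) + 1 - u = k - u + 1 by ring)]
          have i2 := qInt_mul_sub hq (a := C - u) (b := D - u) (c := A - u - k)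
            (d := B + k + 1 - u) (by omega) (show -(A - C - k) = _ by ring)
            (show -(A - D - k) = _ by omega)
          rw [qInt_neg, qInt_neg] at i2
          rw [pow_succ]
          linear_combination ((-1) ^ u * fac q (A - u) *
            fac q (B + k - u) * ifac q u * ifac q (k + 1 - u) *
            ifac q (C - u) * ifac q (D - u)) * (qInt q (B + k + 1 - u) * i1 -
              qInt q (k + 1 - u) * i2)
      · simp [ifac_neg]
      · push_cast
        rw [ifac_neg q (show (k : ℤ) + 1 - (k + 1 + 1) < 0 by omega)]
        ring
    rw [sum_range_succ (fun u : ℕ => (-1 : ℝ) ^ u * (fac q (A - u) * fac q (B + k - u) *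
        (ifac q u * ifac q (k - u) * ifac q (C - u) * ifac q (D - u)))),
      ifac_neg q (show (k : ℤ) - (k + 1 : ℕ) < 0 by push_cast; omega), hih] at key
    push_cast at key ⊢
    rw [fac_step q (show 0 ≤ A - ((k : ℤ) + 1) by omega) (show A - k = A - (k + 1) + 1 by ring),
      ifac_step hq (show (k : ℤ) + 1 = k + 1 by ring)] at key
    rw [ifac_step hq (show A - C - (k : ℤ) = A - C - (k + 1) + 1 by ring),
      ifac_step hq (show A - D - (k : ℤ) = A - D - (k + 1) + 1 by ring)]
    linear_combination key

/-- The counterpart of `saalschutz_desc` with increasing numerator factorials, also used from right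
to left. The parameter `δ - k` moves with `k` so that the sum is balanced for every `k`. -/
theorem saalschutz_asc {q : ℝ} (hq : 0 < q) (k : ℕ) {α β γ δ : ℤ} (hδ : δ = α + β + 1 - γ)
    (hα : 0 ≤ α) (hβ : 0 ≤ β) (hαγ : γ ≤ α) (hβγ : γ ≤ β) :
    ∑ u ∈ range (k + 1), (-1) ^ u * (fac q (α + u) * fac q (β + u) *
        (ifac q u * ifac q (k - u) * ifac q (γ + u) * ifac q (δ - k + u))) =
      (-1) ^ k * (fac q α * fac q β * fac q (α - γ) * fac q (β - γ) *
        (ifac q k * ifac q (α - γ - k) * ifac q (β - γ - k) * ifac q (γ + k) * ifac q δ)) := by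
  induction k with
  | zero =>
    simp only [zero_add, sum_range_one, Nat.cast_zero, sub_zero, add_zero, ifac_zero, pow_zero]
    linear_combination (-fac q α * fac q β * ifac q γ * ifac q δ) *
      (fac_mul_ifac hq (show 0 ≤ α - γ by omega) + fac q (α - γ) * ifac q (α - γ) *
        fac_mul_ifac hq (show 0 ≤ β - γ by omega))
  | succ k ih =>
    rcases lt_trichotomy (γ + (k + 1)) 0 with hP | hP | hP
    · rw [ifac_neg q (show γ + ((k + 1 : ℕ) : ℤ) < 0 by push_cast; omega)]
      simp only [mul_zero, zero_mul]
      refine sum_eq_zero fun r hr => ?_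
      have := mem_range.1 hr
      rw [ifac_neg q (show γ + r < 0 by omega)]
      ring
    · rw [sum_eq_single_of_mem (k + 1) (by simp)]
      · have hP' : γ = -(k + 1) := by omega
        subst hP'
        push_cast
        rw [show (k : ℤ) + 1 - (k + 1) = 0 by ring, show -((k : ℤ) + 1) + (k + 1) = 0 by ring,
          show δ - ((k : ℤ) + 1) + (k + 1) = δ by ring,
          show α - -((k : ℤ) + 1) - (k + 1) = α by ring,
          show β - -((k : ℤ) + 1) - (k + 1) = β by ring, ifac_zero,
          show α - -((k : ℤ) + 1) = α + (k + 1) by ring,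
          show β - -((k : ℤ) + 1) = β + (k + 1) by ring]
        linear_combination (-(-1) ^ (k + 1) * fac q (α + (k + 1)) * fac q (β + (k + 1)) *
          ifac q (k + 1) * ifac q δ) * (fac_mul_ifac hq hα + fac q α * ifac q α *
          fac_mul_ifac hq hβ)
      · intro r hr hr'
        have := mem_range.1 hr
        rw [ifac_neg q (show γ + r < 0 by omega)]
        ring
    · have h1 : qInt q (k + 1) * qInt q (γ + (k + 1)) ≠ 0 :=
        mul_ne_zero (qInt_pos hq (by omega)).ne' (qInt_pos hq (by omega)).ne'
      apply mul_left_cancel₀ h1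
      have key : qInt q (k + 1) * qInt q (γ + (k + 1)) * ∑ u ∈ range (k + 1 + 1),
          (-1) ^ u * (fac q (α + u) * fac q (β + u) *
          (ifac q u * ifac q ((k + 1 : ℕ) - u) * ifac q (γ + u) *
            ifac q (δ - (k + 1 : ℕ) + u))) +
          qInt q (α - γ - k) * qInt q (β - γ - k) * ∑ u ∈ range (k + 1 + 1),
          (-1) ^ u * (fac q (α + u) * fac q (β + u) *
          (ifac q u * ifac q (k - u) * ifac q (γ + u) * ifac q (δ - k + u))) = 0 := by
        rw [mul_sum, mul_sum, ← sum_add_distrib]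
        apply sum_telescope (G := fun u : ℕ => (-1) ^ u * (fac q (α + u) * fac q (β + u) *
          (ifac q (u - 1) * ifac q (k + 1 - u) * ifac q (γ + u - 1) *
            ifac q (δ - (k + 1) + u))))
        · intro u hu
          push_cast
          have i1 := qInt_mul_sub' hq (a := k + 1) (b := γ + (k + 1)) (c := u) (d := γ + u)
            (by ring) (show (k : ℤ) + 1 - u = _ by ring) (show γ + k + 1 + u = _ by ring)
          have i2 := qInt_mul_sub hq (a := α + u + 1) (b := β + u + 1) (c := γ + k + 1 + u)
            (d := δ - k + u) (by omega) (show α - γ - k = _ by ring)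
            (show β - γ - k = _ by omega)
          rw [show (u : ℤ) + 1 - 1 = u by ring, show γ + ((u : ℤ) + 1) - 1 = γ + u by ring,
            fac_step q (show 0 ≤ α + (u : ℤ) by omega)
              (show α + ((u : ℤ) + 1) = α + u + 1 by ring),
            fac_step q (show 0 ≤ β + (u : ℤ) by omega)
              (show β + ((u : ℤ) + 1) = β + u + 1 by ring),
            ifac_step hq (show (u : ℤ) = u - 1 + 1 by ring),
            ifac_step hq (show γ + (u : ℤ) = γ + u - 1 + 1 by ring),
            ifac_step hq (show (k : ℤ) + 1 - u = k - u + 1 by ring),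
            ifac_step hq (show (k : ℤ) + 1 - u = k + 1 - (u + 1) + 1 by ring),
            ifac_step hq (show δ - k + (u : ℤ) = δ - (k + 1) + u + 1 by ring),
            show δ - ((k : ℤ) + 1) + (u + 1) = δ - k + u by ring,
            show α + ((u : ℤ) + 1) = α + u + 1 by ring,
            show β + ((u : ℤ) + 1) = β + u + 1 by ring, pow_succ]
          linear_combination ((-1) ^ u * fac q (α + u) *
            fac q (β + u) * ifac q u * ifac q (k + 1 - u) *
            ifac q (γ + u) * ifac q (δ - k + u)) * (qInt q (δ - k + u) * i1 -
              qInt q (k + 1 - u) * i2)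
        · simp [ifac_neg]
        · push_cast
          rw [ifac_neg q (show (k : ℤ) + 1 - (k + 1 + 1) < 0 by omega)]
          ring
      rw [sum_range_succ (fun u : ℕ => (-1 : ℝ) ^ u * (fac q (α + u) * fac q (β + u) *
          (ifac q u * ifac q (k - u) * ifac q (γ + u) * ifac q (δ - k + u)))),
        ifac_neg q (show (k : ℤ) - (k + 1 : ℕ) < 0 by push_cast; omega), ih] at key
      push_cast at key ⊢
      rw [ifac_step hq (show γ + ((k : ℤ) + 1) = γ + k + 1 by ring),
        ifac_step hq (show (k : ℤ) + 1 = k + 1 by ring)] at key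
      rw [ifac_step hq (show α - γ - (k : ℤ) = α - γ - (k + 1) + 1 by ring),
        ifac_step hq (show β - γ - (k : ℤ) = β - γ - (k + 1) + 1 by ring)]
      linear_combination key

/-- The algebraic content of the telescoping step in `well_poised_sum`, where `a = m + 1 - i`, `b =
m + X + 2 + i` and `p = y + i + 1`, so that `b - a` is the very-well-poised factor `2i + X + 1`. -/
lemma well_poised_identity {q : ℝ} (hq : 0 < q) (a b i p : ℤ) :
    qInt q (b - a) * (qInt q (a + i) * qInt q (b - p) - q ^ (i - p) * (qInt q a * qInt q b)) =
      q ^ (-a) * (qInt q i * qInt q (b - a - p) * qInt q b) -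
        q ^ (-b) * (qInt q (b - a - i) * qInt q p * qInt q a) := by
  by_cases h1 : q = 1
  · simp [qInt, qNum, h1]; ring
  · simp only [qInt_eq h1]
    have h2 := sub_inv_ne_zero hq h1
    have hq0 := hq.ne'
    simp only [neg_sub, neg_add, zpow_add₀ hq0, zpow_sub₀ hq0, zpow_neg]
    have ha : q ^ a ≠ 0 := zpow_ne_zero _ hq0
    have hc : q ^ b ≠ 0 := zpow_ne_zero _ hq0
    have hd : q ^ i ≠ 0 := zpow_ne_zero _ hq0
    have hp : q ^ p ≠ 0 := zpow_ne_zero _ hq0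
    generalize q - q⁻¹ = w at *
    field_simp
    ring

/-- A terminating very-well-poised summation. -/
theorem well_poised_sum {q : ℝ} (hq : 0 < q) (m : ℕ) (X : ℤ) {y : ℤ} (hy : 0 ≤ y) :
    ∑ i ∈ range (m + 1), qInt q (2 * i + X + 1) * q ^ (-(i : ℤ) * (i + X + 1)) *
        (fac q (X + i) * ifac q i * fac q (y + i) * ifac q (X - y + i) * ifac q (m - i) *
          ifac q (m + X + 1 + i)) =
      q ^ (-(m : ℤ) * (y + 1)) * (fac q y * ifac q m * ifac q (m + X - y)) := by
  have hq0 := hq.ne'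
  induction m with
  | zero =>
    simp only [zero_add, sum_range_one, Nat.cast_zero, sub_zero, add_zero, ifac_zero, neg_zero,
      zero_mul, zpow_zero, mul_zero, mul_one, one_mul]
    rcases lt_or_ge X y with h | h
    · rw [ifac_neg q (show X - y < 0 by omega)]; ring
    · have h1 := fac_mul_ifac hq (show 0 ≤ X + 1 by omega)
      rw [fac_step q (show 0 ≤ X by omega) rfl] at h1
      linear_combination (fac q y * ifac q (X - y)) * h1
  | succ m ih =>
    -- The recurrence has the coefficient `[m + 1][m + 1 + X - y]`. If the second factor is zero,
    -- only the term `i = m + 1` survives; if its argument is negative, both sides vanish.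
    rcases lt_trichotomy ((m : ℤ) + 1 + X - y) 0 with hP | hP | hP
    · rw [ifac_neg q (show ((m + 1 : ℕ) : ℤ) + X - y < 0 by push_cast; omega)]
      simp only [mul_zero]
      refine sum_eq_zero fun r hr => ?_
      have := mem_range.1 hr
      rw [ifac_neg q (show X - y + r < 0 by omega)]
      ring
    · rw [sum_eq_single_of_mem (m + 1) (by simp)]
      · have hP' : X = y - m - 1 := by omega
        subst hP'
        push_cast
        have h1 := fac_mul_ifac hq (show 0 ≤ y + (m + 1) + 1 by omega)
        rw [fac_step q (show 0 ≤ y + (m + 1) by omega) rfl] at h1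
        rw [show 2 * ((m : ℤ) + 1) + (y - m - 1) + 1 = y + (m + 1) + 1 by ring,
          show (m : ℤ) + 1 + (y - m - 1) + 1 = y + 1 by ring,
          show y - (m : ℤ) - 1 + (m + 1) = y by ring,
          show y - (m : ℤ) - 1 - y + (m + 1) = 0 by ring,
          show (m : ℤ) + 1 - (m + 1) = 0 by ring,
          show y + 1 + ((m : ℤ) + 1) = y + (m + 1) + 1 by ring,
          show (m : ℤ) + 1 + (y - m - 1) - y = 0 by ring, ifac_zero]
        linear_combination (q ^ (-((m : ℤ) + 1) * (y + 1)) * fac q y * ifac q (m + 1)) * h1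
      · intro r hr hr'
        have := mem_range.1 hr
        rw [ifac_neg q (show X - y + r < 0 by omega)]
        ring
    · have h1 : qInt q (m + 1) * qInt q (m + 1 + X - y) ≠ 0 :=
        mul_ne_zero (qInt_pos hq (by omega)).ne' (qInt_pos hq (by omega)).ne'
      apply mul_left_cancel₀ h1
      have key : qInt q (m + 1) * qInt q (m + 1 + X - y) * (∑ i ∈ range (m + 1 + 1),
          qInt q (2 * i + X + 1) * q ^ (-(i : ℤ) * (i + X + 1)) *
          (fac q (X + i) * ifac q i * fac q (y + i) * ifac q (X - y + i) *
            ifac q ((m + 1 : ℕ) - i) * ifac q ((m + 1 : ℕ) + X + 1 + i))) -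
          q ^ (-(y + 1)) * (∑ i ∈ range (m + 1 + 1),
          qInt q (2 * i + X + 1) * q ^ (-(i : ℤ) * (i + X + 1)) *
          (fac q (X + i) * ifac q i * fac q (y + i) * ifac q (X - y + i) *
            ifac q (m - i) * ifac q (m + X + 1 + i))) = 0 := by
        rw [mul_sum, mul_sum, ← sum_sub_distrib]
        apply sum_telescope (G := fun i : ℕ => q ^ (-(i : ℤ) * (i + X + 1) - (m + 1 - i)) *
          (fac q (X + i) * ifac q (i - 1) * fac q (y + i) * ifac q (X - y + i - 1) *
            ifac q (m + 1 - i) * ifac q (m + X + 1 + i)))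
        · intro i _
          push_cast
          rw [show X - y + ((i : ℤ) + 1) - 1 = X - y + i by ring,
            show (i : ℤ) + 1 - 1 = i by ring]
          -- `X` may be negative. As long as `X - y + i < 0` all terms are zero; afterwards `X + i ≥
          -- 0` because `0 ≤ y`, and the factorial recursion applies.
          rcases lt_or_ge (X - y + i) 0 with h | h
          · rw [ifac_neg q h, ifac_neg q (show X - y + (i : ℤ) - 1 < 0 by omega)]
            ring
          rw [fac_step q (show 0 ≤ X + (i : ℤ) by omega)
              (show X + ((i : ℤ) + 1) = X + i + 1 by ring),
            fac_step q (show 0 ≤ y + (i : ℤ) by omega)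
              (show y + ((i : ℤ) + 1) = y + i + 1 by ring),
            ifac_step hq (show (i : ℤ) = i - 1 + 1 by ring),
            ifac_step hq (show X - y + (i : ℤ) = X - y + i - 1 + 1 by ring),
            ifac_step hq (show (m : ℤ) + 1 - i = m - i + 1 by ring),
            ifac_step hq (show (m : ℤ) + 1 - i = m + 1 - (i + 1) + 1 by ring),
            show (m : ℤ) + X + 1 + (i + 1) = m + 1 + X + 1 + i by ring,
            ifac_step hq (show (m : ℤ) + 1 + X + 1 + i = m + X + 1 + i + 1 by ring),
            show X + ((i : ℤ) + 1) = X + i + 1 by ring,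
            show y + ((i : ℤ) + 1) = y + i + 1 by ring]
          have key := well_poised_identity hq (m + 1 - i) (m + 1 + X + 1 + i) i (y + i + 1)
          rw [show (m : ℤ) + 1 + X + 1 + i - (m + 1 - i) = 2 * i + X + 1 by ring,
            show (m : ℤ) + 1 - i + i = m + 1 by ring,
            show (m : ℤ) + 1 + X + 1 + i - (y + i + 1) = m + 1 + X - y by ring,
            show 2 * (i : ℤ) + X + 1 - (y + i + 1) = X - y + i by ring,
            show 2 * (i : ℤ) + X + 1 - i = X + i + 1 by ring,
            show (i : ℤ) - (y + i + 1) = -(y + 1) by ring] at key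
          rw [show -(i : ℤ) * (i + X + 1) - (m + 1 - i) =
              -(i : ℤ) * (i + X + 1) + -(m + 1 - i) by ring,
            show -((i : ℤ) + 1) * (i + 1 + X + 1) - (m + 1 - (i + 1)) =
              -(i : ℤ) * (i + X + 1) + -(m + 1 + X + 1 + i) by ring,
            zpow_add₀ hq0, zpow_add₀ hq0]
          linear_combination (q ^ (-(i : ℤ) * (i + X + 1)) *
            (fac q (X + i) * ifac q i * fac q (y + i) * ifac q (X - y + i) *
            ifac q (m + 1 - i) * ifac q (m + 1 + X + 1 + i))) * key
        · simp [ifac_neg]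
        · push_cast
          rw [ifac_neg q (show (m : ℤ) + 1 - (m + 1 + 1) < 0 by omega)]
          ring
      rw [sum_range_succ (fun i : ℕ => qInt q (2 * i + X + 1) * q ^ (-(i : ℤ) * (i + X + 1)) *
          (fac q (X + i) * ifac q i * fac q (y + i) * ifac q (X - y + i) *
            ifac q (m - i) * ifac q (m + X + 1 + i))),
        ifac_neg q (show (m : ℤ) - (m + 1 : ℕ) < 0 by push_cast; omega), ih] at key
      push_cast at key ⊢
      rw [ifac_step hq (show (m : ℤ) + 1 = m + 1 by ring),
        ifac_step hq (show (m : ℤ) + 1 + X - y = m + X - y + 1 by ring)] at key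
      rw [show -((m : ℤ) + 1) * (y + 1) = -(m : ℤ) * (y + 1) + -(y + 1) by ring, zpow_add₀ hq0]
      linear_combination key

/-! ### Transformations of Racah's sum -/

/-- Racah's alternating sum. -/
noncomputable def racah (q : ℝ) (n : ℕ) (q₂ q₃ t₁ t₂ t₃ t₄ : ℤ) : ℝ :=
  ∑ z ∈ range (n + 1), (-1) ^ z * (fac q (z + 1) * (ifac q (z - t₁) * ifac q (z - t₂) *
    ifac q (z - t₃) * ifac q (z - t₄) * ifac q (n - z) * ifac q (q₂ - z) * ifac q (q₃ - z)))

/-- With `z = n - k`, the factors `[z + 1]!`, `1/[z - t₃]!` and `1/[z - t₄]!` are expanded by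
`saalschutz_desc`. By `hs` the resulting sum over `k` is balanced and is evaluated by `saalschutz`.
This is a Whipple-type transformation of a terminating balanced `₄F₃`. -/
theorem racah_eq_desc {q : ℝ} (hq : 0 < q) {n : ℕ} {q₂ q₃ t₁ t₂ t₃ t₄ : ℤ}
    (hs : t₁ + t₂ + t₃ + t₄ = n + q₂ + q₃) (h1 : 0 ≤ t₁) (h3 : 0 ≤ t₃) (h4 : 0 ≤ t₄) (h3n : t₃ ≤ n)
    (h4n : t₄ ≤ n) (h34 : n ≤ t₃ + t₄) :
    racah q n q₂ q₃ t₁ t₂ t₃ t₄ = (-1) ^ n * (fac q (t₃ + 1) * fac q (t₄ + 1) * ifac q (n - t₃) *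
      ifac q (n - t₄) * ifac q (q₂ - t₁) * ifac q (q₃ - t₁) * ifac q (q₂ - t₂) *
      ifac q (q₃ - t₂)) * ∑ u ∈ range (n + 1), (-1) ^ u * (fac q (n + 1 - u) *
      fac q (n + q₂ - t₁ - t₂ - u) * fac q (n + q₃ - t₁ - t₂ - u) * (ifac q u *
      ifac q (t₃ + 1 - u) * ifac q (t₄ + 1 - u) * ifac q (n - t₁ - u) * ifac q (n - t₂ - u))) := by
  have c1 := fac_mul_ifac hq (show 0 ≤ t₃ + 1 by omega)
  have c2 := fac_mul_ifac hq (show 0 ≤ t₄ + 1 by omega)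
  have c3 := fac_mul_ifac hq (show 0 ≤ (n : ℤ) - t₃ by omega)
  have c4 := fac_mul_ifac hq (show 0 ≤ (n : ℤ) - t₄ by omega)
  have c5 := fac_mul_ifac hq (show 0 ≤ t₃ + t₄ - n by omega)
  set c := fac q (t₃ + 1) * fac q (t₄ + 1) * ifac q (n - t₃) * ifac q (n - t₄) *
    ifac q (t₃ + t₄ - n) with hc
  have e1 : racah q n q₂ q₃ t₁ t₂ t₃ t₄ = ∑ k ∈ range (n + 1), ∑ u ∈ range (n + 1),
      (-1) ^ n * c * ((-1) ^ u * (fac q (n + 1 - u) * (ifac q u * ifac q (t₃ + 1 - u) *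
      ifac q (t₄ + 1 - u))) * (fac q (t₃ + t₄ - n + k - u) * (ifac q (k - u) *
      ifac q (n - t₁ - k) * ifac q (n - t₂ - k) * ifac q (q₂ - n + k) * ifac q (q₃ - n + k)))) := by
    rw [racah, ← sum_flip]
    refine sum_congr rfl fun k hk => ?_
    have hkn : k ≤ n := Nat.lt_succ_iff.1 (mem_range.1 hk)
    have hs := saalschutz_desc hq k (A := n + 1) (B := t₃ + t₄ - n) (C := t₃ + 1) (D := t₄ + 1)
      (by ring) (by omega) (by omega) (by omega) (by omega)
    rw [sum_range_extend hkn] at hs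
    · rw [Nat.cast_sub hkn]
      rw [show (n : ℤ) + 1 - (t₃ + 1) = n - t₃ by ring, show (n : ℤ) + 1 - (t₄ +
        1) = n - t₄ by ring]
        at hs
      have c6 := fac_mul_ifac hq (show 0 ≤ (k : ℤ) by omega)
      have e2 : fac q (n - k + 1) * ifac q (n - k - t₃) * ifac q (n - k - t₄) =
          (-1) ^ k * fac q k * c * ∑ u ∈ range (n + 1), (-1) ^ u * (fac q (n + 1 - u) *
          fac q (t₃ + t₄ - n + k - u) *
          (ifac q u * ifac q (k - u) * ifac q (t₃ + 1 - u) * ifac q (t₄ + 1 - u))) := by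
        rw [hs, hc, show (n : ℤ) - k + 1 = n + 1 - k by ring,
          show (n : ℤ) - k - t₃ = n - t₃ - k by ring, show (n : ℤ) - k - t₄ = n - t₄ - k by ring]
        have hsq : ((-1 : ℝ) ^ k) * (-1) ^ k = 1 := by
          rw [← mul_pow]; norm_num
        calc _ = ((-1 : ℝ) ^ k * (-1) ^ k) * (fac q k * ifac q k) *
              (fac q (t₃ + 1) * ifac q (t₃ + 1)) * (fac q (t₄ + 1) * ifac q (t₄ + 1)) *
              (fac q (n - t₃) * ifac q (n - t₃)) * (fac q (n - t₄) * ifac q (n - t₄)) *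
              (fac q (t₃ + t₄ - n) * ifac q (t₃ + t₄ - n)) *
              (fac q (n + 1 - k) * ifac q (n - t₃ - k) * ifac q (n - t₄ - k)) := by
              rw [hsq, c1, c2, c3, c4, c5, c6]; ring
          _ = _ := by ring
      calc _ = (-1) ^ (n - k) * (ifac q (n - k - t₁) * ifac q (n - k - t₂) *
            ifac q (n - (n - k)) * ifac q (q₂ - (n - k)) * ifac q (q₃ - (n - k))) *
            (fac q (n - k + 1) * ifac q (n - k - t₃) * ifac q (n - k - t₄)) := by ring
        _ = _ := by
          rw [e2, mul_sum, mul_sum]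
          refine sum_congr rfl fun u _ => ?_
          have hpn : (-1 : ℝ) ^ n = (-1) ^ (n - k) * (-1) ^ k := by
            rw [← pow_add]; congr 1; omega
          rw [hpn, show (n : ℤ) - (n - k) = k by ring, show (n : ℤ) - k - t₁ = n - t₁ - k by ring,
            show (n : ℤ) - k - t₂ = n - t₂ - k by ring, show q₂ - ((n : ℤ) - k) = q₂ - n +
              k by ring,
            show q₃ - ((n : ℤ) - k) = q₃ - n + k by ring]
          linear_combination ((-1) ^ (n - k) * (-1) ^ k * c * ((-1) ^ u * (fac q (n + 1 - u) *
            (ifac q u * ifac q (t₃ + 1 - u) * ifac q (t₄ + 1 - u))) *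
            (fac q (t₃ + t₄ - n + k - u) * (ifac q (k - u) *
            ifac q (n - t₁ - k) * ifac q (n - t₂ - k) * ifac q (q₂ - n + k) *
            ifac q (q₃ - n + k))))) * c6
    · intro u hu
      rw [ifac_neg q (show (k : ℤ) - u < 0 by omega)]
      ring
  rw [e1, sum_comm, mul_sum]
  refine sum_congr rfl fun u hu => ?_
  have hun : u ≤ n := Nat.lt_succ_iff.1 (mem_range.1 hu)
  rw [← mul_sum, ← mul_sum, sum_range_shift hun]
  · have hs := saalschutz hq (L := n - u) (N := n - t₁ - u) (n - t₂ - u) (q₂ - n + u) (q₃ - n + u)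
      (M := t₃ + t₄ - n) (by rw [Nat.cast_sub hun]; omega) (by omega)
    have e3 : ∑ r ∈ range (n - u + 1), fac q (t₃ + t₄ - n + (u + r : ℕ) - u) *
        (ifac q ((u + r : ℕ) - u) * ifac q (n - t₁ - (u + r : ℕ)) * ifac q (n - t₂ - (u + r : ℕ)) *
          ifac q (q₂ - n + (u + r : ℕ)) * ifac q (q₃ - n + (u + r : ℕ))) =
        ∑ r ∈ range (n - u + 1), fac q (t₃ + t₄ - n + r) * (ifac q r * ifac q (n - t₁ - u - r) *
          ifac q (n - t₂ - u - r) * ifac q (q₂ - n + u + r) * ifac q (q₃ - n + u + r)) := by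
      refine sum_congr rfl fun r _ => ?_
      push_cast
      rw [show t₃ + t₄ - n + ((u : ℤ) + r) - u = t₃ + t₄ - n + r by ring,
        show (u : ℤ) + r - u = r by ring, show (n : ℤ) - t₁ - (u + r) = n - t₁ - u - r by ring,
        show (n : ℤ) - t₂ - (u + r) = n - t₂ - u - r by ring,
        show q₂ - n + ((u : ℤ) + r) = q₂ - n + u + r by ring,
        show q₃ - n + ((u : ℤ) + r) = q₃ - n + u + r by ring]
    rw [e3, hs, hc,
      show (n : ℤ) - t₁ - u + (n - t₂ - u) + (q₂ - n + u) = n + q₂ - t₁ - t₂ - u by ring,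
      show (n : ℤ) - t₁ - u + (n - t₂ - u) + (q₃ - n + u) = n + q₃ - t₁ - t₂ - u by ring,
      show (n : ℤ) - t₁ - u + (q₂ - n + u) = q₂ - t₁ by ring,
      show (n : ℤ) - t₁ - u + (q₃ - n + u) = q₃ - t₁ by ring,
      show (n : ℤ) - t₂ - u + (q₂ - n + u) = q₂ - t₂ by ring,
      show (n : ℤ) - t₂ - u + (q₃ - n + u) = q₃ - t₂ by ring]
    linear_combination ((-1) ^ n * (fac q (t₃ + 1) * fac q (t₄ + 1) * ifac q (n - t₃) *
      ifac q (n - t₄) * ifac q (q₂ - t₁) * ifac q (q₃ - t₁) * ifac q (q₂ - t₂) *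
      ifac q (q₃ - t₂)) * ((-1) ^ u * (fac q (n + 1 - u) *
      fac q (n + q₂ - t₁ - t₂ - u) * fac q (n + q₃ - t₁ - t₂ - u) * (ifac q u *
      ifac q (t₃ + 1 - u) * ifac q (t₄ + 1 - u) * ifac q (n - t₁ - u) *
      ifac q (n - t₂ - u))))) * c5
  · intro s hs
    rw [ifac_neg q (show (s : ℤ) - u < 0 by omega)]
    ring

/-- The same two-step scheme without reversal: the four factors with `n`, `q₂`, `t₃`, `t₄` are
expanded by `saalschutz_asc` at `k = n - z`, and the remaining sum over `z` is balanced by `hs`. -/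
theorem racah_eq_asc {q : ℝ} (hq : 0 < q) {n : ℕ} {q₂ q₃ t₁ t₂ t₃ t₄ : ℤ}
    (hs : t₁ + t₂ + t₃ + t₄ = n + q₂ + q₃) (h1 : 0 ≤ t₁) (h3n : t₃ ≤ n) (h4n : t₄ ≤ n)
    (h3q : t₃ ≤ q₂) (h4q : t₄ ≤ q₂) (h12 : q₃ ≤ t₁ + t₂) (h1n : t₁ ≤ n) :
    racah q n q₂ q₃ t₁ t₂ t₃ t₄ = (-1) ^ n * (fac q (t₁ + 1) * fac q (t₂ + 1) * ifac q (n - t₃) *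
      ifac q (n - t₄) * ifac q (q₂ - t₃) * ifac q (q₂ - t₄) * ifac q (q₃ - t₁) *
      ifac q (q₃ - t₂)) * ∑ u ∈ range (n + 1), (-1) ^ u * (fac q (q₂ - t₃ + u) *
      fac q (q₂ - t₄ + u) * fac q (n + q₃ - t₁ - t₂ - u) * (ifac q u * ifac q (n - t₁ - u) *
      ifac q (n - t₂ - u) * ifac q (q₂ - n + u) * ifac q (t₁ + t₂ - n + 1 + u))) := by
  have c1 := fac_mul_ifac hq (show 0 ≤ q₂ - t₃ by omega)
  have c2 := fac_mul_ifac hq (show 0 ≤ q₂ - t₄ by omega)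
  have c3 := fac_mul_ifac hq (show 0 ≤ (n : ℤ) - t₃ by omega)
  have c4 := fac_mul_ifac hq (show 0 ≤ (n : ℤ) - t₄ by omega)
  have c5 := fac_mul_ifac hq (show 0 ≤ t₁ + t₂ - q₃ + 1 by omega)
  set c := ifac q (q₂ - t₃) * ifac q (q₂ - t₄) * ifac q (n - t₃) * ifac q (n - t₄) *
    fac q (t₁ + t₂ - q₃ + 1) with hc
  have e1 : racah q n q₂ q₃ t₁ t₂ t₃ t₄ = ∑ z ∈ range (n + 1), ∑ u ∈ range (n + 1),
      (-1) ^ n * c * ((-1) ^ u * (fac q (q₂ - t₃ + u) * fac q (q₂ - t₄ + u) * (ifac q u *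
      ifac q (q₂ - n + u))) * (fac q (z + 1) * (ifac q (z - t₁) * ifac q (z - t₂) *
      ifac q (q₃ - z) * ifac q (n - z - u) * ifac q (q₂ - t₃ - t₄ + 1 + z + u)))) := by
    rw [racah]
    refine sum_congr rfl fun z hz => ?_
    have hzn : z ≤ n := Nat.lt_succ_iff.1 (mem_range.1 hz)
    have hs := saalschutz_asc hq (n - z) (α := q₂ - t₃) (β := q₂ - t₄) (γ := q₂ - n)
      (δ := t₁ + t₂ - q₃ + 1) (by omega) (by omega) (by omega) (by omega) (by omega)
    rw [sum_range_extend (Nat.sub_le n z)] at hs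
    · rw [Nat.cast_sub hzn] at hs
      rw [show q₂ - t₃ - (q₂ - (n : ℤ)) = n - t₃ by ring,
        show q₂ - t₄ - (q₂ - (n : ℤ)) = n - t₄ by ring,
        show (n : ℤ) - t₃ - (n - z) = z - t₃ by ring, show (n : ℤ) - t₄ - (n - z) = z - t₄ by ring,
        show q₂ - (n : ℤ) + (n - z) = q₂ - z by ring] at hs
      have hsq : ((-1 : ℝ) ^ (n - z)) * (-1) ^ (n - z) = 1 := by
          rw [← mul_pow]; norm_num
      have e2 : ifac q (n - z) * ifac q (z - t₃) * ifac q (z - t₄) * ifac q (q₂ - z) =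
          (-1) ^ (n - z) * c * ∑ u ∈ range (n + 1), (-1) ^ u * (fac q (q₂ - t₃ + u) *
          fac q (q₂ - t₄ + u) * (ifac q u * ifac q (n - z - u) * ifac q (q₂ - n + u) *
          ifac q (t₁ + t₂ - q₃ + 1 - (n - z) + u))) := by
        rw [hs, hc]
        calc _ = ((-1 : ℝ) ^ (n - z) * (-1) ^ (n - z)) *
              (fac q (q₂ - t₃) * ifac q (q₂ - t₃)) * (fac q (q₂ - t₄) * ifac q (q₂ - t₄)) *
              (fac q (n - t₃) * ifac q (n - t₃)) * (fac q (n - t₄) * ifac q (n - t₄)) *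
              (fac q (t₁ + t₂ - q₃ + 1) * ifac q (t₁ + t₂ - q₃ + 1)) *
              (ifac q (n - z) * ifac q (z - t₃) * ifac q (z - t₄) * ifac q (q₂ - z)) := by
              rw [hsq, c1, c2, c3, c4, c5]; ring
          _ = _ := by ring
      calc _ = (-1) ^ z * fac q (z + 1) * (ifac q (z - t₁) * ifac q (z - t₂) * ifac q (q₃ - z)) *
            (ifac q (n - z) * ifac q (z - t₃) * ifac q (z - t₄) * ifac q (q₂ - z)) := by ring
        _ = _ := by
          rw [e2, mul_sum, mul_sum]
          refine sum_congr rfl fun u _ => ?_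
          have hpn : (-1 : ℝ) ^ n = (-1) ^ z * (-1) ^ (n - z) := by
            rw [← pow_add]; congr 1; omega
          rw [hpn, show t₁ + t₂ - q₃ + 1 - ((n : ℤ) - z) + u = q₂ - t₃ - t₄ + 1 + z + u by omega]
          ring
    · intro u hu
      rw [ifac_neg q (show ((n - z : ℕ) : ℤ) - u < 0 by omega)]
      ring
  rw [e1, sum_comm, mul_sum]
  refine sum_congr rfl fun u hu => ?_
  -- Because of `1/[z - t₁]!` the sum over `z` effectively starts at `t₁`; as a natural number this
  -- can serve as the shift.
  obtain ⟨T, rfl⟩ := Int.eq_ofNat_of_zero_le h1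
  have hTn : T ≤ n := by omega
  rw [← mul_sum, ← mul_sum, sum_range_shift hTn]
  · have hs := saalschutz hq (L := n - T) (N := n - T - u) (q₃ - T) (T - t₂)
      (q₂ + T - t₃ - t₄ + 1 + u)
      (M := T + 1) (by rw [Nat.cast_sub hTn]; omega) (by omega)
    have e3 : ∑ r ∈ range (n - T + 1), fac q ((T + r : ℕ) + 1) *
        (ifac q ((T + r : ℕ) - T) * ifac q ((T + r : ℕ) - t₂) * ifac q (q₃ - (T + r : ℕ)) *
          ifac q (n - (T + r : ℕ) - u) * ifac q (q₂ - t₃ - t₄ + 1 + (T + r : ℕ) + u)) =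
        ∑ r ∈ range (n - T + 1), fac q (T + 1 + r) * (ifac q r * ifac q (n - T - u - r) *
          ifac q (q₃ - T - r) * ifac q (T - t₂ + r) * ifac q (q₂ + T - t₃ - t₄ + 1 + u + r)) := by
      refine sum_congr rfl fun r _ => ?_
      push_cast
      rw [show (T : ℤ) + r + 1 = T + 1 + r by ring,
        show (T : ℤ) + r - T = r by ring, show (n : ℤ) - (T + r) - u = n - T - u - r by ring,
        show (T : ℤ) + r - t₂ = T - t₂ + r by ring,
        show q₃ - ((T : ℤ) + r) = q₃ - T - r by ring,
        show q₂ - t₃ - t₄ + 1 + ((T : ℤ) + r) + u = q₂ + T - t₃ - t₄ + 1 + u + r by ring]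
      ring
    rw [e3, hs, hc,
      show (n : ℤ) - T - u + (q₃ - T) + (T - t₂) = n + q₃ - T - t₂ - u by ring,
      show (n : ℤ) - T - u + (q₃ - T) + (q₂ + T - t₃ - t₄ + 1 + u) = t₂ + 1 by omega,
      show (n : ℤ) - T - u + (T - t₂) = n - t₂ - u by ring,
      show (n : ℤ) - T - u + (q₂ + T - t₃ - t₄ + 1 + u) = T + t₂ - q₃ + 1 by omega,
      show q₃ - (T : ℤ) + (T - t₂) = q₃ - t₂ by ring,
      show q₃ - (T : ℤ) + (q₂ + T - t₃ - t₄ + 1 + u) = T + t₂ - n + 1 + u by omega]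
    linear_combination ((-1) ^ n * (fac q (T + 1) * fac q (t₂ + 1) * ifac q (n - t₃) *
      ifac q (n - t₄) * ifac q (q₂ - t₃) * ifac q (q₂ - t₄) * ifac q (q₃ - T) *
      ifac q (q₃ - t₂)) * ((-1) ^ u * (fac q (q₂ - t₃ + u) *
      fac q (q₂ - t₄ + u) * fac q (n + q₃ - T - t₂ - u) * (ifac q u * ifac q (n - T - u) *
      ifac q (n - t₂ - u) * ifac q (q₂ - n + u) * ifac q (T + t₂ - n + 1 + u))))) * c5
  · intro s hs
    rw [ifac_neg q (show (s : ℤ) - T < 0 by omega)]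
    ring

/-! ### Symmetries of the terminating series: inversion of `q`, reversal and shift -/

lemma altSum_inv {q : ℝ} (hq : 0 < q) (A B C D : ℤ) (n : ℕ) : altSum q⁻¹ A B C D n =
    ∑ s ∈ range (n + 1), (-1) ^ s * q ^ (-((s : ℤ) * (A + B - C - D - n + 1))) *
      (fac q (A + s) * fac q (B + s) * ifac q s * ifac q (n - s) * ifac q (C + s) *
        ifac q (D + s)) := by
  simp only [altSum, inv_zpow', fac_inv hq, ifac_inv hq]

lemma mixSum_inv {q : ℝ} (hq : 0 < q) (x y C m : ℤ) (n : ℕ) : mixSum q⁻¹ x y C m n =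
    ∑ s ∈ range (n + 1), (-1) ^ s * q ^ (-((s : ℤ) * (x + y + 1 - C - m - n))) *
      (fac q (y + s) * fac q (x - s) * ifac q s * ifac q (C + s) * ifac q (m - s) *
        ifac q (n - s)) := by
  simp only [mixSum, inv_zpow', fac_inv hq, ifac_inv hq]

lemma posSum_inv {q : ℝ} (hq : 0 < q) (e x C l m : ℤ) (n : ℕ) : posSum q⁻¹ e x C l m n =
    ∑ t ∈ range (n + 1), q ^ (-((t : ℤ) * e)) *
      (fac q (x + t) * ifac q t * ifac q (C + t) * ifac q (l + t) * ifac q (m - t) *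
        ifac q (n - t)) := by
  simp only [posSum, inv_zpow', fac_inv hq, ifac_inv hq]

lemma altSum_comm (q : ℝ) (A B C D : ℤ) (n : ℕ) : altSum q A B C D n = altSum q B A D C n := by
  unfold altSum
  refine sum_congr rfl fun s _ => ?_
  rw [show B + A - D - C - (n : ℤ) + 1 = A + B - C - D - n + 1 by ring]
  ring

lemma altSum_comm_left (q : ℝ) (A B C D : ℤ) (n : ℕ) :
    altSum q A B C D n = altSum q B A C D n := by
  unfold altSum
  refine sum_congr rfl fun s _ => ?_
  rw [show B + A - C - D - (n : ℤ) + 1 = A + B - C - D - n + 1 by ring]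
  ring

/-- The factor `1/[l + t]!` needs `t ≥ -l`, while `1/[m - t]!` and `1/[n - t]!` need `t ≤ m` and `t
≤ n`. This disposes of degenerate parameters in the comparisons of series. -/
lemma posSum_eq_zero {q : ℝ} {e x C l m : ℤ} {n : ℕ} (h : m + l < 0 ∨ n + l < 0) :
    posSum q e x C l m n = 0 := by
  refine sum_eq_zero fun t ht => ?_
  rcases lt_or_ge (l + t) 0 with h1 | h1
  · rw [ifac_neg q h1]; ring
  rcases h with h | h
  · rw [ifac_neg q (show m - t < 0 by omega)]; ring
  · rw [ifac_neg q (show (n : ℤ) - t < 0 by omega)]; ring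

/-- A sum over all integers has no end points, so reversal and shift of the variable become
bijections of `ℤ`; vanishing reciprocal factorials restore whichever finite range is wanted. -/
lemma finsum_eq_sum_range {f : ℤ → ℝ} {n : ℕ} (h0 : ∀ t < 0, f t = 0)
    (h1 : ∀ t : ℤ, (n : ℤ) < t → f t = 0) :
    ∑ᶠ t, f t = ∑ t ∈ range (n + 1), f t := by
  have : (Function.support f) ⊆ ((range (n + 1)).map Nat.castEmbedding : Finset ℤ) := by
    intro t ht
    have h2 : 0 ≤ t := by
      by_contra h; exact ht (h0 t (by omega))
    have h3 : t ≤ n := by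
      by_contra h; exact ht (h1 t (by omega))
    obtain ⟨t, rfl⟩ := Int.eq_ofNat_of_zero_le h2
    simp only [coe_map, Set.mem_image, coe_range, Set.mem_Iio]
    exact ⟨t, by omega, rfl⟩
  rw [finsum_eq_sum_of_support_subset _ this, sum_map]
  rfl

/-- The substitution `s ↦ m - s`. The factor `1/[C + s]!` then becomes the one that ends the series,
whence the new upper limit `C + m`. -/
lemma mixSum_reflect {q : ℝ} (hq : 0 < q) (x y C : ℤ) (m n n' : ℕ) (hn' : (n' : ℤ) = C + m) :
    mixSum q x y C m n = (-1) ^ m * q ^ ((m : ℤ) * (x + y + 1 - C - m - n)) *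
      mixSum q⁻¹ (y + m) (x - m) (n - m) m n' := by
  have hq0 := hq.ne'
  let f : ℤ → ℝ := fun s => (-1) ^ s * q ^ (s * (x + y + 1 - C - m - n)) *
    (fac q (y + s) * fac q (x - s) * ifac q s * ifac q (C + s) * ifac q (m - s) * ifac q (n - s))
  have e1 : mixSum q x y C m n = ∑ᶠ t, f t := by
    rw [finsum_eq_sum_range (n := n)]
    · simp [mixSum, f]
    · intro t ht; simp only [f]; rw [ifac_neg q ht]; ring
    · intro t ht; simp only [f]; rw [ifac_neg q (show (n : ℤ) - t < 0 by omega)]; ring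
  have e2 : ∑ᶠ t, f t = ∑ᶠ t, f (m - t) := by
    rw [← finsum_comp_equiv (Equiv.subLeft (m : ℤ))]
    rfl
  rw [e1, e2, finsum_eq_sum_range (n := n'), mixSum_inv hq, mul_sum]
  · refine sum_congr rfl fun t _ => ?_
    simp only [f]
    rw [show y + ((m : ℤ) - t) = y + m - t by ring, show x - ((m : ℤ) - t) = x - m + t by ring,
      show C + ((m : ℤ) - t) = n' - t by rw [hn']; ring, show (m : ℤ) - (m - t) = t by ring,
      show (n : ℤ) - (m - t) = n - m + t by ring, hn']
    have hz : q ^ (((m : ℤ) - t) * (x + y + 1 - C - m - n)) =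
        q ^ ((m : ℤ) * (x + y + 1 - C - m - n)) *
        q ^ (-((t : ℤ) * (y + m + (x - m) + 1 - (n - m) - m - (C + m)))) := by
      rw [← zpow_add₀ hq0]
      congr 1
      ring
    have hs : (-1 : ℝ) ^ ((m : ℤ) - t) = (-1) ^ m * (-1) ^ t := by
      rw [zpow_sub₀ (by norm_num), zpow_natCast, zpow_natCast, div_eq_iff (by simp), mul_assoc,
        ← mul_pow]
      norm_num
    rw [hz, hs]
    ring
  · intro t ht; simp only [f]; rw [ifac_neg q (show (m : ℤ) - (m - t) < 0 by omega)]; ring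
  · intro t ht; simp only [f]; rw [ifac_neg q (show C + ((m : ℤ) - t) < 0 by omega)]; ring

lemma vdwSum_reflect {q : ℝ} (hq : 0 < q) (e C l p : ℤ) (m n n' : ℕ) (hn' : (n' : ℤ) = l + m) :
    vdwSum q e C l m p n = (-1) ^ m * q ^ ((m : ℤ) * e) *
      vdwSum q⁻¹ e (p - m) (n - m) m (C + m) n' := by
  have hq0 := hq.ne'
  let f : ℤ → ℝ := fun t => (-1) ^ t * q ^ (t * e) *
    (ifac q t * ifac q (C + t) * ifac q (l + t) * ifac q (m - t) * ifac q (p - t) * ifac q (n - t))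
  have e1 : vdwSum q e C l m p n = ∑ᶠ t, f t := by
    rw [finsum_eq_sum_range (n := n)]
    · simp [vdwSum, f]
    · intro t ht; simp only [f]; rw [ifac_neg q ht]; ring
    · intro t ht; simp only [f]; rw [ifac_neg q (show (n : ℤ) - t < 0 by omega)]; ring
  have e2 : ∑ᶠ t, f t = ∑ᶠ t, f (m - t) := by
    rw [← finsum_comp_equiv (Equiv.subLeft (m : ℤ))]
    rfl
  rw [e1, e2, finsum_eq_sum_range (n := n'), vdwSum, mul_sum]
  · refine sum_congr rfl fun t _ => ?_
    simp only [f, ifac_inv hq, inv_zpow']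
    rw [show p - ((m : ℤ) - t) = p - m + t by ring, show C + ((m : ℤ) - t) = C + m - t by ring,
      show l + ((m : ℤ) - t) = n' - t by rw [hn']; ring, show (m : ℤ) - (m - t) = t by ring,
      show (n : ℤ) - (m - t) = n - m + t by ring]
    have hz : q ^ (((m : ℤ) - t) * e) = q ^ ((m : ℤ) * e) * q ^ (-((t : ℤ) * e)) := by
      rw [← zpow_add₀ hq0]
      congr 1
      ring
    have hs : (-1 : ℝ) ^ ((m : ℤ) - t) = (-1) ^ m * (-1) ^ t := by
      rw [zpow_sub₀ (by norm_num), zpow_natCast, zpow_natCast, div_eq_iff (by simp), mul_assoc,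
        ← mul_pow]
      norm_num
    rw [hz, hs]
    ring
  · intro t ht; simp only [f]; rw [ifac_neg q (show (m : ℤ) - (m - t) < 0 by omega)]; ring
  · intro t ht; simp only [f]; rw [ifac_neg q (show l + ((m : ℤ) - t) < 0 by omega)]; ring

/-- The substitution `t ↦ t - D`, which exchanges the roles of `1/[t]!` and `1/[D + t]!`. -/
lemma vdwSum_shift {q : ℝ} (hq : 0 < q) (e D l m p : ℤ) (n n' : ℕ) (hn' : (n' : ℤ) = p + D) :
    vdwSum q e D l m p n = (-1) ^ D * q ^ (-(D * e)) *
      vdwSum q e (l - D) (-D) (n + D) (m + D) n' := by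
  have hq0 := hq.ne'
  let f : ℤ → ℝ := fun t => (-1) ^ t * q ^ (t * e) *
    (ifac q t * ifac q (D + t) * ifac q (l + t) * ifac q (m - t) * ifac q (p - t) * ifac q (n - t))
  have e1 : vdwSum q e D l m p n = ∑ᶠ t, f t := by
    rw [finsum_eq_sum_range (n := n)]
    · simp [vdwSum, f]
    · intro t ht; simp only [f]; rw [ifac_neg q ht]; ring
    · intro t ht; simp only [f]; rw [ifac_neg q (show (n : ℤ) - t < 0 by omega)]; ring
  have e2 : ∑ᶠ t, f t = ∑ᶠ t, f (t - D) := by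
    rw [← finsum_comp_equiv (Equiv.subRight D)]
    rfl
  rw [e1, e2, finsum_eq_sum_range (n := n'), vdwSum, mul_sum]
  · refine sum_congr rfl fun t _ => ?_
    simp only [f]
    rw [show D + ((t : ℤ) - D) = t by ring, show l + ((t : ℤ) - D) = l - D + t by ring,
      show m - ((t : ℤ) - D) = m + D - t by ring, show p - ((t : ℤ) - D) = n' - t by rw [hn']; ring,
      show (n : ℤ) - (t - D) = n + D - t by ring, show (t : ℤ) - D = -D + t by ring]
    have hz : q ^ ((-D + (t : ℤ)) * e) = q ^ (-(D * e)) * q ^ ((t : ℤ) * e) := by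
      rw [← zpow_add₀ hq0]
      congr 1
      ring
    have hs : (-1 : ℝ) ^ (-D + (t : ℤ)) = (-1) ^ D * (-1) ^ t := by
      rw [zpow_add₀ (by norm_num), zpow_natCast, zpow_neg, ← inv_zpow, inv_neg, inv_one]
    rw [hz, hs]
    ring
  · intro t ht; simp only [f]; rw [ifac_neg q (show D + (t - D) < 0 by omega)]; ring
  · intro t ht; simp only [f]; rw [ifac_neg q (show p - (t - D) < 0 by omega)]; ring

/-! ### The five double sums in integer parameters -/

section DoubleSums

/-- The summand of the first double sum in integer parameters. -/
noncomputable def dblA (q : ℝ) (α β n₁ n₃ : ℤ) (s₀ s₁ z₀ z₁ : ℕ) (s z : ℤ) : ℝ :=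
  (-1) ^ (s + z) * q ^ (s * (s₀ + s₁ + z₀ - n₃ - z) + z * (β - n₁ + s₀)) *
    (fac q (α - s₀ + s) * fac q (z₁ + z) * ifac q s * ifac q (s₀ - s) * ifac q (n₁ - s₀ + s) *
      ifac q (α + s₁ - s₀ + 1 + s) * fac q (n₁ + n₃ - s₀ - z₀ + s + z) * ifac q z *
      ifac q (z₀ - z) * ifac q (n₃ - z₀ + z) * ifac q (β + z₁ - z₀ + 1 + z))

/-- The summand of the second double sum in integer parameters. -/
noncomputable def dblB (q : ℝ) (α β n₁ n₃ : ℤ) (s₀ s₁ z₀ z₁ : ℕ) (s z : ℤ) : ℝ :=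
  (-1) ^ s * q ^ (s * (s₀ + s₁ + z₀ - n₃ - z) + z * (α + β - n₁ + s₁ + 1)) *
    (fac q (α + s₁ - s₀ - s) * fac q (α + s₁ - n₁ - s) * fac q (z₁ + z) * ifac q s *
      ifac q (s₁ - s) * ifac q (α + s₁ + 1 - s) * ifac q (α + s₁ + z₀ - n₁ - n₃ - s - z) *
      ifac q z * ifac q (z₀ - z) * ifac q (n₃ - z₀ + z) * ifac q (β + z₁ - z₀ + 1 + z))

/-- The summand of the third double sum in integer parameters. -/
noncomputable def dblC (q : ℝ) (α β n₁ n₃ : ℤ) (s₀ s₁ z₀ z₁ : ℕ) (s z : ℤ) : ℝ :=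
  (-1) ^ (s + z) * q ^ (s * (s₀ + s₁ + z₁ - n₃ - z) - z * (n₁ - s₀ + 1)) *
    (fac q (α - s₀ + s) * fac q (β - n₁ + s₀ - s) * ifac q s * ifac q (s₀ - s) *
      ifac q (α + s₁ - s₀ + 1 + s) * ifac q (β + z₁ + s₀ - n₁ - n₃ - s - z) * fac q (z₀ + z) *
      fac q (β + z₁ - z₀ - z) * ifac q z * ifac q (z₁ - z) * ifac q (n₃ - z₁ + z))

/-- The summand of the fourth double sum in integer parameters. -/
noncomputable def dblD (q : ℝ) (α β n₁ n₃ : ℤ) (s₀ s₁ z₀ z₁ : ℕ) (s z : ℤ) : ℝ :=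
  (-1) ^ (s₀ + s + z) * q ^ (z * (z₀ + z₁ + s₀ - n₃ - s) - s * (α + s₁ - n₁ - n₃ + 1)) *
    (fac q (β - z) * fac q (n₁ + n₃ - s₀ - z) * ifac q z * ifac q (z₀ - z) *
      ifac q (β + z₁ - z + 1) * ifac q s * fac q (α - s) * fac q (s₁ + s) *
      ifac q (n₁ - z - s) * ifac q (s₀ - s) * ifac q (n₃ - s₀ + s))

/-- The summand of the fifth double sum in integer parameters. -/
noncomputable def dblE (q : ℝ) (α β n₁ n₃ : ℤ) (s₀ s₁ z₀ z₁ : ℕ) (s z : ℤ) : ℝ :=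
  (-1) ^ z * q ^ (-s * (α + β - n₁ + z + 1) - z * (n₁ + n₃ - s₀ - z₀)) *
    (fac q (s₁ + s) * fac q (z₀ + z) * fac q (β - n₁ + z) * ifac q s *
      ifac q (β + z₁ + s₀ - n₁ - n₃ - s) * ifac q (s₀ - s) * ifac q (α + s₁ - s₀ + 1 + s) *
      ifac q z * ifac q (z₁ - z) * ifac q (n₃ - z₁ - s₀ + s + z) * ifac q (β + 1 + z))

variable {q : ℝ} {α β n₁ n₃ : ℤ} {s₀ s₁ z₀ z₁ : ℕ}

/-- This and the following lemmas recognise a single sum inside a double sum as one of the standard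
series, so that its transformations apply while the other variable is fixed. -/
lemma sum_dblE_fst (hq : 0 < q) (z : ℕ) :
    ∑ s ∈ range (s₀ + 1), dblE q α β n₁ n₃ s₀ s₁ z₀ z₁ s z =
      (-1) ^ z * q ^ (-(z : ℤ) * (n₁ + n₃ - s₀ - z₀)) * (fac q (z₀ + z) * fac q (β - n₁ + z) *
        ifac q z * ifac q (z₁ - z) * ifac q (β + 1 + z)) *
        posSum q⁻¹ (α + β - n₁ + 1 + z) s₁ (α + s₁ - s₀ + 1) (n₃ - z₁ - s₀ + z)
          (β + z₁ + s₀ - n₁ - n₃) s₀ := by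
  rw [posSum_inv hq, mul_sum]
  refine sum_congr rfl fun s _ => ?_
  rw [dblE, show n₃ - z₁ - s₀ + (z : ℤ) + s = n₃ - z₁ - s₀ + s + z by ring, zpow_natCast]
  have hz : q ^ (-(s : ℤ) * (α + β - n₁ + z + 1) - z * (n₁ + n₃ - s₀ - z₀)) =
      q ^ (-(z : ℤ) * (n₁ + n₃ - s₀ - z₀)) * q ^ (-((s : ℤ) * (α + β - n₁ + 1 + z))) := by
    rw [← zpow_add₀ hq.ne']
    congr 1
    ring
  rw [hz]
  ring

lemma sum_dblC_snd (hq : 0 < q) (s : ℕ) :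
    ∑ z ∈ range (z₁ + 1), dblC q α β n₁ n₃ s₀ s₁ z₀ z₁ s z =
      (-1) ^ s * q ^ ((s : ℤ) * (s₀ + s₁ + z₁ - n₃)) * (fac q (α - s₀ + s) *
        fac q (β - n₁ + s₀ - s) * ifac q s * ifac q (s₀ - s) * ifac q (α + s₁ - s₀ + 1 + s)) *
        mixSum q⁻¹ (β - z₀ + z₁) z₀ (n₃ - z₁) (β + z₁ + s₀ - n₁ - n₃ - s) z₁ := by
  rw [mixSum_inv hq, mul_sum]
  refine sum_congr rfl fun z _ => ?_
  rw [dblC, show β - z₀ + z₁ - (z : ℤ) = β + z₁ - z₀ - z by ring, ← Nat.cast_add, zpow_natCast,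
    pow_add]
  have hz : q ^ ((s : ℤ) * (s₀ + s₁ + z₁ - n₃ - z) - z * (n₁ - s₀ + 1)) =
      q ^ ((s : ℤ) * (s₀ + s₁ + z₁ - n₃)) * q ^ (-((z : ℤ) * (β - z₀ + z₁ + z₀ + 1 - (n₃ - z₁) -
        (β + z₁ + s₀ - n₁ - n₃ - s) - z₁))) := by
    rw [← zpow_add₀ hq.ne']
    congr 1
    ring
  rw [hz]
  ring

lemma sum_dblA_snd (hq : 0 < q) (s : ℕ) :
    ∑ z ∈ range (z₀ + 1), dblA q α β n₁ n₃ s₀ s₁ z₀ z₁ s z =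
      (-1) ^ s * q ^ ((s : ℤ) * (s₀ + s₁ + z₀ - n₃)) * (fac q (α - s₀ + s) * ifac q s *
        ifac q (s₀ - s) * ifac q (n₁ - s₀ + s) * ifac q (α + s₁ - s₀ + 1 + s)) *
        altSum q⁻¹ z₁ (n₁ + n₃ - s₀ - z₀ + s) (β + z₁ - z₀ + 1) (n₃ - z₀) z₀ := by
  rw [altSum_inv hq, mul_sum]
  refine sum_congr rfl fun z _ => ?_
  rw [dblA, ← Nat.cast_add, zpow_natCast, pow_add]
  have hz : q ^ ((s : ℤ) * (s₀ + s₁ + z₀ - n₃ - z) + z * (β - n₁ + s₀)) =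
      q ^ ((s : ℤ) * (s₀ + s₁ + z₀ - n₃)) * q ^ (-((z : ℤ) * (z₁ + (n₁ + n₃ - s₀ - z₀ + s) -
        (β + z₁ - z₀ + 1) - (n₃ - z₀) - z₀ + 1))) := by
    rw [← zpow_add₀ hq.ne']
    congr 1
    ring
  rw [hz]
  ring

lemma sum_dblA_fst (hq : 0 < q) (z : ℕ) :
    ∑ s ∈ range (s₀ + 1), dblA q α β n₁ n₃ s₀ s₁ z₀ z₁ s z =
      (-1) ^ z * q ^ ((z : ℤ) * (β - n₁ + s₀)) * (fac q (z₁ + z) * ifac q z * ifac q (z₀ - z) *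
        ifac q (n₃ - z₀ + z) * ifac q (β + z₁ - z₀ + 1 + z)) *
        altSum q⁻¹ (α - s₀) (n₁ + n₃ - s₀ - z₀ + z) (α + s₁ - s₀ + 1) (n₁ - s₀) s₀ := by
  rw [altSum_inv hq, mul_sum]
  refine sum_congr rfl fun s _ => ?_
  rw [dblA, ← Nat.cast_add, zpow_natCast, pow_add,
    show n₁ + n₃ - s₀ - z₀ + (z : ℤ) + s = n₁ + n₃ - s₀ - z₀ + s + z by ring]
  have hz : q ^ ((s : ℤ) * (s₀ + s₁ + z₀ - n₃ - z) + z * (β - n₁ + s₀)) =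
      q ^ ((z : ℤ) * (β - n₁ + s₀)) * q ^ (-((s : ℤ) * (α - s₀ + (n₁ + n₃ - s₀ - z₀ + z) -
        (α + s₁ - s₀ + 1) - (n₁ - s₀) - s₀ + 1))) := by
    rw [← zpow_add₀ hq.ne']
    congr 1
    ring
  rw [hz]
  ring

/-- The sum is reversed by `s ↦ s₁ - s`, which makes the decreasing numerator factorials increasing,
as `altSum` requires. -/
lemma sum_dblB_fst (hq : 0 < q) (z : ℕ) :
    ∑ s ∈ range (s₁ + 1), dblB q α β n₁ n₃ s₀ s₁ z₀ z₁ s z =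
      (-1) ^ s₁ * q ^ ((s₁ : ℤ) * (s₀ + s₁ + z₀ - n₃ - z) + z * (α + β - n₁ + s₁ + 1)) *
        (fac q (z₁ + z) * ifac q z * ifac q (z₀ - z) * ifac q (n₃ - z₀ + z) *
          ifac q (β + z₁ - z₀ + 1 + z)) *
        altSum q (α - s₀) (α - n₁) (α + 1) (α - n₁ - n₃ + z₀ - z) s₁ := by
  rw [altSum, mul_sum, ← sum_range_reflect]
  refine sum_congr rfl fun s hs => ?_
  have hs' : s ≤ s₁ := Nat.lt_succ_iff.1 (mem_range.1 hs)
  rw [dblB, Nat.add_sub_cancel, Nat.cast_sub hs',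
    show α + s₁ - s₀ - ((s₁ : ℤ) - s) = α - s₀ + s by ring,
    show α + s₁ - n₁ - ((s₁ : ℤ) - s) = α - n₁ + s by ring,
    show (s₁ : ℤ) - ((s₁ : ℤ) - s) = s by ring,
    show α + s₁ + 1 - ((s₁ : ℤ) - s) = α + 1 + s by ring,
    show α + s₁ + z₀ - n₁ - n₃ - ((s₁ : ℤ) - s) - z = α - n₁ - n₃ + z₀ - z + s by ring]
  have hsg : (-1 : ℝ) ^ ((s₁ : ℤ) - s) = (-1) ^ s₁ * (-1) ^ s := by
    rw [zpow_sub₀ (by norm_num), zpow_natCast, zpow_natCast, div_eq_mul_inv, ← inv_pow]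
    norm_num
  have hz : q ^ (((s₁ : ℤ) - s) * (s₀ + s₁ + z₀ - n₃ - z) + z * (α + β - n₁ + s₁ + 1)) =
      q ^ ((s₁ : ℤ) * (s₀ + s₁ + z₀ - n₃ - z) + z * (α + β - n₁ + s₁ + 1)) *
      q ^ ((s : ℤ) * (α - s₀ + (α - n₁) - (α + 1) - (α - n₁ - n₃ + z₀ - z) - s₁ + 1)) := by
    rw [← zpow_add₀ hq.ne']
    congr 1
    ring
  rw [hz, hsg]
  ring

lemma sum_dblE_snd (hq : 0 < q) (s : ℕ) :
    ∑ z ∈ range (z₁ + 1), dblE q α β n₁ n₃ s₀ s₁ z₀ z₁ s z =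
      q ^ (-(s : ℤ) * (α + β - n₁ + 1)) * (fac q (s₁ + s) * ifac q s *
        ifac q (β + z₁ + s₀ - n₁ - n₃ - s) * ifac q (s₀ - s) * ifac q (α + s₁ - s₀ + 1 + s)) *
        altSum q z₀ (β - n₁) (β + 1) (n₃ - z₁ - s₀ + s) z₁ := by
  rw [altSum, mul_sum]
  refine sum_congr rfl fun z _ => ?_
  rw [dblE, zpow_natCast]
  have hz : q ^ (-(s : ℤ) * (α + β - n₁ + z + 1) - z * (n₁ + n₃ - s₀ - z₀)) =
      q ^ (-(s : ℤ) * (α + β - n₁ + 1)) *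
      q ^ ((z : ℤ) * (z₀ + (β - n₁) - (β + 1) - (n₃ - z₁ - s₀ + s) - z₁ + 1)) := by
    rw [← zpow_add₀ hq.ne']
    congr 1
    ring
  rw [hz]
  ring

/-- The outer variable is `z₀ - z` because in this form the factors outside the inner sum agree with
those obtained from the fifth double sum. -/
lemma sum_dblD_fst (hq : 0 < q) (z : ℕ) :
    ∑ s ∈ range (s₀ + 1), dblD q α β n₁ n₃ s₀ s₁ z₀ z₁ s (z₀ - z) =
      (-1) ^ (s₀ + z₀ + z) * q ^ (((z₀ : ℤ) - z) * (z₀ + z₁ + s₀ - n₃)) * (fac q (β - z₀ + z) *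
        fac q (n₁ + n₃ - s₀ - z₀ + z) * ifac q z * ifac q (z₀ - z) *
        ifac q (β + z₁ - z₀ + 1 + z)) * mixSum q⁻¹ α s₁ (n₃ - s₀) (n₁ - z₀ + z) s₀ := by
  rw [mixSum_inv hq, mul_sum]
  refine sum_congr rfl fun s _ => ?_
  rw [dblD, show β - ((z₀ : ℤ) - z) = β - z₀ + z by ring,
    show n₁ + n₃ - s₀ - ((z₀ : ℤ) - z) = n₁ + n₃ - s₀ - z₀ + z by ring,
    show (z₀ : ℤ) - ((z₀ : ℤ) - z) = z by ring,
    show β + z₁ - ((z₀ : ℤ) - z) + 1 = β + z₁ - z₀ + 1 + z by ring,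
    show n₁ - ((z₀ : ℤ) - z) - s = n₁ - z₀ + z - s by ring]
  have hsg : (-1 : ℝ) ^ ((s₀ : ℤ) + s + (z₀ - z)) = (-1) ^ (s₀ + z₀ + z) * (-1) ^ s := by
    rw [← pow_add, ← zpow_natCast]
    push_cast
    rw [show (s₀ : ℤ) + s + (z₀ - z) = (s₀ + z₀ + z + s) + 2 * (-z) by ring,
      zpow_add₀ (by norm_num), zpow_mul]
    norm_num
  have hz : q ^ (((z₀ : ℤ) - z) * (z₀ + z₁ + s₀ - n₃ - s) - s * (α + s₁ - n₁ - n₃ + 1)) =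
      q ^ (((z₀ : ℤ) - z) * (z₀ + z₁ + s₀ - n₃)) *
      q ^ (-((s : ℤ) * (α + s₁ + 1 - (n₃ - s₀) - (n₁ - z₀ + z) - s₀))) := by
    rw [← zpow_add₀ hq.ne']
    congr 1
    ring
  rw [hz, hsg]
  ring

end DoubleSums

/-! ### From the fifth double sum to the third -/

section DoubleSums

variable {q : ℝ} {α β n₁ n₃ : ℤ} {s₀ s₁ z₀ z₁ : ℕ}

/-- `mixSum_eq_posSum` at `q⁻¹`, read backwards. The factor `1/[n₃ - z₁ + z]!` stays on the right,
so that the identity also covers `n₃ - z₁ + z < 0`, where both sides are zero. -/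
lemma fac_mul_posSum_eq_mixSum (hq : 0 < q) (z : ℕ) (h₁ : n₁ ≤ β) (h₂ : (s₀ : ℤ) ≤ α) :
    fac q (β - n₁ + z) * posSum q⁻¹ (α + β - n₁ + 1 + z) s₁ (α + s₁ - s₀ + 1)
      (n₃ - z₁ - s₀ + z) (β + z₁ + s₀ - n₁ - n₃) s₀ =
    q ^ (-(s₀ : ℤ) * (β + z₁ + s₀ - n₁ - n₃)) * (ifac q (α - s₀) * fac q s₁ *
      ifac q (n₃ - z₁ + z)) * mixSum q⁻¹ (β - n₁ + s₀ + z) (α - s₀) (α + s₁ - s₀ + 1)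
        (β + z₁ + s₀ - n₁ - n₃) s₀ := by
  rcases lt_or_ge (n₃ - z₁ + z) 0 with h | h
  · rw [posSum_eq_zero (.inr (by omega)), ifac_neg q h]
    ring
  have hm := mixSum_eq_posSum (inv_pos.2 hq) (x := β - n₁ + s₀ + z) (y := α - s₀)
    (C := α + s₁ - s₀ + 1) (m := β + z₁ + s₀ - n₁ - n₃) s₀ (by omega) (by omega) (by omega)
    (by omega)
  rw [hm]
  simp only [fac_inv hq, ifac_inv hq, inv_zpow']
  rw [show β - n₁ + s₀ + z - (β + z₁ + s₀ - n₁ - n₃) = n₃ - z₁ + z by ring,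
    show β - n₁ + s₀ + (z : ℤ) - s₀ = β - n₁ + z by ring,
    show α + s₁ - s₀ + 1 - (α - s₀) - 1 = (s₁ : ℤ) by ring,
    show β - n₁ + s₀ + z + (α - s₀) + 1 = α + β - n₁ + 1 + z by ring,
    show β - n₁ + z - (β + z₁ + s₀ - n₁ - n₃) = n₃ - z₁ - s₀ + z by ring]
  have c1 := fac_mul_ifac hq h
  have c2 := fac_mul_ifac hq (show 0 ≤ α - s₀ by omega)
  have c3 := fac_mul_ifac hq (show (0 : ℤ) ≤ s₁ by omega)
  have hz : q ^ (-(s₀ : ℤ) * (β + z₁ + s₀ - n₁ - n₃)) *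
      q ^ (-(-(s₀ : ℤ) * (β + z₁ + s₀ - n₁ - n₃))) = 1 := by
    rw [← zpow_add₀ hq.ne', show -(s₀ : ℤ) * (β + z₁ + s₀ - n₁ - n₃) +
      -(-(s₀ : ℤ) * (β + z₁ + s₀ - n₁ - n₃)) = 0 by ring, zpow_zero]
  set P := posSum q⁻¹ (α + β - n₁ + 1 + z) s₁ (α + s₁ - s₀ + 1) (n₃ - z₁ - s₀ + z)
    (β + z₁ + s₀ - n₁ - n₃) s₀
  calc _ = 1 * 1 * 1 * 1 * (fac q (β - n₁ + z) * P) := by ring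
    _ = _ := by
      nth_rewrite 1 [← hz]
      nth_rewrite 1 [← c1]
      nth_rewrite 1 [← c2]
      rw [← c3]
      ring

/-- The single-sum form through which the fifth double sum is related to the first and the
third. -/
noncomputable def auxSum (q : ℝ) (α β n₁ n₃ : ℤ) (s₀ s₁ z₀ z₁ : ℕ) : ℝ :=
  ∑ s ∈ range (s₀ + 1), (-1) ^ s * q ^ ((s : ℤ) * (s₀ + s₁ + z₁ - n₃)) * (fac q (α - s₀ + s) *
    ifac q s * ifac q (s₀ - s) * ifac q (α + s₁ - s₀ + 1 + s) *
    ifac q (β + z₁ + s₀ - n₁ - n₃ - s)) *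
    altSum q z₀ (β - n₁ + s₀ - s) (β + 1) (n₃ - z₁) z₁

/-- The sum over `s` at fixed `z` is transformed and the order of summation is exchanged. Now the
sum over `z` at fixed `s` is an `altSum`, which can be transformed in more than one way. -/
lemma sum_dblE_eq_auxSum (hq : 0 < q) (h₁ : n₁ ≤ β) (h₂ : (s₀ : ℤ) ≤ α) :
    ∑ s ∈ range (s₀ + 1), ∑ z ∈ range (z₁ + 1), dblE q α β n₁ n₃ s₀ s₁ z₀ z₁ s z =
      q ^ (-(s₀ : ℤ) * (β + z₁ + s₀ - n₁ - n₃)) * (ifac q (α - s₀) * fac q s₁) *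
        auxSum q α β n₁ n₃ s₀ s₁ z₀ z₁ := by
  rw [sum_comm, auxSum]
  simp only [sum_dblE_fst hq, altSum, mul_sum]
  rw [sum_comm (s := range (s₀ + 1))]
  refine sum_congr rfl fun z _ => ?_
  have e := fac_mul_posSum_eq_mixSum (s₁ := s₁) (n₃ := n₃) (z₁ := z₁) hq z h₁ h₂
  set P := posSum q⁻¹ (α + β - n₁ + 1 + z) s₁ (α + s₁ - s₀ + 1) (n₃ - z₁ - s₀ + z)
    (β + z₁ + s₀ - n₁ - n₃) s₀
  rw [mixSum_inv hq, mul_sum] at e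
  calc _ = (-1) ^ z * q ^ (-(z : ℤ) * (n₁ + n₃ - s₀ - z₀)) * (fac q (z₀ + z) *
        ifac q z * ifac q (z₁ - z) * ifac q (β + 1 + z)) * (fac q (β - n₁ + z) * P) := by ring
    _ = _ := by
      rw [e, mul_sum]
      refine sum_congr rfl fun s _ => ?_
      rw [show β - n₁ + s₀ + (z : ℤ) - s = β - n₁ + s₀ - s + z by ring]
      have hz : q ^ (-(z : ℤ) * (n₁ + n₃ - s₀ - z₀)) * q ^ (-((s : ℤ) * (β - n₁ + s₀ + z +
          (α - s₀) + 1 - (α + s₁ - s₀ + 1) - (β + z₁ + s₀ - n₁ - n₃) - s₀))) =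
          q ^ ((s : ℤ) * (s₀ + s₁ + z₁ - n₃)) *
          q ^ ((z : ℤ) * (z₀ + (β - n₁ + s₀ - s) - (β + 1) - (n₃ - z₁) - z₁ + 1)) := by
        rw [← zpow_add₀ hq.ne', ← zpow_add₀ hq.ne']
        congr 1
        ring
      linear_combination ((-1) ^ z * (-1) ^ s * q ^ (-(s₀ : ℤ) * (β + z₁ + s₀ - n₁ - n₃)) *
        (fac q (z₀ + z) * ifac q z * ifac q (z₁ - z) * ifac q (β + 1 + z)) *
        (ifac q (α - s₀) * fac q s₁ * ifac q (n₃ - z₁ + z)) * (fac q (α - s₀ + s) *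
        fac q (β - n₁ + s₀ - s + z) * ifac q s * ifac q (α + s₁ - s₀ + 1 + s) *
        ifac q (β + z₁ + s₀ - n₁ - n₃ - s) * ifac q (s₀ - s))) * hz

/-- For fixed `s` this is `altSum_eq_mixSum`, in the case `B < D` with `B = z₀` and `D = β + 1`. If
`β + z₁ + s₀ - n₁ - n₃ - s` is negative, both sides vanish. -/
lemma auxSum_eq_sum_dblC (hq : 0 < q) (h₁ : n₁ ≤ β) (h₃ : (z₀ : ℤ) ≤ β) :
    auxSum q α β n₁ n₃ s₀ s₁ z₀ z₁ =
      q ^ ((z₁ : ℤ) * (z₀ + 1)) * (ifac q (β - z₀) * ifac q (β + 1 + z₁)) *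
      ∑ s ∈ range (s₀ + 1), ∑ z ∈ range (z₁ + 1), dblC q α β n₁ n₃ s₀ s₁ z₀ z₁ s z := by
  rw [auxSum, mul_sum]
  refine sum_congr rfl fun s hs => ?_
  have hs' : s ≤ s₀ := Nat.lt_succ_iff.1 (mem_range.1 hs)
  rw [sum_dblC_snd hq]
  rcases lt_or_ge (β + z₁ + s₀ - n₁ - n₃ - s) 0 with h | h
  · rw [ifac_neg q h]
    have : mixSum q⁻¹ (β - z₀ + z₁) z₀ (n₃ - z₁) (β + z₁ + s₀ - n₁ - n₃ - s) z₁ = 0 := by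
      refine sum_eq_zero fun z _ => ?_
      rw [ifac_neg q⁻¹ (show β + z₁ + s₀ - n₁ - n₃ - s - (z : ℤ) < 0 by omega)]
      ring
    rw [this]
    ring
  rw [altSum_comm, altSum_eq_mixSum hq (A := β - n₁ + s₀ - s) (B := z₀) (C := n₃ - z₁)
    (D := β + 1) z₁ (by omega) (by omega) (by omega) (by omega)]
  rw [show β - n₁ + s₀ - s - (n₃ - z₁) = β + z₁ + s₀ - n₁ - n₃ - s by ring,
    show β + 1 - (z₀ : ℤ) - 1 = β - z₀ by ring]
  have c1 := fac_mul_ifac hq h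
  linear_combination ((-1) ^ s * q ^ ((s : ℤ) * (s₀ + s₁ + z₁ - n₃)) * (fac q (α - s₀ + s) *
    ifac q s * ifac q (s₀ - s) * ifac q (α + s₁ - s₀ + 1 + s)) *
    (q ^ ((z₁ : ℤ) * (z₀ + 1)) * fac q (β - n₁ + s₀ - s) * ifac q (β - z₀) *
      ifac q (β + 1 + z₁)) *
    mixSum q⁻¹ (β - z₀ + z₁) z₀ (n₃ - z₁) (β + z₁ + s₀ - n₁ - n₃ - s) z₁) * c1

/-- The fifth double sum in terms of the third. -/
theorem sum_dblE_eq_sum_dblC (hq : 0 < q) (h₁ : n₁ ≤ β) (h₂ : (s₀ : ℤ) ≤ α)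
    (h₃ : (z₀ : ℤ) ≤ β) :
    ∑ s ∈ range (s₀ + 1), ∑ z ∈ range (z₁ + 1), dblE q α β n₁ n₃ s₀ s₁ z₀ z₁ s z =
      q ^ ((z₁ : ℤ) * (z₀ + 1) - s₀ * (β + z₁ + s₀ - n₁ - n₃)) *
        (ifac q (α - s₀) * fac q s₁ * ifac q (β - z₀) * ifac q (β + 1 + z₁)) *
      ∑ s ∈ range (s₀ + 1), ∑ z ∈ range (z₁ + 1), dblC q α β n₁ n₃ s₀ s₁ z₀ z₁ s z := by
  rw [sum_dblE_eq_auxSum hq h₁ h₂, auxSum_eq_sum_dblC hq h₁ h₃,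
    sub_eq_add_neg (_ * _ : ℤ), zpow_add₀ hq.ne', ← neg_mul]
  ring

end DoubleSums

/-! ### Transformations of `altSum` into another `altSum` -/

section DoubleSums

variable {q : ℝ} {α β n₁ n₃ : ℤ} {s₀ s₁ z₀ z₁ : ℕ}

/-- Both series are multiples of one and the same `mixSum`, the left one after reversal. The
reciprocal factorial on either side covers the degenerate ranges: where it is zero, the series on
the opposite side becomes a `posSum` without nonzero terms. -/
lemma ifac_mul_altSum_eq_inv (hq : 0 < q) {s : ℕ} (hs : s ≤ s₀) (h₁ : n₁ ≤ β)
    (h₂ : n₃ ≤ z₀ + z₁) (h₃ : s₀ + z₀ ≤ n₁ + n₃) :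
    ifac q (β + z₁ + s₀ - n₁ - n₃ - s) * altSum q z₀ (β - n₁ + s₀ - s) (β + 1) (n₃ - z₁) z₁ =
    (-1) ^ (z₀ + z₁ - n₃) * q ^ (z₁ * (β - n₁ + s₀ - s + 1) +
      z₀ * (n₁ + n₃ - s₀ - z₀ + s + 1) - (z₀ + z₁ - n₃) * (β - z₀ + 1)) *
      (fac q z₀ * ifac q z₁ * ifac q (n₁ - s₀ + s)) *
      altSum q⁻¹ z₁ (n₁ + n₃ - s₀ - z₀ + s) (β + z₁ - z₀ + 1) (n₃ - z₀) z₀ := by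
  have hq0 := hq.ne'
  rcases lt_or_ge (n₁ - s₀ + s) 0 with h | h
  · rw [ifac_neg q h, altSum_comm, altSum_comm_left, altSum_eq_posSum hq z₁ (by omega) (by omega)
      (by omega) (by omega), posSum_eq_zero (by omega)]
    ring
  rcases lt_or_ge (β + z₁ + s₀ - n₁ - n₃ - s) 0 with h' | h'
  · rw [ifac_neg q h', altSum_comm q⁻¹, altSum_comm_left q⁻¹, altSum_eq_posSum (inv_pos.2 hq) z₀
      (by omega) (by omega) (by omega) (by omega), posSum_eq_zero (by omega)]
    ring
  obtain ⟨M, hM⟩ := Int.eq_ofNat_of_zero_le (show 0 ≤ z₀ + z₁ - n₃ by omega)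
  have c1 := fac_mul_ifac hq h'
  have c2 := fac_mul_ifac hq (show (0 : ℤ) ≤ z₁ by omega)
  have e1 := altSum_eq_mixSum hq (A := z₀) (B := β - n₁ + s₀ - s) (C := n₃ - z₁) (D := β + 1) z₁
    (by omega) (by omega) (by omega) (by omega)
  rw [show (z₀ : ℤ) - (n₃ - z₁) = M by omega,
    show β + 1 - (β - n₁ + s₀ - s) - 1 = n₁ - s₀ + s by ring,
    mixSum_reflect (inv_pos.2 hq) _ _ _ M z₁ z₀ (by omega), inv_inv, inv_zpow',
    show β - n₁ + s₀ - s + (M : ℤ) = β + z₁ + s₀ - n₁ - n₃ - s + z₀ by omega,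
    show n₁ - s₀ + s + z₁ - (M : ℤ) = n₁ + n₃ - s₀ - z₀ + s by omega,
    show (z₁ : ℤ) - M = n₃ - z₀ by omega,
    show n₁ - s₀ + s + z₁ + (β - n₁ + s₀ - s) + 1 - (n₃ - z₁) - M - (z₁ : ℤ) = β - z₀ + 1
      by omega] at e1
  have e2 := altSum_eq_mixSum (inv_pos.2 hq) (A := z₁) (B := n₁ + n₃ - s₀ - z₀ + s) (C := n₃ - z₀)
    (D := β + z₁ - z₀ + 1) z₀ (by omega) (by omega) (by omega) (by omega)
  simp only [fac_inv hq, ifac_inv hq, inv_inv, inv_zpow'] at e2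
  rw [show (z₁ : ℤ) - (n₃ - z₀) = M by omega,
    show β + z₁ - z₀ + 1 - (n₁ + n₃ - s₀ - z₀ + s) - 1 = β + z₁ + s₀ - n₁ - n₃ - s by ring,
    show β + (z₁ : ℤ) - z₀ + 1 + z₀ = β + 1 + z₁ by ring] at e2
  rw [altSum_comm q, altSum_comm_left q, e1, altSum_comm q⁻¹, altSum_comm_left q⁻¹, e2, hM,
    zpow_natCast]
  have hz : q ^ (z₁ * (β - n₁ + s₀ - s + 1) + z₀ * (n₁ + n₃ - s₀ - z₀ + s + 1) -
      M * (β - z₀ + 1)) * q ^ (-(z₀ * (n₁ + n₃ - s₀ - z₀ + s + 1))) =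
      q ^ (z₁ * (β - n₁ + s₀ - s + 1)) * q ^ (-(M * (β - z₀ + 1))) := by
    rw [← zpow_add₀ hq0, ← zpow_add₀ hq0]
    congr 1
    ring
  set S := mixSum q (β + z₁ + s₀ - n₁ - n₃ - s + z₀) (n₁ + n₃ - s₀ - z₀ + s) (n₃ - z₀) M z₀
  set i1 := ifac q (β + z₁ + s₀ - n₁ - n₃ - s)
  linear_combination (-((-1) ^ M * fac q z₀ * ifac q z₁ * ifac q (n₁ - s₀ + s) * fac q M *
    fac q z₁ * i1 * ifac q (β + 1 + z₁) * S)) * hz -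
    ((-1) ^ M * q ^ (z₁ * (β - n₁ + s₀ - s + 1)) * q ^ (-(M * (β - z₀ + 1))) * fac q z₀ *
     ifac q (n₁ - s₀ + s) * fac q M * i1 * ifac q (β + 1 + z₁) * S) * c2

/-- Both sides have a normal form `vdwSum`, and the two normal forms are reversals of each other. -/
lemma altSum_inv_eq_altSum (hq : 0 < q) (p : ℕ) (h₁ : n₁ ≤ α) (h₂ : (s₀ : ℤ) ≤ α)
    (h₃ : s₀ ≤ n₁ + p) (h₄ : p ≤ s₀ + s₁) :
    altSum q⁻¹ (α - s₀) (n₁ - s₀ + p) (α + s₁ - s₀ + 1) (n₁ - s₀) s₀ =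
      (-1) ^ p * q ^ (p * (α + s₁ + 1) - (s₀ + s₁) * (α - s₀ + p + 1)) *
        altSum q (α - s₀) (α - n₁) (α + 1) (α - n₁ - p) s₁ := by
  have e1 := altSum_eq_vdwSum (inv_pos.2 hq) (A := α - s₀) (B := n₁ - s₀ + p)
    (C := α + s₁ - s₀ + 1) (D := n₁ - s₀) s₀ (by omega) (by omega) (by omega) (by omega) (by omega)
    (by omega)
  simp only [fac_inv hq, ifac_inv hq, inv_zpow'] at e1
  rw [show α - s₀ + (n₁ - s₀ + p) - (n₁ - s₀) + 1 = α - s₀ + p + 1 by ring,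
    show α - s₀ - (n₁ - s₀) = α - n₁ by ring, show n₁ - s₀ + p - (n₁ - s₀) = (p : ℤ) by ring,
    show α + s₁ - s₀ + 1 - (α - s₀) - 1 = (s₁ : ℤ) by ring,
    show α + s₁ - s₀ + 1 + (s₀ : ℤ) = α + 1 + s₁ by ring] at e1
  have e2 := altSum_eq_vdwSum hq (A := α - s₀) (B := α - n₁) (C := α + 1) (D := α - n₁ - p) s₁
    (by omega) (by omega) (by omega) (by omega) (by omega) (by omega)
  rw [show α - n₁ - (α - n₁ - p) = (p : ℤ) by ring,
    show α + 1 - (α - s₀) - 1 = (s₀ : ℤ) by ring,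
    show α - s₀ + (α - n₁) - (α - n₁ - p) + 1 = α - s₀ + p + 1 by ring,
    show α - s₀ - (α - n₁ - p) = n₁ - s₀ + p by ring,
    vdwSum_reflect hq _ _ _ _ p s₁ s₀ (by omega),
    show n₁ - s₀ + p - p = n₁ - s₀ by ring, show α - n₁ - p + (p : ℤ) = α - n₁ by ring] at e2
  rw [e1, e2, show (s₀ : ℤ) + s₁ - p = s₁ + s₀ - p by ring]
  have hs : (-1 : ℝ) ^ p * (-1) ^ p = 1 := by rw [← mul_pow]; norm_num
  have hz : q ^ (p * (α + s₁ + 1) - (s₀ + s₁) * (α - s₀ + p + 1)) *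
      q ^ (s₁ * (α - s₀ + p + 1)) * q ^ (p * -(α + 1 + s₁)) =
      q ^ (-(s₀ * (α - s₀ + p + 1))) := by
    rw [← zpow_add₀ hq.ne', ← zpow_add₀ hq.ne']
    congr 1
    ring
  rw [← hz]
  linear_combination (-(q ^ (p * (α + s₁ + 1) - (s₀ + s₁) * (α - s₀ + p + 1)) *
      q ^ (s₁ * (α - s₀ + p + 1)) * q ^ (p * -(α + 1 + s₁)) * (fac q (α - s₀) * fac q (α - n₁) *
      fac q (n₁ - s₀ + p) * fac q p * fac q (s₁ + s₀ - p) * ifac q (α + 1 + s₁)) *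
      vdwSum q⁻¹ (-(α + 1 + s₁)) (n₁ - s₀) (s₁ - p) p (α - n₁) s₀)) * hs

/-- Again both sides are compared through `vdwSum`, but here the two normal forms differ by the
shift `n₃ - z₁ - s₀ + s` of the summation variable. As before, a vanishing reciprocal factorial on
one side is matched by a vanishing series on the other. -/
lemma ifac_mul_altSum_eq (hq : 0 < q) {s : ℕ} (hs : s ≤ s₀) (h₁ : n₁ ≤ β) (hz : (z₀ : ℤ) ≤ β)
    (h₂ : n₃ ≤ z₀ + z₁) (h₃ : s₀ + z₀ ≤ n₁ + n₃) :
    ifac q (β + z₁ + s₀ - n₁ - n₃ - s) * altSum q z₀ (β - n₁) (β + 1) (n₃ - z₁ - s₀ + s) z₁ =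
    (-1) ^ (n₃ - z₁ - s₀ + s) * q ^ (z₁ * (z₀ + β - n₁ - (n₃ - z₁ - s₀ + s) + 1) -
      z₀ * (β - z₀ + n₃ - s₀ + s + 1) + (n₃ - z₁ - s₀ + s) * (β + 1 + z₁)) *
      (fac q z₀ * ifac q (β - z₀) * ifac q (n₃ - s₀ + s)) *
      altSum q (β - z₀) (n₁ + n₃ - s₀ - z₀ + s) (β + z₁ - z₀ + 1) (n₁ - z₀) z₀ := by
  rcases lt_or_ge (n₃ - s₀ + s) 0 with h | h
  · have : altSum q z₀ (β - n₁) (β + 1) (n₃ - z₁ - s₀ + s) z₁ = 0 := by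
      refine sum_eq_zero fun z hz => ?_
      have := mem_range.1 hz
      rw [ifac_neg q (show n₃ - z₁ - s₀ + s + (z : ℤ) < 0 by omega)]
      ring
    rw [this, ifac_neg q h]
    ring
  have e2 := altSum_eq_vdwSum hq (A := β - z₀) (B := n₁ + n₃ - s₀ - z₀ + s)
    (C := β + z₁ - z₀ + 1) (D := n₁ - z₀) z₀ (by omega) (by omega) (by omega) (by omega)
    (by omega) (by omega)
  rw [show β - z₀ + (n₁ + n₃ - s₀ - z₀ + s) - (n₁ - z₀) + 1 = β - z₀ + n₃ - s₀ + s + 1 by ring,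
    show β - z₀ - (n₁ - z₀) = β - n₁ by ring,
    show n₁ + n₃ - s₀ - z₀ + s - (n₁ - z₀) = n₃ - s₀ + s by ring,
    show β + z₁ - z₀ + 1 - (β - z₀) - 1 = (z₁ : ℤ) by ring,
    show β + z₁ - z₀ + 1 + (z₀ : ℤ) = β + 1 + z₁ by ring] at e2
  rw [e2]
  rcases lt_or_ge (β + z₁ + s₀ - n₁ - n₃ - s) 0 with h' | h'
  · have : vdwSum q (-(β + 1 + z₁)) (n₁ - z₀) (z₁ - (n₃ - s₀ + s)) (n₃ - s₀ + s) (β - n₁) z₀ =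
        0 := by
      refine sum_eq_zero fun t _ => ?_
      rcases lt_or_ge (β - n₁ - t) 0 with ht | ht
      · rw [ifac_neg q ht]
        ring
      · rw [ifac_neg q (show (z₁ : ℤ) - (n₃ - s₀ + s) + t < 0 by omega)]
        ring
    rw [this, ifac_neg q h']
    ring
  have e1 := altSum_eq_vdwSum hq (A := z₀) (B := β - n₁) (C := β + 1) (D := n₃ - z₁ - s₀ + s) z₁
    (by omega) (by omega) (by omega) (by omega) (by omega) (by omega)
  rw [vdwSum_shift hq _ _ _ _ _ z₁ z₀ (by omega),
    show β - n₁ - (n₃ - z₁ - s₀ + s) = β + z₁ + s₀ - n₁ - n₃ - s by ring,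
    show β + z₁ + s₀ - n₁ - n₃ - s + (n₃ - z₁ - s₀ + s) = β - n₁ by ring,
    show z₁ + (n₃ - z₁ - s₀ + s) = n₃ - s₀ + s by ring,
    show β + 1 - z₀ - 1 - (β + z₁ + s₀ - n₁ - n₃ - s) - (n₃ - z₁ - s₀ + s) = n₁ - z₀ by ring,
    show β + 1 - z₀ - 1 + z₁ - (β + z₁ + s₀ - n₁ - n₃ - s) = n₁ + n₃ - s₀ - z₀ + s by ring,
    show -(n₃ - z₁ - s₀ + s) = z₁ - (n₃ - s₀ + s) by ring,
    show (z₀ : ℤ) - (n₃ - z₁ - s₀ + s) = z₀ + z₁ - (n₃ - s₀ + s) by ring,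
    show (z₀ : ℤ) + (β - n₁) - (n₃ - z₁ - s₀ + s) + 1 = z₀ + β - n₁ - (n₃ - z₁ - s₀ + s) + 1
      by ring] at e1
  rw [e1, show (z₁ : ℤ) + z₀ - (n₃ - s₀ + s) = z₀ + z₁ - (n₃ - s₀ + s) by ring]
  have c1 := fac_mul_ifac hq h
  have c2 := fac_mul_ifac hq h'
  have c3 := fac_mul_ifac hq (show 0 ≤ β - z₀ by omega)
  have hz : q ^ (z₁ * (z₀ + β - n₁ - (n₃ - z₁ - s₀ + s) + 1) -
      z₀ * (β - z₀ + n₃ - s₀ + s + 1) + (n₃ - z₁ - s₀ + s) * (β + 1 + z₁)) *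
      q ^ (z₀ * (β - z₀ + n₃ - s₀ + s + 1)) =
      q ^ (z₁ * (z₀ + β - n₁ - (n₃ - z₁ - s₀ + s) + 1)) *
      q ^ (-((n₃ - z₁ - s₀ + s) * -(β + 1 + z₁))) := by
    rw [← zpow_add₀ hq.ne', ← zpow_add₀ hq.ne']
    congr 1
    ring
  set V := vdwSum q (-(β + 1 + z₁)) (n₁ - z₀) (z₁ - (n₃ - s₀ + s)) (n₃ - s₀ + s) (β - n₁) z₀
  set W := (-1 : ℝ) ^ (n₃ - z₁ - s₀ + s) * (fac q z₀ * fac q (β - n₁) *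
    fac q (z₀ + z₁ - (n₃ - s₀ + s)) * fac q (n₁ + n₃ - s₀ - z₀ + s) * ifac q (β + 1 + z₁)) * V
  set E1 := q ^ (z₁ * (z₀ + β - n₁ - (n₃ - z₁ - s₀ + s) + 1))
  set E2 := q ^ (-((n₃ - z₁ - s₀ + s) * -(β + 1 + z₁)))
  set i1 := ifac q (n₃ - s₀ + s) with hi1
  set i3 := ifac q (β - z₀) with hi3
  linear_combination (E1 * E2 * W) * c2 - (i1 * i3 * fac q (n₃ - s₀ + s) * fac q (β - z₀) * W) *
    hz - (E1 * E2 * W) * c1 - (E1 * E2 * W * fac q (n₃ - s₀ + s) * i1) * c3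

end DoubleSums

/-! ### From the fifth double sum to the first, second and fourth -/

section DoubleSums

variable {q : ℝ} {α β n₁ n₃ : ℤ} {s₀ s₁ z₀ z₁ : ℕ}

/-- The sum over `z` in `auxSum` is replaced at fixed `s` by means of `ifac_mul_altSum_eq_inv`; the
range of `z` changes from `z₁` to `z₀`. -/
lemma auxSum_eq_sum_dblA (hq : 0 < q) (h₁ : n₁ ≤ β) (h₂ : n₃ ≤ z₀ + z₁)
    (h₃ : s₀ + z₀ ≤ n₁ + n₃) :
    auxSum q α β n₁ n₃ s₀ s₁ z₀ z₁ = (-1) ^ (z₀ + z₁ - n₃) * q ^ (z₁ * (β - n₁ + s₀ + 1) +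
      z₀ * (n₁ + n₃ - s₀ - z₀ + 1) - (z₀ + z₁ - n₃) * (β - z₀ + 1)) * (fac q z₀ * ifac q z₁) *
      ∑ s ∈ range (s₀ + 1), ∑ z ∈ range (z₀ + 1), dblA q α β n₁ n₃ s₀ s₁ z₀ z₁ s z := by
  rw [auxSum, mul_sum]
  refine sum_congr rfl fun s hs => ?_
  have hs' : s ≤ s₀ := Nat.lt_succ_iff.1 (mem_range.1 hs)
  have e := ifac_mul_altSum_eq_inv hq hs' h₁ h₂ h₃
  rw [sum_dblA_snd hq]
  have hz : q ^ ((s : ℤ) * (s₀ + s₁ + z₁ - n₃)) * q ^ (z₁ * (β - n₁ + s₀ - s + 1) +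
      z₀ * (n₁ + n₃ - s₀ - z₀ + s + 1) - (z₀ + z₁ - n₃) * (β - z₀ + 1)) =
      q ^ (z₁ * (β - n₁ + s₀ + 1) + z₀ * (n₁ + n₃ - s₀ - z₀ + 1) - (z₀ + z₁ - n₃) * (β - z₀ + 1)) *
      q ^ ((s : ℤ) * (s₀ + s₁ + z₀ - n₃)) := by
    rw [← zpow_add₀ hq.ne', ← zpow_add₀ hq.ne']
    congr 1
    ring
  set c := (-1) ^ s * (fac q (α - s₀ + s) * ifac q s * ifac q (s₀ - s) *
    ifac q (α + s₁ - s₀ + 1 + s)) with hc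
  set A := altSum q⁻¹ z₁ (n₁ + n₃ - s₀ - z₀ + s) (β + z₁ - z₀ + 1) (n₃ - z₀) z₀ with hA
  linear_combination (c * q ^ ((s : ℤ) * (s₀ + s₁ + z₁ - n₃))) * e +
    ((-1) ^ (z₀ + z₁ - n₃) * (fac q z₀ * ifac q z₁ * ifac q (n₁ - s₀ + s)) * A * c) * hz

/-- The fifth double sum in terms of the first. -/
theorem sum_dblE_eq_sum_dblA (hq : 0 < q) (h₁ : n₁ ≤ β) (h₂ : (s₀ : ℤ) ≤ α) (h₃ : n₃ ≤ z₀ + z₁)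
    (h₄ : s₀ + z₀ ≤ n₁ + n₃) :
    ∑ s ∈ range (s₀ + 1), ∑ z ∈ range (z₁ + 1), dblE q α β n₁ n₃ s₀ s₁ z₀ z₁ s z =
      (-1) ^ (z₀ + z₁ - n₃) * q ^ (z₁ * (β - n₁ + s₀ + 1) + z₀ * (n₁ + n₃ - s₀ - z₀ + 1) -
        (z₀ + z₁ - n₃) * (β - z₀ + 1) - s₀ * (β + z₁ + s₀ - n₁ - n₃)) *
        (ifac q (α - s₀) * fac q s₁ * fac q z₀ * ifac q z₁) *
      ∑ s ∈ range (s₀ + 1), ∑ z ∈ range (z₀ + 1), dblA q α β n₁ n₃ s₀ s₁ z₀ z₁ s z := by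
  rw [sum_dblE_eq_auxSum hq h₁ h₂, auxSum_eq_sum_dblA hq h₁ h₃ h₄,
    sub_eq_add_neg _ (s₀ * _ : ℤ), zpow_add₀ hq.ne', ← neg_mul]
  ring

/-- Only the sum over `s` at fixed `z` is changed, by `altSum_inv_eq_altSum` with `p = n₃ - z₀ + z`.
Both double sums contain `1/[p]!`, so negative `p` does not contribute. -/
lemma sum_dblA_eq_sum_dblB (hq : 0 < q) (h₁ : n₁ ≤ α) (h₂ : (s₀ : ℤ) ≤ α) (h₃ : n₃ ≤ s₀ + s₁)
    (h₄ : s₀ + z₀ ≤ n₁ + n₃) :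
    ∑ s ∈ range (s₀ + 1), ∑ z ∈ range (z₀ + 1), dblA q α β n₁ n₃ s₀ s₁ z₀ z₁ s z =
      (-1) ^ (n₃ - z₀ + s₁) * q ^ ((n₃ - z₀) * (α + s₁ + 1) -
        (s₀ + s₁) * (α - s₀ + n₃ - z₀ + 1) - s₁ * (s₀ + s₁ + z₀ - n₃)) *
      ∑ s ∈ range (s₁ + 1), ∑ z ∈ range (z₀ + 1), dblB q α β n₁ n₃ s₀ s₁ z₀ z₁ s z := by
  rw [sum_comm, sum_comm (s := range (s₁ + 1)), mul_sum]
  refine sum_congr rfl fun z hz => ?_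
  have hz' : z ≤ z₀ := Nat.lt_succ_iff.1 (mem_range.1 hz)
  rw [sum_dblA_fst hq, sum_dblB_fst hq]
  rcases lt_or_ge (n₃ - z₀ + z) 0 with h | h
  · rw [ifac_neg q h]
    ring
  obtain ⟨p, hp⟩ := Int.eq_ofNat_of_zero_le h
  have e := altSum_inv_eq_altSum (s₁ := s₁) hq p h₁ h₂ (by omega) (by omega)
  rw [show n₁ + n₃ - s₀ - z₀ + z = n₁ - s₀ + p by omega, e, hp,
    show α - n₁ - n₃ + z₀ - z = α - n₁ - p by omega]
  have hs : (-1 : ℝ) ^ (n₃ - z₀ + s₁) * (-1) ^ s₁ = (-1) ^ p * (-1) ^ z := by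
    rw [show n₃ - z₀ + s₁ = (p : ℤ) + z + s₁ + 2 * (-z) by omega, zpow_add₀ (by norm_num),
      zpow_mul, zpow_add₀ (by norm_num), zpow_add₀ (by norm_num)]
    simp only [zpow_natCast]
    have : (-1 : ℝ) ^ s₁ * (-1) ^ s₁ = 1 := by rw [← mul_pow]; norm_num
    norm_num
    linear_combination ((-1) ^ p * (-1) ^ z) * this
  have hz : q ^ ((z : ℤ) * (β - n₁ + s₀)) *
      q ^ (p * (α + s₁ + 1) - (s₀ + s₁) * (α - s₀ + p + 1)) =
      q ^ ((n₃ - z₀) * (α + s₁ + 1) - (s₀ + s₁) * (α - s₀ + n₃ - z₀ + 1) -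
        s₁ * (s₀ + s₁ + z₀ - n₃)) *
      q ^ ((s₁ : ℤ) * (s₀ + s₁ + z₀ - n₃ - z) + z * (α + β - n₁ + s₁ + 1)) := by
    rw [← zpow_add₀ hq.ne', ← zpow_add₀ hq.ne', ← hp]
    congr 1
    ring
  set c := fac q (z₁ + z) * ifac q z * ifac q (z₀ - z) * ifac q p * ifac q (β + z₁ - z₀ + 1 + z)
  set V := altSum q (α - s₀) (α - n₁) (α + 1) (α - n₁ - p) s₁
  linear_combination ((-1) ^ p * (-1) ^ z * c * V) * hz - (q ^ ((n₃ - z₀) * (α + s₁ + 1) -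
      (s₀ + s₁) * (α - s₀ + n₃ - z₀ + 1) - s₁ * (s₀ + s₁ + z₀ - n₃)) *
      q ^ ((s₁ : ℤ) * (s₀ + s₁ + z₀ - n₃ - z) + z * (α + β - n₁ + s₁ + 1)) * c * V) * hs

/-- The fifth double sum in terms of the second. -/
theorem sum_dblE_eq_sum_dblB (hq : 0 < q) (h₁ : n₁ ≤ β) (h₂ : (s₀ : ℤ) ≤ α) (h₃ : n₃ ≤ z₀ + z₁)
    (h₄ : s₀ + z₀ ≤ n₁ + n₃) (h₅ : n₁ ≤ α) (h₆ : n₃ ≤ s₀ + s₁) :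
    ∑ s ∈ range (s₀ + 1), ∑ z ∈ range (z₁ + 1), dblE q α β n₁ n₃ s₀ s₁ z₀ z₁ s z =
      (-1) ^ (s₁ + z₁ : ℤ) * q ^ (z₁ * (β - n₁ + s₀ + 1) + z₀ * (n₁ + n₃ - s₀ - z₀ + 1) -
        (z₀ + z₁ - n₃) * (β - z₀ + 1) - s₀ * (β + z₁ + s₀ - n₁ - n₃) +
        (n₃ - z₀) * (α + s₁ + 1) - (s₀ + s₁) * (α - s₀ + n₃ - z₀ + 1) -
        s₁ * (s₀ + s₁ + z₀ - n₃)) *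
        (ifac q (α - s₀) * fac q s₁ * fac q z₀ * ifac q z₁) *
      ∑ s ∈ range (s₁ + 1), ∑ z ∈ range (z₀ + 1), dblB q α β n₁ n₃ s₀ s₁ z₀ z₁ s z := by
  rw [sum_dblE_eq_sum_dblA hq h₁ h₂ h₃ h₄, sum_dblA_eq_sum_dblB hq h₅ h₂ h₆ h₄]
  have hs : (-1 : ℝ) ^ (s₁ + z₁ : ℤ) = (-1) ^ (z₀ + z₁ - n₃) * (-1) ^ (n₃ - z₀ + s₁) := by
    rw [← zpow_add₀ (by norm_num)]
    congr 1
    ring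
  have hz : q ^ (z₁ * (β - n₁ + s₀ + 1) + z₀ * (n₁ + n₃ - s₀ - z₀ + 1) -
        (z₀ + z₁ - n₃) * (β - z₀ + 1) - s₀ * (β + z₁ + s₀ - n₁ - n₃) +
        (n₃ - z₀) * (α + s₁ + 1) - (s₀ + s₁) * (α - s₀ + n₃ - z₀ + 1) -
        s₁ * (s₀ + s₁ + z₀ - n₃)) = q ^ (z₁ * (β - n₁ + s₀ + 1) +
        z₀ * (n₁ + n₃ - s₀ - z₀ + 1) - (z₀ + z₁ - n₃) * (β - z₀ + 1) -
        s₀ * (β + z₁ + s₀ - n₁ - n₃)) * q ^ ((n₃ - z₀) * (α + s₁ + 1) -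
        (s₀ + s₁) * (α - s₀ + n₃ - z₀ + 1) - s₁ * (s₀ + s₁ + z₀ - n₃)) := by
    rw [← zpow_add₀ hq.ne']
    congr 1
    ring
  rw [hs, hz]
  ring

lemma ifac_mul_altSum_eq_mixSum (hq : 0 < q) {z : ℕ} (h₁ : (s₀ : ℤ) ≤ α)
    (h₂ : s₀ + z₀ ≤ n₁ + n₃) :
    ifac q (n₁ - z₀ + z) *
      altSum q s₁ (n₁ + n₃ - s₀ - z₀ + z) (α + s₁ - s₀ + 1) (n₃ - s₀) s₀ =
    q ^ ((s₀ : ℤ) * (s₁ + 1)) * (fac q (n₁ + n₃ - s₀ - z₀ + z) * ifac q (α - s₀) *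
      ifac q (α + s₁ + 1)) * mixSum q⁻¹ α s₁ (n₃ - s₀) (n₁ - z₀ + z) s₀ := by
  rcases lt_or_ge (n₁ - z₀ + z) 0 with h | h
  · have : mixSum q⁻¹ α s₁ (n₃ - s₀) (n₁ - z₀ + z) s₀ = 0 := by
      refine sum_eq_zero fun s _ => ?_
      rw [ifac_neg q⁻¹ (show n₁ - z₀ + z - (s : ℤ) < 0 by omega)]
      ring
    rw [this, ifac_neg q h]
    ring
  have c := fac_mul_ifac hq h
  rw [altSum_comm, altSum_eq_mixSum hq s₀ (by omega) (by omega) (by omega) (by omega),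
    show n₁ + n₃ - s₀ - z₀ + z - (n₃ - s₀) = n₁ - z₀ + z by ring,
    show α + s₁ - s₀ + 1 - s₁ - 1 = α - s₀ by ring,
    show α + s₁ - s₀ + 1 + s₀ = α + s₁ + 1 by ring, show α - s₀ + s₀ = α by ring]
  linear_combination (q ^ ((s₀ : ℤ) * (s₁ + 1)) * (fac q (n₁ + n₃ - s₀ - z₀ + z) *
    ifac q (α - s₀) * ifac q (α + s₁ + 1)) * mixSum q⁻¹ α s₁ (n₃ - s₀) (n₁ - z₀ + z) s₀) * c

/-- The fifth double sum in terms of the fourth. -/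
theorem sum_dblE_eq_sum_dblD (hq : 0 < q) (h₁ : n₁ ≤ β) (h₂ : (s₀ : ℤ) ≤ α) (h₃ : n₃ ≤ z₀ + z₁)
    (h₄ : s₀ + z₀ ≤ n₁ + n₃) (h₅ : (z₀ : ℤ) ≤ β) :
    ∑ s ∈ range (s₀ + 1), ∑ z ∈ range (z₁ + 1), dblE q α β n₁ n₃ s₀ s₁ z₀ z₁ s z =
      (-1) ^ (n₃ - z₁ + z₀) * q ^ (z₁ * (z₀ + β - n₁ - n₃ + z₁ + s₀ + 1) -
        z₀ * (β - z₀ + n₃ - s₀ + 1) + (n₃ - z₁ - s₀) * (β + 1 + z₁) + s₀ * (s₁ + 1) -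
        z₀ * (z₀ + z₁ + s₀ - n₃)) *
        (fac q z₀ * ifac q (β - z₀) * ifac q (α - s₀) * ifac q (α + s₁ + 1)) *
      ∑ s ∈ range (s₀ + 1), ∑ z ∈ range (z₀ + 1), dblD q α β n₁ n₃ s₀ s₁ z₀ z₁ s z := by
  have hD : ∑ s ∈ range (s₀ + 1), ∑ z ∈ range (z₀ + 1), dblD q α β n₁ n₃ s₀ s₁ z₀ z₁ s z =
      ∑ z ∈ range (z₀ + 1), ∑ s ∈ range (s₀ + 1), dblD q α β n₁ n₃ s₀ s₁ z₀ z₁ s (z₀ - z) := by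
    rw [sum_comm, ← sum_range_reflect]
    refine sum_congr rfl fun z hz => sum_congr rfl fun s _ => ?_
    rw [Nat.add_sub_cancel, Nat.cast_sub (Nat.lt_succ_iff.1 (mem_range.1 hz))]
  rw [hD]
  simp only [sum_dblD_fst hq, sum_dblE_snd hq, mul_sum]
  -- Replacing the sum over `z` at fixed `s` by the other `altSum` makes the sum over `s` at fixed
  -- `z` an `altSum` too, and the latter becomes the `mixSum` inside the fourth double sum.
  have hE : ∀ s ∈ range (s₀ + 1), q ^ (-(s : ℤ) * (α + β - n₁ + 1)) * (fac q (s₁ + s) *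
      ifac q s * ifac q (β + z₁ + s₀ - n₁ - n₃ - s) * ifac q (s₀ - s) *
      ifac q (α + s₁ - s₀ + 1 + s)) * altSum q z₀ (β - n₁) (β + 1) (n₃ - z₁ - s₀ + s) z₁ =
      ∑ z ∈ range (z₀ + 1), (-1) ^ (n₃ - z₁ - s₀) * q ^ (z₁ * (z₀ + β - n₁ - n₃ + z₁ + s₀ + 1) -
        z₀ * (β - z₀ + n₃ - s₀ + 1) + (n₃ - z₁ - s₀) * (β + 1 + z₁)) *
        (fac q z₀ * ifac q (β - z₀)) * ((-1) ^ z * q ^ ((z : ℤ) * (n₃ - s₀ - z₀ - z₁)) *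
        (fac q (β - z₀ + z) * ifac q z * ifac q (z₀ - z) * ifac q (β + z₁ - z₀ + 1 + z))) *
        (ifac q (n₁ - z₀ + z) * ((-1) ^ s * q ^ ((s : ℤ) * (s₁ + (n₁ + n₃ - s₀ - z₀ + z) -
          (α + s₁ - s₀ + 1) - (n₃ - s₀) - s₀ + 1)) * (fac q (s₁ + s) *
          fac q (n₁ + n₃ - s₀ - z₀ + z + s) * ifac q s * ifac q (s₀ - s) *
          ifac q (α + s₁ - s₀ + 1 + s) * ifac q (n₃ - s₀ + s)))) := by
    intro s hs
    have e := ifac_mul_altSum_eq hq (Nat.lt_succ_iff.1 (mem_range.1 hs)) h₁ h₅ h₃ h₄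
    calc _ = q ^ (-(s : ℤ) * (α + β - n₁ + 1)) * (fac q (s₁ + s) * ifac q s * ifac q (s₀ - s) *
          ifac q (α + s₁ - s₀ + 1 + s)) * (ifac q (β + z₁ + s₀ - n₁ - n₃ - s) *
          altSum q z₀ (β - n₁) (β + 1) (n₃ - z₁ - s₀ + s) z₁) := by ring
      _ = _ := by
        rw [e, altSum, mul_sum, mul_sum]
        refine sum_congr rfl fun z _ => ?_
        rw [zpow_add₀ (show (-1 : ℝ) ≠ 0 by norm_num) _ (s : ℤ), zpow_natCast,
          show n₁ + n₃ - s₀ - z₀ + z + (s : ℤ) = n₁ + n₃ - s₀ - z₀ + s + z by ring]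
        have hz : q ^ (-(s : ℤ) * (α + β - n₁ + 1)) * q ^ (z₁ * (z₀ + β - n₁ -
            (n₃ - z₁ - s₀ + s) + 1) - z₀ * (β - z₀ + n₃ - s₀ + s + 1) +
            (n₃ - z₁ - s₀ + s) * (β + 1 + z₁)) * q ^ ((z : ℤ) * (β - z₀ +
            (n₁ + n₃ - s₀ - z₀ + s) - (β + z₁ - z₀ + 1) - (n₁ - z₀) - z₀ + 1)) =
            q ^ (z₁ * (z₀ + β - n₁ - n₃ + z₁ + s₀ + 1) - z₀ * (β - z₀ + n₃ - s₀ + 1) +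
            (n₃ - z₁ - s₀) * (β + 1 + z₁)) * q ^ ((z : ℤ) * (n₃ - s₀ - z₀ - z₁)) *
            q ^ ((s : ℤ) * (s₁ + (n₁ + n₃ - s₀ - z₀ + z) - (α + s₁ - s₀ + 1) - (n₃ - s₀) -
            s₀ + 1)) := by
          simp only [← zpow_add₀ hq.ne']
          congr 1
          ring
        linear_combination ((-1) ^ (n₃ - z₁ - s₀) * (-1) ^ s * (-1) ^ z * (fac q z₀ *
          ifac q (β - z₀)) * (fac q (β - z₀ + z) * ifac q z * ifac q (z₀ - z) *
          ifac q (β + z₁ - z₀ + 1 + z)) * ifac q (n₁ - z₀ + z) * (fac q (s₁ + s) *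
          fac q (n₁ + n₃ - s₀ - z₀ + s + z) * ifac q s * ifac q (s₀ - s) *
          ifac q (α + s₁ - s₀ + 1 + s) * ifac q (n₃ - s₀ + s))) * hz
  rw [sum_congr rfl hE, sum_comm]
  refine sum_congr rfl fun z _ => ?_
  rw [← mul_sum, ← mul_sum, ← altSum, ifac_mul_altSum_eq_mixSum hq h₂ h₄]
  have hs : (-1 : ℝ) ^ (n₃ - z₁ + z₀) * (-1) ^ (s₀ + z₀ + z) =
      (-1) ^ (n₃ - z₁ - s₀) * (-1) ^ z := by
    rw [← zpow_natCast, ← zpow_natCast, ← zpow_add₀ (by norm_num), ← zpow_add₀ (by norm_num)]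
    push_cast
    rw [show n₃ - z₁ + z₀ + (s₀ + z₀ + z : ℤ) = n₃ - z₁ - s₀ + z + 2 * (s₀ + z₀) by ring,
      zpow_add₀ (by norm_num) _ (2 * _), zpow_mul]
    norm_num
  have hz : q ^ (z₁ * (z₀ + β - n₁ - n₃ + z₁ + s₀ + 1) - z₀ * (β - z₀ + n₃ - s₀ + 1) +
      (n₃ - z₁ - s₀) * (β + 1 + z₁)) * q ^ ((z : ℤ) * (n₃ - s₀ - z₀ - z₁)) *
      q ^ ((s₀ : ℤ) * (s₁ + 1)) = q ^ (z₁ * (z₀ + β - n₁ - n₃ + z₁ + s₀ + 1) -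
        z₀ * (β - z₀ + n₃ - s₀ + 1) + (n₃ - z₁ - s₀) * (β + 1 + z₁) + s₀ * (s₁ + 1) -
        z₀ * (z₀ + z₁ + s₀ - n₃)) * q ^ (((z₀ : ℤ) - z) * (z₀ + z₁ + s₀ - n₃)) := by
    simp only [← zpow_add₀ hq.ne']
    congr 1
    ring
  set c := fac q z₀ * ifac q (β - z₀) * (fac q (β - z₀ + z) * ifac q z * ifac q (z₀ - z) *
    ifac q (β + z₁ - z₀ + 1 + z)) * (fac q (n₁ + n₃ - s₀ - z₀ + z) * ifac q (α - s₀) *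
      ifac q (α + s₁ + 1)) * mixSum q⁻¹ α s₁ (n₃ - s₀) (n₁ - z₀ + z) s₀
  linear_combination ((-1) ^ (n₃ - z₁ - s₀) * (-1) ^ z * c) * hz - (q ^ (z₁ * (z₀ + β - n₁ - n₃ +
    z₁ + s₀ + 1) - z₀ * (β - z₀ + n₃ - s₀ + 1) + (n₃ - z₁ - s₀) * (β + 1 + z₁) + s₀ * (s₁ + 1) -
    z₀ * (z₀ + z₁ + s₀ - n₃)) * q ^ (((z₀ : ℤ) - z) * (z₀ + z₁ + s₀ - n₃)) * c) * hs

end DoubleSums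

/-! ### The product of the three Racah sums in the stretched case -/

/-- A lower limit of summation exceeds an upper one. This is applied backwards, to conclude that the
transformed sums `descPart` and `ascPart` vanish where a triangular condition fails. -/
lemma racah_eq_zero {q : ℝ} {n : ℕ} {q₂ q₃ t₁ t₂ t₃ t₄ : ℤ}
    (h : q₂ < t₁ ∨ q₂ < t₃ ∨ q₃ < t₄) : racah q n q₂ q₃ t₁ t₂ t₃ t₄ = 0 := by
  refine sum_eq_zero fun z _ => ?_
  rcases h with h | h | h
  · rcases lt_or_ge (z : ℤ) t₁ with h' | h'
    · rw [ifac_neg q (show (z : ℤ) - t₁ < 0 by omega)]; ring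
    · rw [ifac_neg q (show q₂ - (z : ℤ) < 0 by omega)]; ring
  · rcases lt_or_ge (z : ℤ) t₃ with h' | h'
    · rw [ifac_neg q (show (z : ℤ) - t₃ < 0 by omega)]; ring
    · rw [ifac_neg q (show q₂ - (z : ℤ) < 0 by omega)]; ring
  · rcases lt_or_ge (z : ℤ) t₄ with h' | h'
    · rw [ifac_neg q (show (z : ℤ) - t₄ < 0 by omega)]; ring
    · rw [ifac_neg q (show q₃ - (z : ℤ) < 0 by omega)]; ring

/-- This is where `g = e + f` enters: an upper and a lower limit of summation are both `t`. -/
lemma racah_stretched (q : ℝ) {n t : ℕ} {q₃ t₂ t₃ t₄ : ℤ} :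
    racah q n t q₃ t t₂ t₃ t₄ = (-1) ^ t * (fac q (t + 1) * (ifac q (t - t₂) *
      ifac q (t - t₃) * ifac q (t - t₄) * ifac q (n - t) * ifac q (q₃ - t))) := by
  have h : ∀ z : ℕ, z ≠ t → ifac q ((z : ℤ) - t) * ifac q ((t : ℤ) - z) = 0 := by
    intro z hz
    rcases lt_or_gt_of_ne hz with h | h
    · rw [ifac_neg q (show (z : ℤ) - t < 0 by omega), zero_mul]
    · rw [ifac_neg q (show (t : ℤ) - z < 0 by omega), mul_zero]
  rw [racah, sum_eq_single t]
  · rw [sub_self, ifac_zero]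
    ring
  · intro z _ hz
    linear_combination ((-1) ^ z * fac q (z + 1) * ifac q (z - t₂) * ifac q (z - t₃) *
      ifac q (z - t₄) * ifac q (n - z) * ifac q (q₃ - z)) * h z hz
  · intro ht
    rw [ifac_neg q (show (n : ℤ) - t < 0 by rw [mem_range] at ht; omega)]
    ring

section StretchedSum

variable (q : ℝ) (α β n₁ n₃ : ℤ) (s₀ s₁ z₀ z₁ : ℕ)

/-- The `i`-dependent polynomial part of the first six-`j` coefficient. -/
noncomputable def descPart (i : ℕ) : ℝ :=
  ∑ u ∈ range (s₀ + 1), (-1) ^ u * (fac q (α + β + s₀ + s₁ + z₁ - n₁ - n₃ + 1 - u) *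
    fac q (n₁ + n₃ - z₀ - u) * fac q (s₀ + s₁ - u) * (ifac q u * ifac q (α + s₁ + 1 - u) *
    ifac q (β + s₀ + s₁ + z₁ - n₁ - n₃ + i + 1 - u) * ifac q (n₁ + n₃ - z₀ - i - u) *
    ifac q (s₀ - u)))

/-- The `i`-dependent polynomial part of the second six-`j` coefficient. -/
noncomputable def ascPart (i : ℕ) : ℝ :=
  ∑ v ∈ range (z₁ + 1), (-1) ^ v * (fac q (β - n₁ + i + v) * fac q (z₀ + v) *
    fac q (s₀ + s₁ + z₁ - n₃ - v) * (ifac q v *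
    ifac q (s₀ + s₁ + z₀ + z₁ - n₁ - 2 * n₃ + i - v) * ifac q (z₁ - v) *
    ifac q (n₃ - z₁ + v) * ifac q (β + 1 + v)))

variable {q α β n₁ n₃ s₀ s₁ z₀ z₁}

lemma racah_eq_descPart (hq : 0 < q) {i n : ℕ} {q₂ q₃ t₁ t₂ t₃ t₄ : ℤ}
    (hn : n = α + β + s₀ + s₁ + z₁ - n₁ - n₃) (hq₂ : q₂ = α + β + s₁ + z₁ - n₁ - n₃ + i)
    (hq₃ : q₃ = α + β + s₀ + 2 * s₁ + z₀ + z₁ - 2 * n₁ - 2 * n₃ + i)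
    (ht₁ : t₁ = α + β + s₀ + s₁ + z₀ + z₁ - 2 * n₁ - 2 * n₃ + i)
    (ht₂ : t₂ = α + β + s₁ + z₁ - n₁ - n₃) (ht₃ : t₃ = α + s₁)
    (ht₄ : t₄ = β + s₀ + s₁ + z₁ - n₁ - n₃ + i)
    (h1 : 0 ≤ t₁) (hα : 0 ≤ α) (h4 : 0 ≤ t₄) (hm : 0 ≤ β + z₁ + s₀ - n₁ - n₃) (hi : i ≤ α)
    (h2 : 0 ≤ t₂) :
    racah q n q₂ q₃ t₁ t₂ t₃ t₄ = (-1) ^ n * (fac q (α + s₁ + 1) * fac q (t₄ + 1) *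
      ifac q (β + z₁ + s₀ - n₁ - n₃) * ifac q (α - i) * ifac q (n₁ + n₃ - s₀ - z₀) *
      ifac q s₁ * ifac q i * ifac q (s₀ + s₁ + z₀ - n₁ - n₃ + i)) *
      descPart q α β n₁ n₃ s₀ s₁ z₀ z₁ i := by
  rw [racah_eq_desc hq (by omega) h1 (by omega) h4 (by omega) (by omega) (by omega), descPart,
    sum_range_extend (m := s₀) (n := n) (by omega)]
  · rw [show t₃ + 1 = α + s₁ + 1 by omega, show (n : ℤ) - t₃ = β + z₁ + s₀ - n₁ - n₃ by omega,
      show n - t₄ = α - i by omega, show q₂ - t₁ = n₁ + n₃ - s₀ - z₀ by omega,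
      show q₃ - t₁ = s₁ by omega, show q₂ - t₂ = i by omega,
      show q₃ - t₂ = s₀ + s₁ + z₀ - n₁ - n₃ + i by omega]
    congr 1
    refine sum_congr rfl fun u _ => ?_
    rw [hn, show α + β + s₀ + s₁ + z₁ - n₁ - n₃ + q₂ - t₁ - t₂ - u = n₁ + n₃ - z₀ - u by omega,
      show α + β + s₀ + s₁ + z₁ - n₁ - n₃ + q₃ - t₁ - t₂ - u = s₀ + s₁ - u by omega,
      show t₄ + 1 - u = β + s₀ + s₁ + z₁ - n₁ - n₃ + i + 1 - u by omega,
      show α + β + s₀ + s₁ + z₁ - n₁ - n₃ - t₁ - u = n₁ + n₃ - z₀ - i - u by omega,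
      show α + β + s₀ + s₁ + z₁ - n₁ - n₃ - t₂ - u = s₀ - u by omega]
  · intro u hu
    rw [ifac_neg q (show (s₀ : ℤ) - u < 0 by omega)]
    ring

lemma racah_eq_ascPart (hq : 0 < q) {i n : ℕ} {q₂ q₃ t₁ t₂ t₃ t₄ : ℤ}
    (hn : n = β + s₀ + s₁ + z₀ + 2 * z₁ - n₁ - 2 * n₃ + i)
    (hq₂ : q₂ = β + s₀ + s₁ + z₀ + z₁ - n₁ - n₃ + i) (hq₃ : q₃ = β + s₀ + s₁ + z₁ - n₃)
    (ht₁ : t₁ = β + z₁) (ht₂ : t₂ = β + s₀ + s₁ + z₀ + z₁ - n₁ - 2 * n₃ + i)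
    (ht₃ : t₃ = s₀ + s₁ + z₀ + z₁ - n₃) (ht₄ : t₄ = β + s₀ + s₁ + z₁ - n₁ - n₃ + i)
    (h1 : 0 ≤ t₁) (h3 : n₃ ≤ z₀ + z₁) (h4 : n₁ ≤ β) (h5 : 0 ≤ β + z₁ - n₁ - n₃ + i)
    (h6 : 0 ≤ s₀ + s₁ + z₀ + z₁ - n₁ - 2 * n₃ + i) (h2 : 0 ≤ t₂) :
    racah q n q₂ q₃ t₁ t₂ t₃ t₄ = (-1) ^ n * (fac q (β + z₁ + 1) * fac q (t₂ + 1) *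
      ifac q (β + z₁ - n₁ - n₃ + i) * ifac q (z₀ + z₁ - n₃) * ifac q (β - n₁ + i) *
      ifac q z₀ * ifac q (s₀ + s₁ - n₃) * ifac q (n₁ + n₃ - z₀ - i)) *
      ascPart q β n₁ n₃ s₀ s₁ z₀ z₁ i := by
  rw [racah_eq_asc hq (by omega) h1 (by omega) (by omega) (by omega) (by omega) (by omega)
    (by omega), ascPart, sum_range_extend (m := z₁) (n := n) (by omega)]
  · rw [show t₁ + 1 = β + z₁ + 1 by omega, show (n : ℤ) - t₃ = β + z₁ - n₁ - n₃ + i by omega,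
      show n - t₄ = z₀ + z₁ - n₃ by omega, show q₂ - t₃ = β - n₁ + i by omega,
      show q₂ - t₄ = z₀ by omega, show q₃ - t₁ = s₀ + s₁ - n₃ by omega,
      show q₃ - t₂ = n₁ + n₃ - z₀ - i by omega]
    congr 1
    refine sum_congr rfl fun v _ => ?_
    rw [show n + q₃ - t₁ - t₂ - v = s₀ + s₁ + z₁ - n₃ - v by omega,
      show (n : ℤ) - t₁ - v = s₀ + s₁ + z₀ + z₁ - n₁ - 2 * n₃ + i - v by omega,
      show (n : ℤ) - t₂ - v = z₁ - v by omega, show q₂ - n + v = n₃ - z₁ + v by omega,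
      show t₁ + t₂ - n + 1 + v = β + 1 + v by omega]
  · intro v hv
    rw [ifac_neg q (show (z₁ : ℤ) - v < 0 by omega)]
    ring

lemma descPart_eq_zero {i : ℕ} (h : n₁ + n₃ - z₀ - i < 0) :
    descPart q α β n₁ n₃ s₀ s₁ z₀ z₁ i = 0 := by
  refine sum_eq_zero fun u _ => ?_
  rw [ifac_neg q (show n₁ + n₃ - z₀ - (i : ℤ) - u < 0 by omega)]
  ring

lemma ascPart_eq_zero {i : ℕ} (h : s₀ + s₁ + z₀ + z₁ - n₁ - 2 * n₃ + i < 0) :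
    ascPart q β n₁ n₃ s₀ s₁ z₀ z₁ i = 0 := by
  refine sum_eq_zero fun v _ => ?_
  rw [ifac_neg q (show s₀ + s₁ + z₀ + z₁ - n₁ - 2 * n₃ + (i : ℤ) - v < 0 by omega)]
  ring

end StretchedSum

section

lemma ifac_ne_zero {q : ℝ} (hq : 0 < q) {n : ℤ} (hn : 0 ≤ n) : ifac q n ≠ 0 :=
  right_ne_zero_of_mul_eq_one (fac_mul_ifac hq hn)

lemma fac_ne_zero {q : ℝ} (hq : 0 < q) {n : ℤ} (hn : 0 ≤ n) : fac q n ≠ 0 :=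
  left_ne_zero_of_mul_eq_one (fac_mul_ifac hq hn)

/-- The integer parameters of a stretched nine-`j` coefficient. -/
structure StretchedParams (α β n₁ n₃ : ℤ) (s₀ s₁ z₀ z₁ : ℕ) : Prop where
  n₁_nonneg : 0 ≤ n₁
  n₃_nonneg : 0 ≤ n₃
  n₁_le_α : n₁ ≤ α
  n₁_le_β : n₁ ≤ β
  s₀_le : (s₀ : ℤ) ≤ α
  z₀_le : (z₀ : ℤ) ≤ β
  n₃_le : n₃ ≤ s₀ + s₁
  n₃_le' : n₃ ≤ z₀ + z₁
  ghk : 0 ≤ α + s₁ + z₀ - n₁ - n₃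
  gkh : 0 ≤ β + z₁ + s₀ - n₁ - n₃
  hkg : s₀ + z₀ ≤ n₁ + n₃

variable {q : ℝ} {α β n₁ n₃ : ℤ} {s₀ s₁ z₀ z₁ : ℕ}

/-- The factorials in front are the squares of the three triangle coefficients that involve `j`, for
`(a, g, j)`, `(k, c, j)` and `(f, b, j)`. In the triangular range they cancel all `i`-dependent
factors of the transformed sums except those on the right. Outside that range the left side is zero,
and the right side has to be shown to vanish as well. -/
lemma racah_mul_racah_mul_racah (hq : 0 < q) (hP : StretchedParams α β n₁ n₃ s₀ s₁ z₀ z₁)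
    {i nA nB nC t : ℕ} (hA : nA = α + β + s₀ + s₁ + z₁ - n₁ - n₃)
    (hB : nB = β + s₀ + s₁ + z₀ + 2 * z₁ - n₁ - 2 * n₃ + i)
    (hC : nC = α + β + s₀ + s₁ + z₀ + z₁ - n₁ - 2 * n₃)
    (ht : t = α + β + s₀ + s₁ + z₀ + z₁ - 2 * n₁ - 2 * n₃ + i) :
    fac q (α - i) * fac q i * fac q (β + s₀ + s₁ + z₀ + z₁ - 2 * n₁ - 2 * n₃ + i) *
      ifac q (t + 1) *
      (fac q (n₁ + n₃ - z₀ - i) * fac q (β + z₁ - n₁ - n₃ + i) *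
        fac q (s₀ + s₁ + z₀ - n₁ - n₃ + i) * ifac q (β + s₀ + s₁ + z₁ - n₁ - n₃ + i + 1)) *
      (fac q (n₁ - i) * fac q (s₀ + s₁ + z₀ + z₁ - n₁ - 2 * n₃ + i) * fac q (β - n₁ + i) *
        ifac q (β + s₀ + s₁ + z₀ + z₁ - n₁ - 2 * n₃ + i + 1)) *
      racah q nA (α + β + s₁ + z₁ - n₁ - n₃ + i)
        (α + β + s₀ + 2 * s₁ + z₀ + z₁ - 2 * n₁ - 2 * n₃ + i)
        t (α + β + s₁ + z₁ - n₁ - n₃) (α + s₁) (β + s₀ + s₁ + z₁ - n₁ - n₃ + i) *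
      racah q nB (β + s₀ + s₁ + z₀ + z₁ - n₁ - n₃ + i) (β + s₀ + s₁ + z₁ - n₃)
        (β + z₁) (β + s₀ + s₁ + z₀ + z₁ - n₁ - 2 * n₃ + i) (s₀ + s₁ + z₀ + z₁ - n₃)
        (β + s₀ + s₁ + z₁ - n₁ - n₃ + i) *
      racah q nC t (t + β - n₁) t (α + β - n₁)
        (α + β + s₀ + s₁ + z₀ + z₁ - 2 * n₁ - 2 * n₃)
        (β + s₀ + s₁ + z₀ + z₁ - n₁ - 2 * n₃ + i) =
    (-1) ^ nA * (-1) ^ nB * (-1) ^ t * (fac q (α + s₁ + 1) * ifac q (β + z₁ + s₀ - n₁ - n₃) *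
      ifac q (n₁ + n₃ - s₀ - z₀) * ifac q s₁ * fac q (β + z₁ + 1) * ifac q (z₀ + z₁ - n₃) *
      ifac q z₀ * ifac q (s₀ + s₁ - n₃) * ifac q (α - n₁) * ifac q (β - n₁)) *
      (fac q (β + s₀ + s₁ + z₀ + z₁ - 2 * n₁ - 2 * n₃ + i) * ifac q i *
        descPart q α β n₁ n₃ s₀ s₁ z₀ z₁ i * ascPart q β n₁ n₃ s₀ s₁ z₀ z₁ i) := by
  obtain ⟨h1, h3, h1a, h1b, hs0, hz0, h3a, h3b, hg1, hg2, hg3⟩ := hP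
  rcases lt_or_ge (β + s₀ + s₁ + z₀ + z₁ - 2 * n₁ - 2 * n₃ + i) 0 with hX | hX
  · rw [fac_neg q hX]
    ring
  rcases lt_or_ge (n₁ + n₃ - z₀ - i) 0 with h | hm
  · rw [fac_neg q h, descPart_eq_zero h]
    ring
  rcases lt_or_ge (s₀ + s₁ + z₀ + z₁ - n₁ - 2 * n₃ + i) 0 with h | hf
  · rw [fac_neg q h, ascPart_eq_zero h]
    ring
  have eD : (i : ℤ) ≤ α → _ := racah_eq_descPart hq (i := i) hA rfl rfl ht rfl rfl rfl
    (by omega) (by omega) (by omega) (by omega)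
  rcases lt_or_ge (β + z₁ - n₁ - n₃ + i) 0 with h | hk
  · have e := eD (by omega) (by omega)
    -- The Racah sum is zero here although the prefactor of its transformed version is not, so the
    -- transformed sum must vanish.
    rw [racah_eq_zero (by omega), eq_comm] at e
    have : descPart q α β n₁ n₃ s₀ s₁ z₀ z₁ i = 0 := by
      refine (mul_eq_zero.1 e).resolve_left ?_
      refine mul_ne_zero (by simp) ?_
      repeat' apply mul_ne_zero
      all_goals first
        | exact fac_ne_zero hq (by omega)
        | exact ifac_ne_zero hq (by omega)
    rw [this, fac_neg q h]
    ring
  have eA := racah_eq_ascPart hq (i := i) hB rfl rfl rfl rfl rfl rfl (by omega) (by omega)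
    (by omega) hk (by omega) (by omega)
  have hasc : (s₀ + s₁ + z₀ - n₁ - n₃ + i < 0 ∨ n₁ - i < 0) →
      ascPart q β n₁ n₃ s₀ s₁ z₀ z₁ i = 0 := by
    intro h
    have e := eA
    rw [racah_eq_zero (by omega), eq_comm] at e
    refine (mul_eq_zero.1 e).resolve_left ?_
    refine mul_ne_zero (by simp) ?_
    repeat' apply mul_ne_zero
    all_goals first
      | exact fac_ne_zero hq (by omega)
      | exact ifac_ne_zero hq (by omega)
  rcases lt_or_ge (s₀ + s₁ + z₀ - n₁ - n₃ + (i : ℤ)) 0 with h | hc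
  · rw [fac_neg q h, hasc (.inl h)]
    ring
  rcases lt_or_ge (n₁ - i) 0 with h | hb
  · rw [fac_neg q h, hasc (.inr h)]
    ring
  rw [eA, eD (by omega) (by omega), racah_stretched,
    show (t : ℤ) - (α + β - n₁) = s₀ + s₁ + z₀ + z₁ - n₁ - 2 * n₃ + i by omega,
    show (t : ℤ) - (α + β + s₀ + s₁ + z₀ + z₁ - 2 * n₁ - 2 * n₃) = i by omega,
    show (t : ℤ) - (β + s₀ + s₁ + z₀ + z₁ - n₁ - 2 * n₃ + i) = α - n₁ by omega,
    show (nC : ℤ) - t = n₁ - i by omega, show t + β - n₁ - (t : ℤ) = β - n₁ by ring]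
  have c1 := fac_mul_ifac hq (show 0 ≤ α - i by omega)
  have c2 := fac_mul_ifac hq (show (0 : ℤ) ≤ i by omega)
  have c3 := fac_mul_ifac hq (show (0 : ℤ) ≤ t + 1 by omega)
  have c4 := fac_mul_ifac hq hm
  have c5 := fac_mul_ifac hq hk
  have c6 := fac_mul_ifac hq hc
  have c7 := fac_mul_ifac hq (show 0 ≤ β + s₀ + s₁ + z₁ - n₁ - n₃ + i + 1 by omega)
  have c8 := fac_mul_ifac hq hb
  have c9 := fac_mul_ifac hq hf
  have c10 := fac_mul_ifac hq (show 0 ≤ β - n₁ + i by omega)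
  have c11 := fac_mul_ifac hq
    (show 0 ≤ β + s₀ + s₁ + z₀ + z₁ - n₁ - 2 * n₃ + i + 1 by omega)
  calc _ = (fac q (α - i) * ifac q (α - i)) * (fac q i * ifac q i) *
        (fac q (t + 1) * ifac q (t + 1)) *
        (fac q (n₁ + n₃ - z₀ - i) * ifac q (n₁ + n₃ - z₀ - i)) *
        (fac q (β + z₁ - n₁ - n₃ + i) * ifac q (β + z₁ - n₁ - n₃ + i)) *
        (fac q (s₀ + s₁ + z₀ - n₁ - n₃ + i) * ifac q (s₀ + s₁ + z₀ - n₁ - n₃ + i)) *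
        (fac q (β + s₀ + s₁ + z₁ - n₁ - n₃ + i + 1) *
          ifac q (β + s₀ + s₁ + z₁ - n₁ - n₃ + i + 1)) *
        (fac q (n₁ - i) * ifac q (n₁ - i)) *
        (fac q (s₀ + s₁ + z₀ + z₁ - n₁ - 2 * n₃ + i) *
          ifac q (s₀ + s₁ + z₀ + z₁ - n₁ - 2 * n₃ + i)) *
        (fac q (β - n₁ + i) * ifac q (β - n₁ + i)) *
        (fac q (β + s₀ + s₁ + z₀ + z₁ - n₁ - 2 * n₃ + i + 1) *
          ifac q (β + s₀ + s₁ + z₀ + z₁ - n₁ - 2 * n₃ + i + 1)) *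
        ((-1) ^ nA * (-1) ^ nB * (-1) ^ t * (fac q (α + s₁ + 1) *
          ifac q (β + z₁ + s₀ - n₁ - n₃) *
      ifac q (n₁ + n₃ - s₀ - z₀) * ifac q s₁ * fac q (β + z₁ + 1) * ifac q (z₀ + z₁ - n₃) *
      ifac q z₀ * ifac q (s₀ + s₁ - n₃) * ifac q (α - n₁) * ifac q (β - n₁)) *
      (fac q (β + s₀ + s₁ + z₀ + z₁ - 2 * n₁ - 2 * n₃ + i) * ifac q i *
        descPart q α β n₁ n₃ s₀ s₁ z₀ z₁ i * ascPart q β n₁ n₃ s₀ s₁ z₀ z₁ i)) := by ring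
    _ = _ := by rw [c1, c2, c3, c4, c5, c6, c7, c8, c9, c10, c11]; ring

end

/-! ### The summation over `j` -/

section

variable {q : ℝ} {α β n₁ n₃ : ℤ} {s₀ s₁ z₀ z₁ : ℕ}

/-- What remains of the first `6j` coefficient after the summation over `j`. Reversed by `u ↦ s₀ -
u`, it is an `altSum` at `q⁻¹`, and `altSum_eq_posSum` yields the sum over `s` of the fifth
expression. -/
lemma sum_fst_eq_posSum (hq : 0 < q) (hP : StretchedParams α β n₁ n₃ s₀ s₁ z₀ z₁) (v : ℕ)
    (hv : v ≤ z₁) :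
    ifac q (n₃ - z₁ + v) * fac q (s₀ + s₁ + z₁ - n₃ - v) * ∑ u ∈ range (s₀ + 1),
      (-1) ^ u * q ^ (-(n₁ + n₃ - z₀ - u) * (β - n₁ + v + 1)) *
      (fac q (α + β + s₀ + s₁ + z₁ - n₁ - n₃ + 1 - u) * fac q (s₀ + s₁ - u) * ifac q u *
        ifac q (α + s₁ + 1 - u) * ifac q (s₀ - u) * ifac q (s₀ + s₁ + z₁ - n₃ - v - u)) =
    q ^ (-(s₀ : ℤ) * (s₁ + 1) - (n₁ + n₃ - s₀ - z₀) * (β - n₁ + 1)) *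
      q ^ (-(v : ℤ) * (n₁ + n₃ - s₀ - z₀)) *
      (fac q (β + z₁ + s₀ - n₁ - n₃) * fac q (α + β + s₁ + z₁ - n₁ - n₃ + 1)) *
        posSum q⁻¹ (α + β - n₁ + 1 + v) s₁ (α + s₁ - s₀ + 1) (n₃ - z₁ - s₀ + v)
          (β + z₁ + s₀ - n₁ - n₃) s₀ := by
  obtain ⟨h1, h3, h1a, h1b, hs0, hz0, h3a, h3b, hg1, hg2, hg3⟩ := hP
  rcases lt_or_ge (n₃ - z₁ + v) 0 with h | h
  · rw [ifac_neg q h, posSum_eq_zero (by omega)]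
    ring
  have e1 : ∑ u ∈ range (s₀ + 1),
      (-1) ^ u * q ^ (-(n₁ + n₃ - z₀ - u) * (β - n₁ + v + 1)) *
      (fac q (α + β + s₀ + s₁ + z₁ - n₁ - n₃ + 1 - u) * fac q (s₀ + s₁ - u) * ifac q u *
        ifac q (α + s₁ + 1 - u) * ifac q (s₀ - u) * ifac q (s₀ + s₁ + z₁ - n₃ - v - u)) =
      (-1) ^ s₀ * q ^ (-(n₁ + n₃ - s₀ - z₀) * (β - n₁ + v + 1)) *
      altSum q⁻¹ (α + β + s₁ + z₁ - n₁ - n₃ + 1) s₁ (α + s₁ - s₀ + 1) (s₁ + z₁ - n₃ - v) s₀ := by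
    rw [altSum_inv hq, mul_sum, ← sum_range_reflect]
    refine sum_congr rfl fun s hs => ?_
    have hs' : s ≤ s₀ := Nat.lt_succ_iff.1 (mem_range.1 hs)
    rw [Nat.add_sub_cancel, Nat.cast_sub hs',
      show α + β + s₀ + s₁ + z₁ - n₁ - n₃ + 1 - ((s₀ : ℤ) - s) =
        α + β + s₁ + z₁ - n₁ - n₃ + 1 + s by ring,
      show (s₀ : ℤ) + s₁ - ((s₀ : ℤ) - s) = s₁ + s by ring,
      show α + s₁ + 1 - ((s₀ : ℤ) - s) = α + s₁ - s₀ + 1 + s by ring,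
      show (s₀ : ℤ) - ((s₀ : ℤ) - s) = s by ring,
      show s₀ + s₁ + z₁ - n₃ - v - ((s₀ : ℤ) - s) = s₁ + z₁ - n₃ - v + s by ring]
    have hsg : (-1 : ℝ) ^ (s₀ - s) = (-1) ^ s₀ * (-1) ^ s := by
      have : (-1 : ℝ) ^ s * (-1) ^ s = 1 := by rw [← mul_pow]; norm_num
      nth_rewrite 2 [show s₀ = s₀ - s + s by omega]
      rw [pow_add, mul_assoc, this, mul_one]
    have hz : q ^ (-(n₁ + n₃ - z₀ - ((s₀ : ℤ) - s)) * (β - n₁ + v + 1)) =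
        q ^ (-(n₁ + n₃ - s₀ - z₀) * (β - n₁ + v + 1)) *
        q ^ (-((s : ℤ) * (α + β + s₁ + z₁ - n₁ - n₃ + 1 + s₁ - (α + s₁ - s₀ + 1) -
          (s₁ + z₁ - n₃ - v) - s₀ + 1))) := by
      rw [← zpow_add₀ hq.ne']
      congr 1
      ring
    rw [hz, hsg]
    ring
  have e2 := altSum_eq_posSum (inv_pos.2 hq) (A := α + β + s₁ + z₁ - n₁ - n₃ + 1) (B := s₁)
    (C := α + s₁ - s₀ + 1) (D := s₁ + z₁ - n₃ - v) s₀ (by omega) (by omega) (by omega) (by omega)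
  simp only [fac_inv hq, ifac_inv hq, inv_zpow'] at e2
  rw [show α + β + s₁ + z₁ - n₁ - n₃ + 1 - (α + s₁ - s₀ + 1) = β + z₁ + s₀ - n₁ - n₃ by ring,
    show α + β + s₁ + z₁ - n₁ - n₃ + 1 - (s₁ + z₁ - n₃ - v) = α + β - n₁ + 1 + v by ring,
    show (s₁ : ℤ) - (s₁ + z₁ - n₃ - v) = n₃ - z₁ + v by ring,
    show s₁ + z₁ - n₃ - v + (s₀ : ℤ) = s₀ + s₁ + z₁ - n₃ - v by ring,
    show n₃ - z₁ + v - (s₀ : ℤ) = n₃ - z₁ - s₀ + v by ring] at e2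
  rw [e1, e2]
  have c1 := fac_mul_ifac hq h
  have c2 := fac_mul_ifac hq (show 0 ≤ s₀ + s₁ + z₁ - n₃ - v by omega)
  have hs : (-1 : ℝ) ^ s₀ * (-1) ^ s₀ = 1 := by rw [← mul_pow]; norm_num
  have hz : q ^ (-(n₁ + n₃ - s₀ - z₀) * (β - n₁ + v + 1)) * q ^ (-((s₀ : ℤ) * (s₁ + 1))) =
      q ^ (-(s₀ : ℤ) * (s₁ + 1) - (n₁ + n₃ - s₀ - z₀) * (β - n₁ + 1)) *
      q ^ (-(v : ℤ) * (n₁ + n₃ - s₀ - z₀)) := by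
    simp only [← zpow_add₀ hq.ne']
    congr 1
    ring
  rw [← hz]
  set P := posSum q⁻¹ (α + β - n₁ + 1 + v) s₁ (α + s₁ - s₀ + 1) (n₃ - z₁ - s₀ + v)
          (β + z₁ + s₀ - n₁ - n₃) s₀
  calc _ = ((-1) ^ s₀ * (-1) ^ s₀) * (fac q (n₃ - z₁ + v) * ifac q (n₃ - z₁ + v)) *
        (fac q (s₀ + s₁ + z₁ - n₃ - v) * ifac q (s₀ + s₁ + z₁ - n₃ - v)) *
        (q ^ (-(n₁ + n₃ - s₀ - z₀) * (β - n₁ + v + 1)) * q ^ (-((s₀ : ℤ) * (s₁ + 1))) *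
          (fac q (β + z₁ + s₀ - n₁ - n₃) * fac q (α + β + s₁ + z₁ - n₁ - n₃ + 1)) * P) := by ring
    _ = _ := by rw [hs, c1, c2]; ring

/-- With the sum over `i` innermost, `well_poised_sum` applies with `m = n₁ + n₃ - z₀ - u` and `y =
β - n₁ + v`. Its factor `1/[m]!` cancels the `[m]!` in `descPart`. The sum over `u` then becomes the
sum over `s`, and `v` plays the role of `z`. -/
theorem sum_descPart_mul_ascPart (hq : 0 < q) (hP : StretchedParams α β n₁ n₃ s₀ s₁ z₀ z₁)
    {N : ℕ} (hN : n₁ + n₃ - z₀ ≤ N) :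
    ∑ i ∈ range (N + 1), qInt q (2 * i + (β + s₀ + s₁ + z₀ + z₁ - 2 * n₁ - 2 * n₃) + 1) *
      q ^ (-(i : ℤ) * (i + (β + s₀ + s₁ + z₀ + z₁ - 2 * n₁ - 2 * n₃) + 1)) *
      (fac q (β + s₀ + s₁ + z₀ + z₁ - 2 * n₁ - 2 * n₃ + i) * ifac q i *
        descPart q α β n₁ n₃ s₀ s₁ z₀ z₁ i * ascPart q β n₁ n₃ s₀ s₁ z₀ z₁ i) =
    q ^ (-(s₀ : ℤ) * (s₁ + 1) - (n₁ + n₃ - s₀ - z₀) * (β - n₁ + 1)) *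
      (fac q (β + z₁ + s₀ - n₁ - n₃) * fac q (α + β + s₁ + z₁ - n₁ - n₃ + 1)) *
      ∑ s ∈ range (s₀ + 1), ∑ z ∈ range (z₁ + 1), dblE q α β n₁ n₃ s₀ s₁ z₀ z₁ s z := by
  have hP' := hP
  obtain ⟨h1, h3, h1a, h1b, hs0, hz0, h3a, h3b, hg1, hg2, hg3⟩ := hP'
  set X := β + s₀ + s₁ + z₀ + z₁ - 2 * n₁ - 2 * n₃ with hX
  have hwp : ∀ u ∈ range (s₀ + 1), ∀ v : ℕ, ∑ i ∈ range (N + 1),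
      qInt q (2 * i + X + 1) * q ^ (-(i : ℤ) * (i + X + 1)) * (fac q (X + i) * ifac q i *
        fac q (β - n₁ + v + i) * ifac q (s₀ + s₁ + z₀ + z₁ - n₁ - 2 * n₃ - v + i) *
        ifac q (n₁ + n₃ - z₀ - u - i) * ifac q (β + s₀ + s₁ + z₁ - n₁ - n₃ + 1 - u + i)) =
      q ^ (-(n₁ + n₃ - z₀ - u) * (β - n₁ + v + 1)) * (fac q (β - n₁ + v) *
        ifac q (n₁ + n₃ - z₀ - u) * ifac q (s₀ + s₁ + z₁ - n₃ - v - u)) := by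
    intro u hu v
    have hu' := mem_range.1 hu
    obtain ⟨m, hm⟩ := Int.eq_ofNat_of_zero_le (show 0 ≤ n₁ + n₃ - z₀ - u by omega)
    have e := well_poised_sum hq m X (y := β - n₁ + v) (by omega)
    rw [hm, show s₀ + s₁ + z₁ - n₃ - v - u = m + X - (β - n₁ + v) by omega, ← e,
      sum_range_extend (m := m) (n := N) (by omega)]
    · refine sum_congr rfl fun i _ => ?_
      rw [show X - (β - n₁ + v) + i = s₀ + s₁ + z₀ + z₁ - n₁ - 2 * n₃ - v + i by omega,
        show m + X + 1 + i = β + s₀ + s₁ + z₁ - n₁ - n₃ + 1 - u + i by omega]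
    · intro i hi
      rw [ifac_neg q (show (m : ℤ) - i < 0 by omega)]
      ring
  have hE : ∑ s ∈ range (s₀ + 1), ∑ z ∈ range (z₁ + 1), dblE q α β n₁ n₃ s₀ s₁ z₀ z₁ s z =
      ∑ z ∈ range (z₁ + 1), (-1) ^ z * q ^ (-(z : ℤ) * (n₁ + n₃ - s₀ - z₀)) * (fac q (z₀ + z) *
        fac q (β - n₁ + z) * ifac q z * ifac q (z₁ - z) * ifac q (β + 1 + z)) *
        posSum q⁻¹ (α + β - n₁ + 1 + z) s₁ (α + s₁ - s₀ + 1) (n₃ - z₁ - s₀ + z)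
          (β + z₁ + s₀ - n₁ - n₃) s₀ := by
    rw [sum_comm]
    exact sum_congr rfl fun z _ => sum_dblE_fst hq z
  have hL : ∀ i ∈ range (N + 1), qInt q (2 * i + X + 1) * q ^ (-(i : ℤ) * (i + X + 1)) *
      (fac q (X + i) * ifac q i * descPart q α β n₁ n₃ s₀ s₁ z₀ z₁ i *
        ascPart q β n₁ n₃ s₀ s₁ z₀ z₁ i) = ∑ v ∈ range (z₁ + 1), ∑ u ∈ range (s₀ + 1),
      ((-1) ^ u * (-1) ^ v * (fac q (α + β + s₀ + s₁ + z₁ - n₁ - n₃ + 1 - u) *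
        fac q (n₁ + n₃ - z₀ - u) * fac q (s₀ + s₁ - u) * ifac q u * ifac q (α + s₁ + 1 - u) *
        ifac q (s₀ - u)) * (fac q (z₀ + v) *
        fac q (s₀ + s₁ + z₁ - n₃ - v) * ifac q v * ifac q (z₁ - v) * ifac q (n₃ - z₁ + v) *
        ifac q (β + 1 + v))) *
      (qInt q (2 * i + X + 1) * q ^ (-(i : ℤ) * (i + X + 1)) * (fac q (X + i) * ifac q i *
        fac q (β - n₁ + v + i) * ifac q (s₀ + s₁ + z₀ + z₁ - n₁ - 2 * n₃ - v + i) *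
        ifac q (n₁ + n₃ - z₀ - u - i) *
        ifac q (β + s₀ + s₁ + z₁ - n₁ - n₃ + 1 - u + i))) := by
    intro i _
    rw [descPart, ascPart, mul_sum]
    simp only [mul_sum, sum_mul]
    refine sum_congr rfl fun v _ => sum_congr rfl fun u _ => ?_
    rw [show β - n₁ + i + (v : ℤ) = β - n₁ + v + i by ring,
      show s₀ + s₁ + z₀ + z₁ - n₁ - 2 * n₃ + i - (v : ℤ) =
        s₀ + s₁ + z₀ + z₁ - n₁ - 2 * n₃ - v + i by ring,
      show n₁ + n₃ - z₀ - i - (u : ℤ) = n₁ + n₃ - z₀ - u - i by ring,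
      show β + s₀ + s₁ + z₁ - n₁ - n₃ + i + 1 - (u : ℤ) =
        β + s₀ + s₁ + z₁ - n₁ - n₃ + 1 - u + i by ring]
    ring
  rw [sum_congr rfl hL, sum_comm, hE, mul_sum]
  refine sum_congr rfl fun v hv => ?_
  have hv' : v ≤ z₁ := Nat.lt_succ_iff.1 (mem_range.1 hv)
  rw [sum_comm]
  simp only [← mul_sum]
  have e := sum_fst_eq_posSum hq hP v hv'
  calc _ = (-1) ^ v * (fac q (z₀ + v) * fac q (β - n₁ + v) * ifac q v * ifac q (z₁ - v) *
        ifac q (β + 1 + v)) * (ifac q (n₃ - z₁ + v) * fac q (s₀ + s₁ + z₁ - n₃ - v) *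
        ∑ u ∈ range (s₀ + 1), (-1) ^ u * q ^ (-(n₁ + n₃ - z₀ - u) * (β - n₁ + v + 1)) *
      (fac q (α + β + s₀ + s₁ + z₁ - n₁ - n₃ + 1 - u) * fac q (s₀ + s₁ - u) * ifac q u *
        ifac q (α + s₁ + 1 - u) * ifac q (s₀ - u) *
        ifac q (s₀ + s₁ + z₁ - n₃ - v - u))) := by
        simp only [mul_sum]
        refine sum_congr rfl fun u hu => ?_
        have hu' := mem_range.1 hu
        have hw := hwp u hu v
        rw [← mul_sum, hw]
        have c := fac_mul_ifac hq (show 0 ≤ n₁ + n₃ - z₀ - u by omega)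
        linear_combination ((-1) ^ u * (-1) ^ v * (fac q (α + β + s₀ + s₁ + z₁ - n₁ - n₃ + 1 - u) *
          fac q (s₀ + s₁ - u) * ifac q u * ifac q (α + s₁ + 1 - u) *
          ifac q (s₀ - u)) * (fac q (z₀ + v) *
          fac q (s₀ + s₁ + z₁ - n₃ - v) * ifac q v * ifac q (z₁ - v) * ifac q (n₃ - z₁ + v) *
          ifac q (β + 1 + v)) * q ^ (-(n₁ + n₃ - z₀ - u) * (β - n₁ + v + 1)) *
          (fac q (β - n₁ + v) * ifac q (s₀ + s₁ + z₁ - n₃ - v - u))) * c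
    _ = _ := by rw [e]; ring

end

section

/-! ### From spins to integer parameters -/

lemma qFact_of_eq (q : ℝ) {x : ℝ} {n : ℤ} (h : x = n) : qFact q x = fac q n := by rw [h, fac]

lemma sgn_of_eq {x : ℝ} {n : ℤ} (h : x = n) : sgn x = (-1) ^ n := by
  rw [h, sgn, Int.floor_intCast]

lemma rpow_of_eq (q : ℝ) {x : ℝ} {n : ℤ} (h : x = n) : q ^ x = q ^ n := by
  rw [h, Real.rpow_intCast]

lemma qNum_of_eq (q : ℝ) {x : ℝ} {n : ℤ} (h : x = n) : qNum q x = qInt q n := by rw [h, qInt]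

lemma Triad.exists_nat {a b c : ℝ} (h : Triad a b c) :
    ∃ x y z : ℕ, a + b - c = x ∧ a - b + c = y ∧ b + c - a = z := by
  obtain ⟨⟨na, ha⟩, ⟨nb, hb⟩, ⟨nc, hc⟩, h1, h2, ⟨n, hn⟩⟩ := h
  have h3 := abs_le.1 h1
  have e : na + nb + nc = 2 * n := by
    have : ((na + nb + nc : ℕ) : ℝ) = (2 * n : ℕ) := by push_cast; linarith
    exact_mod_cast this
  have i1 : nc ≤ na + nb := by
    have : (nc : ℝ) ≤ (na + nb : ℕ) := by push_cast; linarith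
    exact_mod_cast this
  have i2 : nb ≤ na + nc := by
    have : (nb : ℝ) ≤ (na + nc : ℕ) := by push_cast; linarith
    exact_mod_cast this
  have i3 : na ≤ nb + nc := by
    have : (na : ℝ) ≤ (nb + nc : ℕ) := by push_cast; linarith
    exact_mod_cast this
  refine ⟨n - nc, n - nb, n - na, ?_, ?_, ?_⟩
  · rw [Nat.cast_sub (by omega)]; linarith
  · rw [Nat.cast_sub (by omega)]; linarith
  · rw [Nat.cast_sub (by omega)]; linarith

lemma triad_of_nonneg {a b c : ℝ} {x y z : ℤ} (hx : a + b - c = x) (hy : a - b + c = y)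
    (hz : b + c - a = z) (h1 : 0 ≤ x) (h2 : 0 ≤ y) (h3 : 0 ≤ z) : Triad a b c := by
  lift x to ℕ using h1
  lift y to ℕ using h2
  lift z to ℕ using h3
  push_cast at hx hy hz
  have p1 : (0 : ℝ) ≤ x := Nat.cast_nonneg x
  have p2 : (0 : ℝ) ≤ y := Nat.cast_nonneg y
  have p3 : (0 : ℝ) ≤ z := Nat.cast_nonneg z
  refine ⟨⟨x + y, by push_cast; linarith⟩, ⟨x + z, by push_cast; linarith⟩,
    ⟨y + z, by push_cast; linarith⟩, abs_le.2 ⟨by linarith, by linarith⟩, by linarith,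
    ⟨x + y + z, by push_cast; linarith⟩⟩

lemma nonneg_of_triad {a b c : ℝ} {x y z : ℤ} (hx : a + b - c = x) (hy : a - b + c = y)
    (hz : b + c - a = z) (h : Triad a b c) : 0 ≤ x ∧ 0 ≤ y ∧ 0 ≤ z := by
  obtain ⟨x', y', z', h1, h2, h3⟩ := h.exists_nat
  have e1 : x = x' := by exact_mod_cast hx.symm.trans h1
  have e2 : y = y' := by exact_mod_cast hy.symm.trans h2
  have e3 : z = z' := by exact_mod_cast hz.symm.trans h3
  omega

/-- The spins of a stretched nine-`j` coefficient in terms of its integer parameters. -/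
structure StretchedSpins (a b e c d f h k g : ℝ) (α β n₁ n₃ : ℤ) (s₀ s₁ z₀ z₁ : ℕ) : Prop
    extends StretchedParams α β n₁ n₃ s₀ s₁ z₀ z₁ where
  a_eq : a = α / 2
  b_eq : b = β / 2
  e_eq : e = (α + β - 2 * n₁) / 2
  c_eq : c = (s₀ + s₁) / 2
  d_eq : d = (z₀ + z₁) / 2
  f_eq : f = (s₀ + s₁ + z₀ + z₁ - 2 * n₃) / 2
  h_eq : h = (α + s₁ - s₀) / 2
  k_eq : k = (β + z₁ - z₀) / 2
  g_eq : g = (α + β - 2 * n₁ + s₀ + s₁ + z₀ + z₁ - 2 * n₃) / 2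

/-- The parameters are excesses such as `a + b - e` in the triads, together with `2a` and `2b`. The
relations `e1` to `e7` express consistency of the spins shared by several triads; `e5` to `e7` also
use `g = e + f`. -/
lemma exists_stretchedSpins {a b e c d f h k g : ℝ} (h_abe : Triad a b e) (h_cdf : Triad c d f)
    (h_hkg : Triad h k g) (h_ach : Triad a c h) (h_bdk : Triad b d k) (hg : g = e + f) :
    ∃ (α β n₁ n₃ : ℤ) (s₀ s₁ z₀ z₁ : ℕ),
      StretchedSpins a b e c d f h k g α β n₁ n₃ s₀ s₁ z₀ z₁ := by
  obtain ⟨x1, x2, x3, hx1, hx2, hx3⟩ := h_abe.exists_nat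
  obtain ⟨y1, y2, y3, hy1, hy2, hy3⟩ := h_cdf.exists_nat
  obtain ⟨w1, w2, w3, hw1, hw2, hw3⟩ := h_hkg.exists_nat
  obtain ⟨s₀, s, s₁, hs1, hs2, hs3⟩ := h_ach.exists_nat
  obtain ⟨z₀, z, z₁, hz1, hz2, hz3⟩ := h_bdk.exists_nat
  have e1 : x1 + x2 = s₀ + s := by
    have : ((x1 + x2 : ℕ) : ℝ) = (s₀ + s : ℕ) := by push_cast; linarith
    exact_mod_cast this
  have e2 : x1 + x3 = z₀ + z := by
    have : ((x1 + x3 : ℕ) : ℝ) = (z₀ + z : ℕ) := by push_cast; linarith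
    exact_mod_cast this
  have e3 : y1 + y2 = s₀ + s₁ := by
    have : ((y1 + y2 : ℕ) : ℝ) = (s₀ + s₁ : ℕ) := by push_cast; linarith
    exact_mod_cast this
  have e4 : y1 + y3 = z₀ + z₁ := by
    have : ((y1 + y3 : ℕ) : ℝ) = (z₀ + z₁ : ℕ) := by push_cast; linarith
    exact_mod_cast this
  have e5 : w1 + s₀ + z₀ = x1 + y1 := by
    have : ((w1 + s₀ + z₀ : ℕ) : ℝ) = (x1 + y1 : ℕ) := by push_cast; linarith
    exact_mod_cast this
  have e6 : (w2 : ℤ) = x1 + x2 + s₁ + z₀ - x1 - y1 := by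
    have : (w2 : ℝ) = x1 + x2 + s₁ + z₀ - x1 - y1 := by linarith
    exact_mod_cast this
  have e7 : (w3 : ℤ) = x1 + x3 + z₁ + s₀ - x1 - y1 := by
    have : (w3 : ℝ) = x1 + x3 + z₁ + s₀ - x1 - y1 := by linarith
    exact_mod_cast this
  refine ⟨x1 + x2, x1 + x3, x1, y1, s₀, s₁, z₀, z₁, ⟨?_, ?_, ?_, ?_, ?_, ?_, ?_, ?_, ?_, ?_, ?_⟩,
    ?_, ?_, ?_, ?_, ?_, ?_, ?_, ?_, ?_⟩
  iterate 11 omega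
  all_goals push_cast
  all_goals linarith

variable {q a b e c d f h k g : ℝ} {α β n₁ n₃ : ℤ} {s₀ s₁ z₀ z₁ : ℕ}

lemma termA_eq_dblA (H : StretchedSpins a b e c d f h k g α β n₁ n₃ s₀ s₁ z₀ z₁) (s z : ℕ) :
    termA q a b e c d f h k g s z = dblA q α β n₁ n₃ s₀ s₁ z₀ z₁ s z := by
  obtain ⟨-, ha, hb, he, hc, hd, hf, hh, hk, hg⟩ := H
  rw [termA, dblA, qFact_of_eq q (show a - c + h + s = (α - s₀ + s : ℤ) by push_cast; linarith),
    qFact_of_eq q (show k - b + d + z = (z₁ + z : ℤ) by push_cast; linarith),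
    qFact_of_eq q (show a + c - h - s = (s₀ - s : ℤ) by push_cast; linarith),
    qFact_of_eq q (show b - c - e + h + s = (n₁ - s₀ + s : ℤ) by push_cast; linarith),
    qFact_of_eq q (show 2 * h + s + 1 = (α + s₁ - s₀ + 1 + s : ℤ) by push_cast; linarith),
    qFact_of_eq q (show h - g + k + s + z = (n₁ + n₃ - s₀ - z₀ + s + z : ℤ) by
      push_cast; linarith),
    qFact_of_eq q (show b + d - k - z = (z₀ - z : ℤ) by push_cast; linarith),
    qFact_of_eq q (show k - b + c - f + z = (n₃ - z₀ + z : ℤ) by push_cast; linarith),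
    qFact_of_eq q (show 2 * k + z + 1 = (β + z₁ - z₀ + 1 + z : ℤ) by push_cast; linarith),
    qFact_of_eq q (show (s : ℝ) = (s : ℤ) by push_cast; rfl),
    qFact_of_eq q (show (z : ℝ) = (z : ℤ) by push_cast; rfl),
    rpow_of_eq q (show s * (b + c + f - k - z) + z * (b + c + e - h) =
      (s * (s₀ + s₁ + z₀ - n₃ - z) + z * (β - n₁ + s₀) : ℤ) by
      subst ha hb he hc hd hf hh hk hg; push_cast; ring), ← Nat.cast_add s z, zpow_natCast]
  simp only [ifac_eq, div_eq_mul_inv, mul_inv]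
  ring

lemma termB_eq_dblB (H : StretchedSpins a b e c d f h k g α β n₁ n₃ s₀ s₁ z₀ z₁) (s z : ℕ) :
    termB q a b e c d f h k g s z = dblB q α β n₁ n₃ s₀ s₁ z₀ z₁ s z := by
  obtain ⟨-, ha, hb, he, hc, hd, hf, hh, hk, hg⟩ := H
  rw [termB, dblB, qFact_of_eq q (show 2 * h - s = (α + s₁ - s₀ - s : ℤ) by push_cast; linarith),
    qFact_of_eq q (show e + h - b + c - s = (α + s₁ - n₁ - s : ℤ) by push_cast; linarith),
    qFact_of_eq q (show k - b + d + z = (z₁ + z : ℤ) by push_cast; linarith),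
    qFact_of_eq q (show c + h - a - s = (s₁ - s : ℤ) by push_cast; linarith),
    qFact_of_eq q (show a + c + h - s + 1 = (α + s₁ + 1 - s : ℤ) by push_cast; linarith),
    qFact_of_eq q (show g + h - k - s - z = (α + s₁ + z₀ - n₁ - n₃ - s - z : ℤ) by
      push_cast; linarith),
    qFact_of_eq q (show b + d - k - z = (z₀ - z : ℤ) by push_cast; linarith),
    qFact_of_eq q (show c - b - f + k + z = (n₃ - z₀ + z : ℤ) by push_cast; linarith),
    qFact_of_eq q (show 2 * k + z + 1 = (β + z₁ - z₀ + 1 + z : ℤ) by push_cast; linarith),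
    qFact_of_eq q (show (s : ℝ) = (s : ℤ) by push_cast; rfl),
    qFact_of_eq q (show (z : ℝ) = (z : ℤ) by push_cast; rfl),
    rpow_of_eq q (show s * (b + c + f - k - z) + z * (b + c + e + h + 1) =
      (s * (s₀ + s₁ + z₀ - n₃ - z) + z * (α + β - n₁ + s₁ + 1) : ℤ) by
      subst ha hb he hc hd hf hh hk hg; push_cast; ring), zpow_natCast]
  simp only [ifac_eq, div_eq_mul_inv, mul_inv]
  ring

lemma termC_eq_dblC (H : StretchedSpins a b e c d f h k g α β n₁ n₃ s₀ s₁ z₀ z₁) (s z : ℕ) :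
    termC q a b e c d f h k g s z = dblC q α β n₁ n₃ s₀ s₁ z₀ z₁ s z := by
  obtain ⟨-, ha, hb, he, hc, hd, hf, hh, hk, hg⟩ := H
  rw [termC, dblC, qFact_of_eq q (show a - c + h + s = (α - s₀ + s : ℤ) by push_cast; linarith),
    qFact_of_eq q (show b + c + e - h - s = (β - n₁ + s₀ - s : ℤ) by push_cast; linarith),
    qFact_of_eq q (show a + c - h - s = (s₀ - s : ℤ) by push_cast; linarith),
    qFact_of_eq q (show 2 * h + s + 1 = (α + s₁ - s₀ + 1 + s : ℤ) by push_cast; linarith),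
    qFact_of_eq q (show g - h + k - s - z = (β + z₁ + s₀ - n₁ - n₃ - s - z : ℤ) by
      push_cast; linarith),
    qFact_of_eq q (show b + d - k + z = (z₀ + z : ℤ) by push_cast; linarith),
    qFact_of_eq q (show 2 * k - z = (β + z₁ - z₀ - z : ℤ) by push_cast; linarith),
    qFact_of_eq q (show d + k - b - z = (z₁ - z : ℤ) by push_cast; linarith),
    qFact_of_eq q (show b + c - f - k + z = (n₃ - z₁ + z : ℤ) by push_cast; linarith),
    qFact_of_eq q (show (s : ℝ) = (s : ℤ) by push_cast; rfl),
    qFact_of_eq q (show (z : ℝ) = (z : ℤ) by push_cast; rfl),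
    rpow_of_eq q (show s * (c - b + f + k - z) - z * (b - c - e + h + 1) =
      (s * (s₀ + s₁ + z₁ - n₃ - z) - z * (n₁ - s₀ + 1) : ℤ) by
      subst ha hb he hc hd hf hh hk hg; push_cast; ring), ← Nat.cast_add s z, zpow_natCast]
  simp only [ifac_eq, div_eq_mul_inv, mul_inv]
  ring

lemma termD_eq_dblD (H : StretchedSpins a b e c d f h k g α β n₁ n₃ s₀ s₁ z₀ z₁) (s z : ℕ) :
    termD q a b e c d f h k g s z = dblD q α β n₁ n₃ s₀ s₁ z₀ z₁ s z := by
  obtain ⟨-, ha, hb, he, hc, hd, hf, hh, hk, hg⟩ := H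
  rw [termD, dblD, sgn_of_eq (show a + c - h + s + z = (s₀ + s + z : ℤ) by push_cast; linarith),
    qFact_of_eq q (show 2 * b - z = (β - z : ℤ) by push_cast; linarith),
    qFact_of_eq q (show b + d - g + h - z = (n₁ + n₃ - s₀ - z : ℤ) by push_cast; linarith),
    qFact_of_eq q (show b + d - k - z = (z₀ - z : ℤ) by push_cast; linarith),
    qFact_of_eq q (show b + d + k - z + 1 = (β + z₁ - z + 1 : ℤ) by push_cast; linarith),
    qFact_of_eq q (show 2 * a - s = (α - s : ℤ) by push_cast; linarith),
    qFact_of_eq q (show h - a + c + s = (s₁ + s : ℤ) by push_cast; linarith),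
    qFact_of_eq q (show a + b - e - z - s = (n₁ - z - s : ℤ) by push_cast; linarith),
    qFact_of_eq q (show a + c - h - s = (s₀ - s : ℤ) by push_cast; linarith),
    qFact_of_eq q (show d - a - f + h + s = (n₃ - s₀ + s : ℤ) by push_cast; linarith),
    qFact_of_eq q (show (s : ℝ) = (s : ℤ) by push_cast; rfl),
    qFact_of_eq q (show (z : ℝ) = (z : ℤ) by push_cast; rfl),
    rpow_of_eq q (show z * (a + d + f - h - s) - s * (g + h - b - d + 1) =
      (z * (z₀ + z₁ + s₀ - n₃ - s) - s * (α + s₁ - n₁ - n₃ + 1) : ℤ) by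
      subst ha hb he hc hd hf hh hk hg; push_cast; ring)]
  simp only [ifac_eq, div_eq_mul_inv, mul_inv]
  ring

lemma termE_eq_dblE (H : StretchedSpins a b e c d f h k g α β n₁ n₃ s₀ s₁ z₀ z₁) (s z : ℕ) :
    termE q a b e c d f h k g s z =
      (-1) ^ (n₃ - z₀ - z₁) * dblE q α β n₁ n₃ s₀ s₁ z₀ z₁ s z := by
  obtain ⟨-, ha, hb, he, hc, hd, hf, hh, hk, hg⟩ := H
  rw [termE, dblE,
    sgn_of_eq (show c - d + e - g + z = (n₃ - z₀ - z₁ + z : ℤ) by push_cast; linarith),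
    qFact_of_eq q (show g - h + k - s = (β + z₁ + s₀ - n₁ - n₃ - s : ℤ) by push_cast; linarith),
    qFact_of_eq q (show a + c - h - s = (s₀ - s : ℤ) by push_cast; linarith),
    qFact_of_eq q (show 2 * h + s + 1 = (α + s₁ - s₀ + 1 + s : ℤ) by push_cast; linarith),
    qFact_of_eq q (show c + h - a + s = (s₁ + s : ℤ) by push_cast; linarith),
    qFact_of_eq q (show b + d - k + z = (z₀ + z : ℤ) by push_cast; linarith),
    qFact_of_eq q (show b + e - a + z = (β - n₁ + z : ℤ) by push_cast; linarith),
    qFact_of_eq q (show d + k - b - z = (z₁ - z : ℤ) by push_cast; linarith),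
    qFact_of_eq q (show b - a - f + h - k + s + z = (n₃ - z₁ - s₀ + s + z : ℤ) by
      push_cast; linarith),
    qFact_of_eq q (show 2 * b + z + 1 = (β + 1 + z : ℤ) by push_cast; linarith),
    qFact_of_eq q (show (s : ℝ) = (s : ℤ) by push_cast; rfl),
    qFact_of_eq q (show (z : ℝ) = (z : ℤ) by push_cast; rfl),
    rpow_of_eq q (show -s * (a + b + e + z + 1) - z * (h - g + k) =
      (-s * (α + β - n₁ + z + 1) - z * (n₁ + n₃ - s₀ - z₀) : ℤ) by
      subst ha hb he hc hd hf hh hk hg; push_cast; ring), zpow_add₀ (by norm_num)]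
  simp only [ifac_eq, div_eq_mul_inv, mul_inv]
  ring

end

section

/-! ### The stretched nine-`j` coefficient as a double sum -/

/-- The square root of a quotient of `q`-factorials that occurs in `Δ` and `∇`. -/
noncomputable def sqrtFac (q : ℝ) (x y z w : ℤ) : ℝ :=
  √(fac q x * fac q y * fac q z / fac q w)

lemma triDelta_of_eq (q : ℝ) {a b c : ℝ} {x y z w : ℤ} (hx : a + b - c = x) (hy : a - b + c = y)
    (hz : b + c - a = z) (hw : a + b + c + 1 = w) : triDelta q a b c = sqrtFac q x y z w := by
  rw [triDelta, qFact_of_eq q hx, qFact_of_eq q hy, qFact_of_eq q hz, qFact_of_eq q hw, sqrtFac]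

lemma nabla_of_eq (q : ℝ) {a b c : ℝ} {x y z w : ℤ} (hx : a + b - c = x) (hy : a - b + c = y)
    (hz : b + c - a = z) (hw : a + b + c + 1 = w) : nabla q a b c = sqrtFac q x y w z := by
  rw [nabla, qFact_of_eq q hx, qFact_of_eq q hy, qFact_of_eq q hz, qFact_of_eq q hw, sqrtFac]

lemma sqrtFac_mul_self {q : ℝ} (hq : 0 < q) (x y z w : ℤ) :
    sqrtFac q x y z w * sqrtFac q x y z w = fac q x * fac q y * fac q z * ifac q w := by
  have := fac_nonneg hq
  rw [sqrtFac, Real.mul_self_sqrt (div_nonneg (mul_nonneg (mul_nonneg (this _) (this _)) (this _))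
    (this _)), ifac_eq, div_eq_mul_inv]

lemma sqrtFac_swap (q : ℝ) (x y z w : ℤ) : sqrtFac q x y z w = sqrtFac q y x z w := by
  rw [sqrtFac, sqrtFac, mul_comm (fac q x)]

lemma racah_perm (q : ℝ) (n : ℕ) (q₂ q₃ t₁ t₂ t₃ t₄ : ℤ) :
    racah q n q₂ q₃ t₁ t₂ t₃ t₄ = racah q n q₂ q₃ t₂ t₄ t₁ t₃ :=
  sum_congr rfl fun z _ => by ring

lemma racah_perm_swap (q : ℝ) (n : ℕ) (q₂ q₃ t₁ t₂ t₃ t₄ : ℤ) :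
    racah q n q₂ q₃ t₁ t₂ t₃ t₄ = racah q n q₃ q₂ t₂ t₃ t₄ t₁ :=
  sum_congr rfl fun z _ => by ring

lemma sixJ_eq_racah (q : ℝ) {a b e d c f : ℝ} (h1 : Triad a b e) (h2 : Triad a c f)
    (h3 : Triad d b f) (h4 : Triad d c e) {n : ℕ} {q₂ q₃ t₁ t₂ t₃ t₄ : ℤ}
    (hn : a + b + c + d = n) (hq₂ : a + d + e + f = q₂) (hq₃ : b + c + e + f = q₃)
    (ht₁ : a + b + e = t₁) (ht₂ : a + c + f = t₂) (ht₃ : d + b + f = t₃) (ht₄ : d + c + e = t₄) :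
    sixJ q a b e d c f = triDelta q a b e * triDelta q a c f * triDelta q d b f *
      triDelta q d c e * racah q n q₂ q₃ t₁ t₂ t₃ t₄ := by
  rw [sixJ, if_pos ⟨h1, h2, h3, h4⟩, hn, Nat.floor_natCast, racah]
  congr 1
  refine sum_congr rfl fun z _ => ?_
  rw [qFact_of_eq q (show (z : ℝ) + 1 = (z + 1 : ℤ) by push_cast; rfl),
    qFact_of_eq q (show z - a - b - e = (z - t₁ : ℤ) by push_cast; linarith),
    qFact_of_eq q (show z - a - c - f = (z - t₂ : ℤ) by push_cast; linarith),
    qFact_of_eq q (show z - d - b - f = (z - t₃ : ℤ) by push_cast; linarith),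
    qFact_of_eq q (show z - d - c - e = (z - t₄ : ℤ) by push_cast; linarith),
    qFact_of_eq q (show (n : ℝ) - z = (n - z : ℤ) by push_cast; rfl), hq₂, hq₃,
    qFact_of_eq q (show (q₂ : ℝ) - z = (q₂ - z : ℤ) by push_cast; rfl),
    qFact_of_eq q (show (q₃ : ℝ) - z = (q₃ - z : ℤ) by push_cast; rfl)]
  simp only [ifac_eq, div_eq_mul_inv, mul_inv]
  ring

lemma triads_of_sixJ_ne_zero {q a b e d c f : ℝ} (h : sixJ q a b e d c f ≠ 0) :
    Triad a b e ∧ Triad a c f ∧ Triad d b f ∧ Triad d c e := by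
  by_contra hT
  exact h (if_neg hT)

lemma Triad.rotate {a b c : ℝ} (h : Triad a b c) : Triad b c a := by
  obtain ⟨x, y, z, hx, hy, hz⟩ := h.exists_nat
  exact triad_of_nonneg (x := z) (y := x) (z := y) (by push_cast; linarith)
    (by push_cast; linarith) (by push_cast; linarith) (by omega) (by omega) (by omega)

lemma Triad.swap {a b c : ℝ} (h : Triad a b c) : Triad b a c := by
  obtain ⟨x, y, z, hx, hy, hz⟩ := h.exists_nat
  exact triad_of_nonneg (x := x) (y := z) (z := y) (by push_cast; linarith)
    (by push_cast; linarith) (by push_cast; linarith) (by omega) (by omega) (by omega)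

variable {q a b e c d f h k g : ℝ} {α β n₁ n₃ : ℤ} {s₀ s₁ z₀ z₁ : ℕ}

set_option maxHeartbeats 1000000 in
/-- The product of three six-`j` coefficients with the triangle coefficients that do not involve `j`
split off. -/
lemma sixJ_mul_sixJ_mul_sixJ (hq : 0 < q) (h_abe : Triad a b e) (h_cdf : Triad c d f)
    (h_hkg : Triad h k g) (h_ach : Triad a c h) (h_bdk : Triad b d k) (h_efg : Triad e f g)
    (H : StretchedSpins a b e c d f h k g α β n₁ n₃ s₀ s₁ z₀ z₁)
    {i n : ℕ} (hn : n = β + s₀ + s₁ + z₀ + z₁ - 2 * n₁ - 2 * n₃ + 2 * i) :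
    (-1) ^ n * (sixJ q a c h k g (n / 2) * sixJ q k (n / 2) c f d b * sixJ q a g (n / 2) f b e) =
    (-1) ^ (n₃ - z₀ - z₁) * (triDelta q a c h * triDelta q k g h * triDelta q k d b *
      triDelta q f d c * triDelta q a b e * triDelta q f g e) *
      (fac q (α + s₁ + 1) * ifac q (β + z₁ + s₀ - n₁ - n₃) *
      ifac q (n₁ + n₃ - s₀ - z₀) * ifac q s₁ * fac q (β + z₁ + 1) * ifac q (z₀ + z₁ - n₃) *
      ifac q z₀ * ifac q (s₀ + s₁ - n₃) * ifac q (α - n₁) * ifac q (β - n₁)) *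
      (fac q (β + s₀ + s₁ + z₀ + z₁ - 2 * n₁ - 2 * n₃ + i) * ifac q i *
        descPart q α β n₁ n₃ s₀ s₁ z₀ z₁ i * ascPart q β n₁ n₃ s₀ s₁ z₀ z₁ i) := by
  have hnn : (0 : ℤ) ≤ n := Int.natCast_nonneg n
  obtain ⟨hP, ha, hb, he, hc, hd, hf, hh, hk, hg⟩ := H
  have hP' := hP
  obtain ⟨h1, h3, h1a, h1b, hs0, hz0, h3a, h3b, hg1, hg2, hg3⟩ := hP'
  obtain ⟨nA, hA⟩ := Int.eq_ofNat_of_zero_le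
    (show 0 ≤ α + β + s₀ + s₁ + z₁ - n₁ - n₃ by omega)
  obtain ⟨nB, hB⟩ := Int.eq_ofNat_of_zero_le
    (show 0 ≤ β + s₀ + s₁ + z₀ + 2 * z₁ - n₁ - 2 * n₃ + i by omega)
  obtain ⟨nC, hC⟩ := Int.eq_ofNat_of_zero_le
    (show 0 ≤ α + β + s₀ + s₁ + z₀ + z₁ - n₁ - 2 * n₃ by omega)
  obtain ⟨t, ht⟩ := Int.eq_ofNat_of_zero_le
    (show 0 ≤ α + β + s₀ + s₁ + z₀ + z₁ - 2 * n₁ - 2 * n₃ + i by omega)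
  have key := racah_mul_racah_mul_racah hq hP hA.symm hB.symm hC.symm ht.symm
  have hsg : (-1 : ℝ) ^ n * ((-1) ^ nA * (-1) ^ nB * (-1) ^ t) = (-1) ^ (n₃ - z₀ - z₁) := by
    rw [← pow_add, ← pow_add, ← pow_add, ← zpow_natCast]
    push_cast
    rw [← hA, ← hB, ← ht, hn, show β + s₀ + s₁ + z₀ + z₁ - 2 * n₁ - 2 * n₃ + 2 * (i : ℤ) +
      (α + β + s₀ + s₁ + z₁ - n₁ - n₃ + (β + s₀ + s₁ + z₀ + 2 * z₁ - n₁ - 2 * n₃ + i) +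
      (α + β + s₀ + s₁ + z₀ + z₁ - 2 * n₁ - 2 * n₃ + i)) = n₃ - z₀ - z₁ + 2 * (α + 2 * β +
      2 * s₀ + 2 * s₁ + 2 * z₀ + 3 * z₁ - 3 * n₁ - 4 * n₃ + 2 * i) by ring,
      zpow_add₀ (by norm_num) _ (2 * _), zpow_mul]
    norm_num
  have hnR : (n : ℝ) = β + s₀ + s₁ + z₀ + z₁ - 2 * n₁ - 2 * n₃ + 2 * i := by
    have : ((n : ℤ) : ℝ) = ((β + s₀ + s₁ + z₀ + z₁ - 2 * n₁ - 2 * n₃ + 2 * i : ℤ) : ℝ) := by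
      rw [hn]
    push_cast at this
    exact this
  have hAR : (nA : ℝ) = α + β + s₀ + s₁ + z₁ - n₁ - n₃ := by
    have := congrArg (fun x : ℤ => (x : ℝ)) hA
    push_cast at this
    exact this.symm
  have hBR : (nB : ℝ) = β + s₀ + s₁ + z₀ + 2 * z₁ - n₁ - 2 * n₃ + i := by
    have := congrArg (fun x : ℤ => (x : ℝ)) hB
    push_cast at this
    exact this.symm
  have hCR : (nC : ℝ) = α + β + s₀ + s₁ + z₀ + z₁ - n₁ - 2 * n₃ := by
    have := congrArg (fun x : ℤ => (x : ℝ)) hC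
    push_cast at this
    exact this.symm
  have htR : (t : ℝ) = α + β + s₀ + s₁ + z₀ + z₁ - 2 * n₁ - 2 * n₃ + i := by
    have := congrArg (fun x : ℤ => (x : ℝ)) ht
    push_cast at this
    exact this.symm
  have x1 : a + g - n / 2 = (α - i : ℤ) := by push_cast; linarith
  have x2 : a - g + n / 2 = (i : ℤ) := by push_cast; linarith
  have x3 : g + n / 2 - a = (β + s₀ + s₁ + z₀ + z₁ - 2 * n₁ - 2 * n₃ + i : ℤ) := by
    push_cast; linarith
  have y1 : k + c - n / 2 = (n₁ + n₃ - z₀ - i : ℤ) := by push_cast; linarith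
  have y2 : k - c + n / 2 = (β + z₁ - n₁ - n₃ + i : ℤ) := by push_cast; linarith
  have y3 : c + n / 2 - k = (s₀ + s₁ + z₀ - n₁ - n₃ + i : ℤ) := by push_cast; linarith
  have w1 : f + b - n / 2 = (n₁ - i : ℤ) := by push_cast; linarith
  have w2 : f - b + n / 2 = (s₀ + s₁ + z₀ + z₁ - n₁ - 2 * n₃ + i : ℤ) := by push_cast; linarith
  have w3 : b + n / 2 - f = (β - n₁ + i : ℤ) := by push_cast; linarith
  -- These eight inequalities say that `(a, g, j)`, `(k, c, j)` and `(f, b, j)` with `j = n / 2` are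
  -- triads; the ninth, `a - g + j = i ≥ 0`, is automatic.
  by_cases hT : (0 ≤ α - i ∧ 0 ≤ β + s₀ + s₁ + z₀ + z₁ - 2 * n₁ - 2 * n₃ + i) ∧
      (0 ≤ n₁ + n₃ - z₀ - i ∧ 0 ≤ β + z₁ - n₁ - n₃ + i ∧ 0 ≤ s₀ + s₁ + z₀ - n₁ - n₃ + (i : ℤ)) ∧
      (0 ≤ n₁ - i ∧ 0 ≤ s₀ + s₁ + z₀ + z₁ - n₁ - 2 * n₃ + i ∧ 0 ≤ β - n₁ + i)
  · obtain ⟨⟨p1, p2⟩, ⟨p3, p4, p5⟩, p6, p7, p8⟩ := hT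
    have Tagj : Triad a g (n / 2) := triad_of_nonneg x1 x2 x3 p1 (by omega) p2
    have Tkcj : Triad k c (n / 2) := triad_of_nonneg y1 y2 y3 p3 p4 p5
    have Tfbj : Triad f b (n / 2) := triad_of_nonneg w1 w2 w3 p6 p7 p8
    have e1 := sixJ_eq_racah q (n := nA) (q₂ := α + β + s₁ + z₁ - n₁ - n₃ + i)
      (q₃ := α + β + s₀ + 2 * s₁ + z₀ + z₁ - 2 * n₁ - 2 * n₃ + i) (t₁ := α + s₁) (t₂ := t)
      (t₃ := β + s₀ + s₁ + z₁ - n₁ - n₃ + i) (t₄ := α + β + s₁ + z₁ - n₁ - n₃)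
      h_ach Tagj Tkcj h_hkg.rotate (by linarith) (by push_cast; linarith) (by push_cast; linarith)
      (by push_cast; linarith) (by push_cast; linarith) (by push_cast; linarith)
      (by push_cast; linarith)
    have e2 := sixJ_eq_racah q (n := nB) (q₃ := β + s₀ + s₁ + z₀ + z₁ - n₁ - n₃ + i)
      (q₂ := β + s₀ + s₁ + z₁ - n₃) (t₂ := β + z₁)
      (t₃ := β + s₀ + s₁ + z₀ + z₁ - n₁ - 2 * n₃ + i) (t₄ := s₀ + s₁ + z₀ + z₁ - n₃)
      (t₁ := β + s₀ + s₁ + z₁ - n₁ - n₃ + i) Tkcj.swap.rotate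
      h_bdk.rotate.swap Tfbj.swap.rotate h_cdf.rotate.swap
      (by linarith) (by push_cast; linarith) (by push_cast; linarith)
      (by push_cast; linarith) (by push_cast; linarith) (by push_cast; linarith)
      (by push_cast; linarith)
    have e3 := sixJ_eq_racah q (n := nC) (q₂ := t) (q₃ := t + β - n₁) (t₁ := t)
      (t₂ := α + β - n₁) (t₃ := α + β + s₀ + s₁ + z₀ + z₁ - 2 * n₁ - 2 * n₃)
      (t₄ := β + s₀ + s₁ + z₀ + z₁ - n₁ - 2 * n₃ + i) Tagj h_abe h_efg.rotate Tfbj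
      (by linarith) (by push_cast; linarith) (by push_cast; linarith)
      (by push_cast; linarith) (by push_cast; linarith) (by push_cast; linarith)
      (by push_cast; linarith)
    have d1 := triDelta_of_eq q (w := t + 1) x1 x2 x3 (by push_cast; linarith)
    have d2 := triDelta_of_eq q (w := β + s₀ + s₁ + z₁ - n₁ - n₃ + i + 1) y1 y2 y3
      (by push_cast; linarith)
    have d2' := triDelta_of_eq q (a := k) (b := n / 2) (c := c)
      (w := β + s₀ + s₁ + z₁ - n₁ - n₃ + i + 1) (show k + n / 2 - c = _ by rw [← y2]; ring)
      (show k - n / 2 + c = _ by rw [← y1]; ring) (show n / 2 + c - k = _ by rw [← y3]; ring)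
      (by push_cast; linarith)
    have d3 := triDelta_of_eq q (w := β + s₀ + s₁ + z₀ + z₁ - n₁ - 2 * n₃ + i + 1) w1 w2 w3
      (by push_cast; linarith)
    have d3' := triDelta_of_eq q (a := f) (b := n / 2) (c := b)
      (w := β + s₀ + s₁ + z₀ + z₁ - n₁ - 2 * n₃ + i + 1) (show f + n / 2 - b = _ by rw [← w2]; ring)
      (show f - n / 2 + b = _ by rw [← w1]; ring) (show n / 2 + b - f = _ by rw [← w3]; ring)
      (by push_cast; linarith)
    rw [racah_perm, d1, d2] at e1
    rw [racah_perm_swap, d2', sqrtFac_swap, d3', sqrtFac_swap q _ (n₁ - i)] at e2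
    rw [d1, d3] at e3
    rw [e1, e2, e3, ← hsg]
    simp only [← sqrtFac_mul_self hq] at key
    linear_combination ((-1) ^ n * (triDelta q a c h * triDelta q k g h * triDelta q k d b *
      triDelta q f d c * triDelta q a b e * triDelta q f g e)) * key
  · have hz : sixJ q a c h k g (n / 2) * sixJ q k (n / 2) c f d b *
        sixJ q a g (n / 2) f b e = 0 := by
      by_contra hne
      obtain ⟨-, Tagj, Tkcj, -⟩ := triads_of_sixJ_ne_zero (left_ne_zero_of_mul
        (left_ne_zero_of_mul hne))
      obtain ⟨-, -, -, Tfbj⟩ := triads_of_sixJ_ne_zero (right_ne_zero_of_mul hne)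
      obtain ⟨p1, -, p2⟩ := nonneg_of_triad x1 x2 x3 Tagj
      exact hT ⟨⟨p1, p2⟩, nonneg_of_triad y1 y2 y3 Tkcj, nonneg_of_triad w1 w2 w3 Tfbj⟩
    -- A failing triangular condition puts a negative argument into one of the factorials on the
    -- left of `key`, so the right side is zero too, and its prefactor is not.
    have hQ := key.symm.trans (b := _) (c := 0) (by
      by_contra hne
      apply hT
      refine ⟨⟨?_, ?_⟩, ⟨?_, ?_, ?_⟩, ?_, ?_, ?_⟩ <;>
        exact not_lt.1 fun hlt => hne (by rw [fac_neg q hlt]; ring))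
    have hQ' := (mul_eq_zero.1 hQ).resolve_left (by
      refine mul_ne_zero (by simp) ?_
      repeat' apply mul_ne_zero
      all_goals first
        | exact fac_ne_zero hq (by omega)
        | exact ifac_ne_zero hq (by omega))
    rw [hz, hQ']
    ring

end

/-! ### Reduction of the nine-`j` coefficient to the fifth double sum -/

section

lemma sqrtFac_rotate (q : ℝ) (x y z w : ℤ) : sqrtFac q x y z w = sqrtFac q y z x w := by
  rw [sqrtFac, sqrtFac, mul_assoc, mul_comm (fac q x)]

/-- Under the root the factor `[w]!/[z]!` is squared and thereby interchanges `z` and `w`. In this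
way a coefficient `Δ` turns into a `∇`. -/
lemma sqrtFac_mul_fac {q : ℝ} (hq : 0 < q) (x y : ℤ) {z w : ℤ} (hz : 0 ≤ z) (hw : 0 ≤ w) :
    sqrtFac q x y z w * (fac q w * ifac q z) = sqrtFac q x y w z := by
  have h1 := (fac_pos hq hz).ne'
  have h2 := (fac_pos hq hw).ne'
  have h0 : 0 ≤ fac q w * ifac q z := mul_nonneg (fac_nonneg hq _) (ifac_nonneg hq _)
  rw [sqrtFac, sqrtFac, ← Real.sqrt_sq h0, ← Real.sqrt_mul' _ (sq_nonneg _), ifac_eq]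
  congr 1
  field_simp

/-- By the same computation `1/([x]! [y]!)` turns `Δ` into a reciprocal `∇`. -/
lemma sqrtFac_mul_ifac {q : ℝ} (hq : 0 < q) {x y z w : ℤ} (hx : 0 ≤ x) (hy : 0 ≤ y) (hz : 0 ≤ z)
    (hw : 0 ≤ w) : sqrtFac q x y z w * (ifac q x * ifac q y) = (sqrtFac q x y w z)⁻¹ := by
  have h1 := (fac_pos hq hx).ne'
  have h2 := (fac_pos hq hy).ne'
  have h3 := (fac_pos hq hz).ne'
  have h4 := (fac_pos hq hw).ne'
  have h0 : 0 ≤ ifac q x * ifac q y := mul_nonneg (ifac_nonneg hq _) (ifac_nonneg hq _)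
  rw [sqrtFac, sqrtFac, ← Real.sqrt_sq h0, ← Real.sqrt_mul' _ (sq_nonneg _), ← Real.sqrt_inv,
    ifac_eq, ifac_eq]
  congr 1
  field_simp

variable {q a b e c d f h k g : ℝ} {α β n₁ n₃ : ℤ} {s₀ s₁ z₀ z₁ : ℕ}

/-- The sum over `n = 2j` is reindexed by `n = X + 2i` with `X = 2(g - a)`. The power of `q` splits
because `j(j+1) = (g-a)(g-a+1) + i(i + X + 1)`. -/
lemma nineJ_eq_sum_dblE (hq : 0 < q) (h_abe : Triad a b e) (h_cdf : Triad c d f)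
    (h_hkg : Triad h k g) (h_ach : Triad a c h) (h_bdk : Triad b d k) (h_efg : Triad e f g)
    (H : StretchedSpins a b e c d f h k g α β n₁ n₃ s₀ s₁ z₀ z₁) :
    nineJ q a b e c d f h k g =
    q ^ (Z [d, e, h] - (g - a) * (g - a + 1)) *
      ((-1) ^ (n₃ - z₀ - z₁) * (triDelta q a c h * triDelta q k g h * triDelta q k d b *
      triDelta q f d c * triDelta q a b e * triDelta q f g e) *
      (fac q (α + s₁ + 1) * ifac q (β + z₁ + s₀ - n₁ - n₃) *
      ifac q (n₁ + n₃ - s₀ - z₀) * ifac q s₁ * fac q (β + z₁ + 1) * ifac q (z₀ + z₁ - n₃) *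
      ifac q z₀ * ifac q (s₀ + s₁ - n₃) * ifac q (α - n₁) * ifac q (β - n₁))) *
    (q ^ (-(s₀ : ℤ) * (s₁ + 1) - (n₁ + n₃ - s₀ - z₀) * (β - n₁ + 1)) *
      (fac q (β + z₁ + s₀ - n₁ - n₃) * fac q (α + β + s₁ + z₁ - n₁ - n₃ + 1)) *
      ∑ s ∈ range (s₀ + 1), ∑ z ∈ range (z₁ + 1), dblE q α β n₁ n₃ s₀ s₁ z₀ z₁ s z) := by
  have hP := H.toStretchedParams
  have hα : 0 ≤ α := le_trans (Int.natCast_nonneg _) hP.s₀_le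
  have hm : 0 ≤ n₁ + n₃ - z₀ := by have := hP.hkg; omega
  obtain ⟨N, hN⟩ := Int.eq_ofNat_of_zero_le (add_nonneg hα hm)
  rw [← sum_descPart_mul_ascPart hq hP (N := N) (by omega), mul_sum, nineJ]
  have key := fun i n => sixJ_mul_sixJ_mul_sixJ (i := i) (n := n) hq h_abe h_cdf h_hkg h_ach h_bdk
    h_efg H
  have ha := H.a_eq
  have hg := H.g_eq
  set B := (-1) ^ (n₃ - z₀ - z₁) * (triDelta q a c h * triDelta q k g h * triDelta q k d b *
      triDelta q f d c * triDelta q a b e * triDelta q f g e) *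
      (fac q (α + s₁ + 1) * ifac q (β + z₁ + s₀ - n₁ - n₃) *
      ifac q (n₁ + n₃ - s₀ - z₀) * ifac q s₁ * fac q (β + z₁ + 1) * ifac q (z₀ + z₁ - n₃) *
      ifac q z₀ * ifac q (s₀ + s₁ - n₃) * ifac q (α - n₁) * ifac q (β - n₁)) with hB
  set X := β + s₀ + s₁ + z₀ + z₁ - 2 * n₁ - 2 * n₃ with hX
  set Q : ℕ → ℝ := fun i => fac q (X + i) * ifac q i *
        descPart q α β n₁ n₃ s₀ s₁ z₀ z₁ i * ascPart q β n₁ n₃ s₀ s₁ z₀ z₁ i with hQ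
  have hXR : (X : ℝ) = 2 * g - 2 * a := by rw [hX, ha, hg]; push_cast; ring
  set G : ℕ → ℝ := fun n => (-1 : ℝ) ^ n *
    q ^ (Z [d, e, h] - (n / 2 : ℝ) * ((n / 2 : ℝ) + 1)) * qNum q ((n : ℝ) + 1) *
      sixJ q a c h k g (n / 2) * sixJ q k (n / 2) c f d b * sixJ q a g (n / 2) f b e with hG
  set T : ℕ → ℝ := fun i => q ^ (Z [d, e, h] - (g - a) * (g - a + 1)) * B *
    (qInt q (2 * i + X + 1) * q ^ (-(i : ℤ) * (i + X + 1)) * Q i) with hT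
  have hGT : ∀ i n : ℕ, (n : ℤ) = X + 2 * i → T i = G n := by
    intro i n hn
    have e1 := key i n hn
    have hnR : (n : ℝ) = X + 2 * i := by exact_mod_cast hn
    have e2 : q ^ (Z [d, e, h] - (n / 2 : ℝ) * ((n / 2 : ℝ) + 1)) =
        q ^ (Z [d, e, h] - (g - a) * (g - a + 1)) * q ^ (-(i : ℤ) * (i + X + 1)) := by
      rw [← Real.rpow_intCast, ← Real.rpow_add hq, hnR]
      congr 1
      push_cast
      rw [hXR]
      ring
    have e3 : qNum q ((n : ℝ) + 1) = qInt q (2 * i + X + 1) :=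
      qNum_of_eq q (by push_cast; rw [hnR]; ring)
    simp only [hT, hG, e2, e3, hQ]
    linear_combination -(q ^ (Z [d, e, h] - (g - a) * (g - a + 1)) *
      q ^ (-(i : ℤ) * (i + X + 1)) * qInt q (2 * i + X + 1)) * e1
  have hTri : ∀ n : ℕ, G n ≠ 0 → Triad a g (n / 2) := fun n hn =>
    (triads_of_sixJ_ne_zero (right_ne_zero_of_mul hn)).1
  have hXn : ∀ i : ℕ, T i ≠ 0 → ∃ n : ℕ, (n : ℤ) = X + 2 * i := by
    intro i hi
    have : 0 ≤ X + i := by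
      by_contra hlt
      apply hi
      simp only [hT, hQ]
      rw [fac_neg q (not_le.1 hlt)]
      ring
    exact ⟨(X + 2 * i).toNat, by omega⟩
  symm
  -- The index sets do not match: `n` of the wrong parity occurs on one side, and `X + 2i` may be
  -- negative on the other. Such terms vanish, so only nonzero terms are put in bijection.
  refine sum_bij_ne_zero (fun i _ _ => (X + 2 * i).toNat) ?_ ?_ ?_ ?_
  · intro i _ hi
    obtain ⟨n, hn⟩ := hXn i hi
    have h1 := hTri n (by rwa [← hGT i n hn])
    have h2 := h1.2.2.2.2.1
    rw [← hn, Int.toNat_natCast, mem_range, Nat.lt_succ_iff]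
    exact Nat.le_floor (by linarith)
  · intro i _ hi j _ hj hij
    obtain ⟨n, hn⟩ := hXn i hi
    obtain ⟨m, hm⟩ := hXn j hj
    omega
  · intro n _ hn
    obtain ⟨x, i, y, hx, hi, hy⟩ := (hTri n hn).exists_nat
    have h1 : (n : ℤ) = X + 2 * i := by
      have : (n : ℝ) = X + 2 * i := by linarith
      exact_mod_cast this
    have h2 : (i : ℤ) ≤ α := by
      have : (x + i : ℝ) = α := by linarith
      have : (x + i : ℤ) = α := by exact_mod_cast this
      omega
    refine ⟨i, mem_range.2 (by omega), ?_, ?_⟩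
    · change T i ≠ 0
      rwa [hGT i n h1]
    · rw [← h1, Int.toNat_natCast]
  · intro i _ hi
    obtain ⟨n, hn⟩ := hXn i hi
    rw [← hn, Int.toNat_natCast]
    exact hGT i n hn

end

/-! ### The common prefactor and the fifth expression -/

section

lemma natFloor_of_eq {x : ℝ} {n : ℕ} (h : x = n) : ⌊x⌋₊ = n := by rw [h, Nat.floor_natCast]

variable {q a b e c d f h k g : ℝ} {α β n₁ n₃ : ℤ} {s₀ s₁ z₀ z₁ : ℕ}

/-- Evaluation of `Δ` and `∇` at permutations of a triad with integer parameters `x, y, z`. -/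
lemma triDelta_nabla_of_eq (q : ℝ) {a b c : ℝ} {x y z w : ℤ} (hx : a + b - c = x)
    (hy : a - b + c = y) (hz : b + c - a = z) (hw : a + b + c + 1 = w) :
    triDelta q a b c = sqrtFac q x y z w ∧ nabla q a b c = sqrtFac q x y w z ∧
      nabla q b a c = sqrtFac q x z w y ∧ nabla q c a b = sqrtFac q y z w x :=
  ⟨triDelta_of_eq q hx hy hz hw, nabla_of_eq q hx hy hz hw,
    nabla_of_eq q (by rw [← hx]; ring) (by rw [← hz]; ring) (by rw [← hy]; ring)
      (by rw [← hw]; ring),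
    nabla_of_eq q (by rw [← hy]; ring) (by rw [← hz]; ring) (by rw [← hx])
      (by rw [← hw]; ring)⟩

lemma triDelta_swap_right (q a b c : ℝ) : triDelta q a b c = triDelta q a c b := by
  rw [triDelta, triDelta, show a + c - b = a - b + c by ring, show a - c + b = a + b - c by ring,
    show c + b - a = b + c - a by ring, show a + c + b + 1 = a + b + c + 1 by ring,
    mul_comm (qFact q (a + b - c))]

lemma triDelta_swap_left (q a b c : ℝ) : triDelta q a b c = triDelta q b a c := by
  rw [triDelta, triDelta, show b + a - c = a + b - c by ring, show b - a + c = b + c - a by ring,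
    show a + c - b = a - b + c by ring, show b + a + c + 1 = a + b + c + 1 by ring,
    mul_right_comm]

lemma StretchedSpins.deltas_ach (q : ℝ)
    (H : StretchedSpins a b e c d f h k g α β n₁ n₃ s₀ s₁ z₀ z₁) :
    triDelta q a c h = sqrtFac q s₀ (α - s₀) s₁
      (α + s₁ + 1) ∧
    nabla q a c h = sqrtFac q s₀ (α - s₀) (α + s₁ + 1)
      s₁ ∧
    nabla q c a h = sqrtFac q s₀ s₁ (α + s₁ + 1)
      (α - s₀) ∧
    nabla q h a c = sqrtFac q (α - s₀) s₁ (α + s₁ + 1)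
      s₀ :=
  triDelta_nabla_of_eq q (by rw [H.a_eq, H.c_eq, H.h_eq]; push_cast; ring)
    (by rw [H.a_eq, H.c_eq, H.h_eq]; push_cast; ring)
    (by rw [H.a_eq, H.c_eq, H.h_eq]; push_cast; ring)
    (by rw [H.a_eq, H.c_eq, H.h_eq]; push_cast; ring)

lemma StretchedSpins.deltas_ghk (q : ℝ)
    (H : StretchedSpins a b e c d f h k g α β n₁ n₃ s₀ s₁ z₀ z₁) :
    triDelta q g h k = sqrtFac q (α + s₁ + z₀ - n₁ - n₃) (β + z₁ + s₀ - n₁ - n₃) (n₁ + n₃ - s₀ - z₀)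
      (α + β + s₁ + z₁ - n₁ - n₃ + 1) ∧
    nabla q g h k = sqrtFac q (α + s₁ + z₀ - n₁ - n₃) (β + z₁ + s₀ - n₁ - n₃)
      (α + β + s₁ + z₁ - n₁ - n₃ + 1)
      (n₁ + n₃ - s₀ - z₀) ∧
    nabla q h g k = sqrtFac q (α + s₁ + z₀ - n₁ - n₃) (n₁ + n₃ - s₀ - z₀)
      (α + β + s₁ + z₁ - n₁ - n₃ + 1)
      (β + z₁ + s₀ - n₁ - n₃) ∧
    nabla q k g h = sqrtFac q (β + z₁ + s₀ - n₁ - n₃) (n₁ + n₃ - s₀ - z₀)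
      (α + β + s₁ + z₁ - n₁ - n₃ + 1)
      (α + s₁ + z₀ - n₁ - n₃) :=
  triDelta_nabla_of_eq q (by rw [H.g_eq, H.h_eq, H.k_eq]; push_cast; ring)
    (by rw [H.g_eq, H.h_eq, H.k_eq]; push_cast; ring)
    (by rw [H.g_eq, H.h_eq, H.k_eq]; push_cast; ring)
    (by rw [H.g_eq, H.h_eq, H.k_eq]; push_cast; ring)

lemma StretchedSpins.deltas_bdk (q : ℝ)
    (H : StretchedSpins a b e c d f h k g α β n₁ n₃ s₀ s₁ z₀ z₁) :
    triDelta q b d k = sqrtFac q z₀ (β - z₀) z₁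
      (β + z₁ + 1) ∧
    nabla q b d k = sqrtFac q z₀ (β - z₀) (β + z₁ + 1)
      z₁ ∧
    nabla q d b k = sqrtFac q z₀ z₁ (β + z₁ + 1)
      (β - z₀) ∧
    nabla q k b d = sqrtFac q (β - z₀) z₁ (β + z₁ + 1)
      z₀ :=
  triDelta_nabla_of_eq q (by rw [H.b_eq, H.d_eq, H.k_eq]; push_cast; ring)
    (by rw [H.b_eq, H.d_eq, H.k_eq]; push_cast; ring)
    (by rw [H.b_eq, H.d_eq, H.k_eq]; push_cast; ring)
    (by rw [H.b_eq, H.d_eq, H.k_eq]; push_cast; ring)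

lemma StretchedSpins.deltas_fcd (q : ℝ)
    (H : StretchedSpins a b e c d f h k g α β n₁ n₃ s₀ s₁ z₀ z₁) :
    triDelta q f c d = sqrtFac q (s₀ + s₁ - n₃) (z₀ + z₁ - n₃) n₃
      (s₀ + s₁ + z₀ + z₁ - n₃ + 1) ∧
    nabla q f c d = sqrtFac q (s₀ + s₁ - n₃) (z₀ + z₁ - n₃) (s₀ + s₁ + z₀ + z₁ - n₃ + 1)
      n₃ ∧
    nabla q c f d = sqrtFac q (s₀ + s₁ - n₃) n₃ (s₀ + s₁ + z₀ + z₁ - n₃ + 1)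
      (z₀ + z₁ - n₃) ∧
    nabla q d f c = sqrtFac q (z₀ + z₁ - n₃) n₃ (s₀ + s₁ + z₀ + z₁ - n₃ + 1)
      (s₀ + s₁ - n₃) :=
  triDelta_nabla_of_eq q (by rw [H.f_eq, H.c_eq, H.d_eq]; push_cast; ring)
    (by rw [H.f_eq, H.c_eq, H.d_eq]; push_cast; ring)
    (by rw [H.f_eq, H.c_eq, H.d_eq]; ring)
    (by rw [H.f_eq, H.c_eq, H.d_eq]; push_cast; ring)

lemma StretchedSpins.deltas_eab (q : ℝ)
    (H : StretchedSpins a b e c d f h k g α β n₁ n₃ s₀ s₁ z₀ z₁) :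
    triDelta q e a b = sqrtFac q (α - n₁) (β - n₁) n₁
      (α + β - n₁ + 1) ∧
    nabla q e a b = sqrtFac q (α - n₁) (β - n₁) (α + β - n₁ + 1)
      n₁ ∧
    nabla q a e b = sqrtFac q (α - n₁) n₁ (α + β - n₁ + 1)
      (β - n₁) ∧
    nabla q b e a = sqrtFac q (β - n₁) n₁ (α + β - n₁ + 1)
      (α - n₁) :=
  triDelta_nabla_of_eq q (by rw [H.e_eq, H.a_eq, H.b_eq]; push_cast; ring)
    (by rw [H.e_eq, H.a_eq, H.b_eq]; push_cast; ring)
    (by rw [H.e_eq, H.a_eq, H.b_eq]; ring)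
    (by rw [H.e_eq, H.a_eq, H.b_eq]; push_cast; ring)

/-- The origin of the constant `N`: since `f - g + e = 0`, one of the factorials in `Δ[fge]` equals
`1`. -/
lemma StretchedSpins.triDelta_fge (q : ℝ)
    (H : StretchedSpins a b e c d f h k g α β n₁ n₃ s₀ s₁ z₀ z₁) : triDelta q f g e =
      √(qFact q (2 * e) * qFact q (2 * f) / qFact q (2 * g + 1)) := by
  have hg : g = e + f := by rw [H.g_eq, H.e_eq, H.f_eq]; ring
  rw [triDelta, show f + g - e = 2 * f by rw [hg]; ring, show f - g + e = (0 : ℤ) by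
      rw [hg]; push_cast; ring, show g + e - f = 2 * e by rw [hg]; ring,
      show f + g + e + 1 = 2 * g + 1 by rw [hg]; ring, qFact_of_eq q rfl, fac_zero, mul_one,
      mul_comm (qFact q (2 * e))]

/-- Each `Δ` absorbs two of the factorials left by the transformations and becomes a `∇` or the
reciprocal of one; `[β + z₁ + s₀ - n₁ - n₃]!` cancels against its own reciprocal. -/
lemma prefactor_eq (hq : 0 < q)
    (H : StretchedSpins a b e c d f h k g α β n₁ n₃ s₀ s₁ z₀ z₁) :
    triDelta q a c h * triDelta q k g h * triDelta q k d b * triDelta q f d c *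
      triDelta q a b e * (fac q (α + s₁ + 1) * ifac q (β + z₁ + s₀ - n₁ - n₃) *
      ifac q (n₁ + n₃ - s₀ - z₀) * ifac q s₁ * fac q (β + z₁ + 1) * ifac q (z₀ + z₁ - n₃) *
      ifac q z₀ * ifac q (s₀ + s₁ - n₃) * ifac q (α - n₁) * ifac q (β - n₁)) *
      (fac q (β + z₁ + s₀ - n₁ - n₃) * fac q (α + β + s₁ + z₁ - n₁ - n₃ + 1)) =
    nabla q g h k * nabla q k b d * nabla q a c h / (nabla q f c d * nabla q e a b) := by
  obtain ⟨d1, m1, -, -⟩ := H.deltas_ach q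
  obtain ⟨d2, m2, -, -⟩ := H.deltas_ghk q
  obtain ⟨d3, -, -, m3⟩ := H.deltas_bdk q
  obtain ⟨d4, m4, -, -⟩ := H.deltas_fcd q
  obtain ⟨d5, m5, -, -⟩ := H.deltas_eab q
  obtain ⟨h1, h3, h1a, h1b, hs0, hz0, h3a, h3b, hg1, hg2, hg3⟩ := H.toStretchedParams
  rw [triDelta_swap_left q k g, triDelta_swap_right q g k, d1, d2, triDelta_swap_left q k d,
    triDelta_swap_right q d k, triDelta_swap_left q d b, d3, triDelta_swap_right q f d, d4,
    triDelta_swap_right q a b, triDelta_swap_left q a e, d5, m1, m2, m3, m4, m5,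
    ← sqrtFac_mul_fac hq s₀ (α - s₀) (z := s₁) (w := α + s₁ + 1) (by omega) (by omega),
    ← sqrtFac_mul_fac hq (α + s₁ + z₀ - n₁ - n₃) (β + z₁ + s₀ - n₁ - n₃)
      (z := n₁ + n₃ - s₀ - z₀) (w := α + β + s₁ + z₁ - n₁ - n₃ + 1) (by omega) (by omega),
    ← sqrtFac_mul_fac hq (β - z₀) z₁ (z := z₀) (w := β + z₁ + 1) (by omega) (by omega),
    ← sqrtFac_rotate q z₀, div_eq_mul_inv, mul_inv,
    ← sqrtFac_mul_ifac hq (x := s₀ + s₁ - n₃) (y := z₀ + z₁ - n₃) (z := n₃)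
      (w := s₀ + s₁ + z₀ + z₁ - n₃ + 1) (by omega) (by omega) (by omega) (by omega),
    ← sqrtFac_mul_ifac hq (x := α - n₁) (y := β - n₁) (z := n₁) (w := α + β - n₁ + 1)
      (by omega) (by omega) (by omega) (by omega)]
  have c1 := fac_mul_ifac hq hg2
  linear_combination (sqrtFac q s₀ (α - s₀) s₁ (α + s₁ + 1) * sqrtFac q (α + s₁ + z₀ - n₁ - n₃)
    (β + z₁ + s₀ - n₁ - n₃) (n₁ + n₃ - s₀ - z₀) (α + β + s₁ + z₁ - n₁ - n₃ + 1) *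
    sqrtFac q z₀ (β - z₀) z₁ (β + z₁ + 1) * sqrtFac q (s₀ + s₁ - n₃) (z₀ + z₁ - n₃) n₃
    (s₀ + s₁ + z₀ + z₁ - n₃ + 1) * sqrtFac q (α - n₁) (β - n₁) n₁ (α + β - n₁ + 1) *
    (fac q (α + s₁ + 1) * ifac q (n₁ + n₃ - s₀ - z₀) * ifac q s₁ * fac q (β + z₁ + 1) *
      ifac q (z₀ + z₁ - n₃) * ifac q z₀ * ifac q (s₀ + s₁ - n₃) * ifac q (α - n₁) *
      ifac q (β - n₁)) * fac q (α + β + s₁ + z₁ - n₁ - n₃ + 1)) * c1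

lemma exponent_eq (hq : 0 < q)
    (H : StretchedSpins a b e c d f h k g α β n₁ n₃ s₀ s₁ z₀ z₁) :
    q ^ (k * (2 * f - 2 * b + k - 1) + (g - h + k) * (a + b - f - h - k) + Z [c, d, e, h]) =
      q ^ (Z [d, e, h] - (g - a) * (g - a + 1)) *
      q ^ (-(s₀ : ℤ) * (s₁ + 1) - (n₁ + n₃ - s₀ - z₀) * (β - n₁ + 1)) := by
  obtain ⟨-, ha, hb, he, hc, hd, hf, hh, hk, hg⟩ := H
  rw [← Real.rpow_intCast, ← Real.rpow_add hq]
  congr 1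
  subst ha hb he hc hd hf hh hk hg
  simp only [Z, List.map_cons, List.map_nil, List.sum_cons, List.sum_nil]
  push_cast
  ring

lemma nineJ_eq_prefactor_mul_sum_dblE (hq : 0 < q) (h_abe : Triad a b e) (h_cdf : Triad c d f)
    (h_hkg : Triad h k g) (h_ach : Triad a c h) (h_bdk : Triad b d k) (h_efg : Triad e f g)
    (H : StretchedSpins a b e c d f h k g α β n₁ n₃ s₀ s₁ z₀ z₁) :
    nineJ q a b e c d f h k g =
      q ^ (k * (2 * f - 2 * b + k - 1) + (g - h + k) * (a + b - f - h - k) + Z [c, d, e, h]) *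
          √(qFact q (2 * e) * qFact q (2 * f) / qFact q (2 * g + 1)) *
          (nabla q g h k * nabla q k b d * nabla q a c h / (nabla q f c d * nabla q e a b)) *
          ((-1) ^ (n₃ - z₀ - z₁) * ∑ s ∈ range (s₀ + 1), ∑ z ∈ range (z₁ + 1),
            dblE q α β n₁ n₃ s₀ s₁ z₀ z₁ s z) := by
  rw [nineJ_eq_sum_dblE hq h_abe h_cdf h_hkg h_ach h_bdk h_efg H, exponent_eq hq H,
    ← prefactor_eq hq H, ← H.triDelta_fge]
  ring

theorem nineJ_eq_sum_termE (hq : 0 < q) (h_abe : Triad a b e) (h_cdf : Triad c d f)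
    (h_hkg : Triad h k g) (h_ach : Triad a c h) (h_bdk : Triad b d k) (h_efg : Triad e f g)
    (H : StretchedSpins a b e c d f h k g α β n₁ n₃ s₀ s₁ z₀ z₁) :
    nineJ q a b e c d f h k g =
      q ^ (k * (2 * f - 2 * b + k - 1) + (g - h + k) * (a + b - f - h - k) + Z [c, d, e, h]) *
          √(qFact q (2 * e) * qFact q (2 * f) / qFact q (2 * g + 1)) *
          (nabla q g h k * nabla q k b d * nabla q a c h / (nabla q f c d * nabla q e a b)) *
          ∑ s ∈ range (⌊a + c - h⌋₊ + 1), ∑ z ∈ range (⌊d + k - b⌋₊ + 1),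
            termE q a b e c d f h k g s z := by
  rw [nineJ_eq_prefactor_mul_sum_dblE hq h_abe h_cdf h_hkg h_ach h_bdk h_efg H,
    natFloor_of_eq (show a + c - h = s₀ by rw [H.a_eq, H.c_eq, H.h_eq]; ring),
    natFloor_of_eq (show d + k - b = z₁ by rw [H.b_eq, H.d_eq, H.k_eq]; ring)]
  simp only [termE_eq_dblE H, ← mul_sum]

end

/-! ### The other four expressions -/

section

lemma sqrtFac_swap_right (q : ℝ) (x y z w : ℤ) : sqrtFac q x y z w = sqrtFac q x z y w := by
  rw [sqrtFac, sqrtFac, mul_right_comm]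

variable {q a b e c d f h k g : ℝ} {α β n₁ n₃ : ℤ} {s₀ s₁ z₀ z₁ : ℕ}

/-- This and the next four lemmas absorb the factorial quotients produced by rewriting the fifth
double sum, which explains why the five expressions carry different `∇`s for the triads `(a, c, h)`
and `(b, d, k)`. -/
lemma StretchedSpins.nabla_cah (hq : 0 < q)
    (H : StretchedSpins a b e c d f h k g α β n₁ n₃ s₀ s₁ z₀ z₁) :
    nabla q a c h * (ifac q (α - s₀) * fac q s₁) = nabla q c a h := by
  obtain ⟨-, m1, m2, -⟩ := H.deltas_ach q
  have := H.s₀_le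
  rw [m1, m2, sqrtFac_swap_right, mul_comm (ifac _ _), sqrtFac_mul_fac hq _ _ (by omega)
    (by omega), sqrtFac_swap_right]

lemma StretchedSpins.nabla_hac_inv (hq : 0 < q)
    (H : StretchedSpins a b e c d f h k g α β n₁ n₃ s₀ s₁ z₀ z₁) :
    nabla q a c h * (ifac q (α - s₀) * ifac q (α + s₁ + 1)) = (nabla q h a c)⁻¹ := by
  obtain ⟨-, m1, -, m2⟩ := H.deltas_ach q
  have := H.s₀_le
  rw [m1, m2, sqrtFac_rotate, sqrtFac_mul_ifac hq (by omega) (by omega) (by omega)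
    (by omega), sqrtFac_swap_right]

lemma StretchedSpins.nabla_bdk (hq : 0 < q)
    (H : StretchedSpins a b e c d f h k g α β n₁ n₃ s₀ s₁ z₀ z₁) :
    nabla q k b d * (fac q z₀ * ifac q z₁) = nabla q b d k := by
  obtain ⟨-, m1, -, m2⟩ := H.deltas_bdk q
  have := H.z₀_le
  rw [m1, m2, sqrtFac_swap_right, sqrtFac_mul_fac hq _ _ (by omega)
    (by omega), sqrtFac_rotate q z₀, sqrtFac_swap_right q _ _ z₀]

lemma StretchedSpins.nabla_bdk_inv (hq : 0 < q)
    (H : StretchedSpins a b e c d f h k g α β n₁ n₃ s₀ s₁ z₀ z₁) :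
    nabla q k b d * (ifac q (β - z₀) * ifac q (β + 1 + z₁)) = (nabla q b d k)⁻¹ := by
  obtain ⟨-, m1, -, m2⟩ := H.deltas_bdk q
  have := H.z₀_le
  rw [m1, m2, sqrtFac_swap_right, show β + 1 + (z₁ : ℤ) = β + z₁ + 1 by ring,
    sqrtFac_mul_ifac hq (by omega) (by omega) (by omega) (by omega), sqrtFac_rotate q z₀]

lemma StretchedSpins.nabla_dbk (hq : 0 < q)
    (H : StretchedSpins a b e c d f h k g α β n₁ n₃ s₀ s₁ z₀ z₁) :
    nabla q k b d * (fac q z₀ * ifac q (β - z₀)) = nabla q d b k := by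
  obtain ⟨-, -, m1, m2⟩ := H.deltas_bdk q
  have := H.z₀_le
  rw [m1, m2, sqrtFac_rotate, sqrtFac_mul_fac hq _ _ (by omega)
    (by omega), ← sqrtFac_rotate]

theorem nineJ_eq_sum_termA (hq : 0 < q) (h_abe : Triad a b e) (h_cdf : Triad c d f)
    (h_hkg : Triad h k g) (h_ach : Triad a c h) (h_bdk : Triad b d k) (h_efg : Triad e f g)
    (H : StretchedSpins a b e c d f h k g α β n₁ n₃ s₀ s₁ z₀ z₁) :
    nineJ q a b e c d f h k g =
      √(qFact q (2 * e) * qFact q (2 * f) / qFact q (2 * g + 1)) *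
          (nabla q g h k * nabla q b d k * nabla q c a h / (nabla q e a b * nabla q f c d)) *
          q ^ ((h - b - c - e) * (b + c + f - k) + 2 * b * c + Z [e, f, h, k]) *
          ∑ s ∈ range (⌊a + c - h⌋₊ + 1), ∑ z ∈ range (⌊b + d - k⌋₊ + 1),
            termA q a b e c d f h k g s z := by
  obtain ⟨h1, h3, h1a, h1b, hs0, hz0, h3a, h3b, hg1, hg2, hg3⟩ := H.toStretchedParams
  -- The second factor is the power of `q` acquired in passing from the fifth double sum to the
  -- first; after substitution of the integer parameters the exponents agree as polynomials.
  have hz : q ^ ((h - b - c - e) * (b + c + f - k) + 2 * b * c + Z [e, f, h, k]) =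
      q ^ (k * (2 * f - 2 * b + k - 1) + (g - h + k) * (a + b - f - h - k) + Z [c, d, e, h]) *
      q ^ (z₁ * (β - n₁ + s₀ + 1) + z₀ * (n₁ + n₃ - s₀ - z₀ + 1) -
        (z₀ + z₁ - n₃) * (β - z₀ + 1) - s₀ * (β + z₁ + s₀ - n₁ - n₃)) := by
    obtain ⟨-, ha, hb, he, hc, hd, hf, hh, hk, hg⟩ := H
    rw [← Real.rpow_intCast, ← Real.rpow_add hq]
    congr 1
    subst ha hb he hc hd hf hh hk hg
    simp only [Z, List.map_cons, List.map_nil, List.sum_cons, List.sum_nil]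
    push_cast
    ring
  have hs : (-1 : ℝ) ^ (n₃ - z₀ - z₁) * (-1) ^ (z₀ + z₁ - n₃) = 1 := by
    rw [← zpow_add₀ (by norm_num), show n₃ - z₀ - z₁ + (z₀ + z₁ - n₃) = 0 by ring, zpow_zero]
  rw [nineJ_eq_prefactor_mul_sum_dblE hq h_abe h_cdf h_hkg h_ach h_bdk h_efg H,
    natFloor_of_eq (show a + c - h = s₀ by rw [H.a_eq, H.c_eq, H.h_eq]; ring),
    natFloor_of_eq (show b + d - k = z₀ by rw [H.b_eq, H.d_eq, H.k_eq]; ring),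
    sum_dblE_eq_sum_dblA hq h1b hs0 h3b hg3, ← H.nabla_cah hq, ← H.nabla_bdk hq, hz]
  simp only [termA_eq_dblA H]
  generalize ∑ s ∈ range (s₀ + 1), ∑ z ∈ range (z₀ + 1), dblA q α β n₁ n₃ s₀ s₁ z₀ z₁ s z = S
  linear_combination (q ^ (k * (2 * f - 2 * b + k - 1) + (g - h + k) * (a + b - f - h - k) +
    Z [c, d, e, h]) * √(qFact q (2 * e) * qFact q (2 * f) / qFact q (2 * g + 1)) *
    (nabla q g h k * nabla q k b d * nabla q a c h / (nabla q f c d * nabla q e a b)) *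
    q ^ (z₁ * (β - n₁ + s₀ + 1) + z₀ * (n₁ + n₃ - s₀ - z₀ + 1) -
    (z₀ + z₁ - n₃) * (β - z₀ + 1) - s₀ * (β + z₁ + s₀ - n₁ - n₃)) *
    (ifac q (α - s₀) * fac q s₁ * fac q z₀ * ifac q z₁) * S) * hs

theorem nineJ_eq_sum_termB (hq : 0 < q) (h_abe : Triad a b e) (h_cdf : Triad c d f)
    (h_hkg : Triad h k g) (h_ach : Triad a c h) (h_bdk : Triad b d k) (h_efg : Triad e f g)
    (H : StretchedSpins a b e c d f h k g α β n₁ n₃ s₀ s₁ z₀ z₁) :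
    nineJ q a b e c d f h k g =
      sgn (b - a + f + h - k) *
          √(qFact q (2 * e) * qFact q (2 * f) / qFact q (2 * g + 1)) *
          (nabla q g h k * nabla q b d k * nabla q c a h / (nabla q e a b * nabla q f c d)) *
          q ^ ((b + c - f) * (k - g - h) + k * (g + h + 1) - 2 * f * h + Z [b, c, f] +
            Z [g, h, k]) *
          ∑ s ∈ range (⌊c + h - a⌋₊ + 1), ∑ z ∈ range (⌊b + d - k⌋₊ + 1),
            termB q a b e c d f h k g s z := by
  obtain ⟨h1, h3, h1a, h1b, hs0, hz0, h3a, h3b, hg1, hg2, hg3⟩ := H.toStretchedParams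
  set E : ℤ := z₁ * (β - n₁ + s₀ + 1) + z₀ * (n₁ + n₃ - s₀ - z₀ + 1) -
    (z₀ + z₁ - n₃) * (β - z₀ + 1) - s₀ * (β + z₁ + s₀ - n₁ - n₃) +
    (n₃ - z₀) * (α + s₁ + 1) - (s₀ + s₁) * (α - s₀ + n₃ - z₀ + 1) -
    s₁ * (s₀ + s₁ + z₀ - n₃) with hE
  have hz : q ^ ((b + c - f) * (k - g - h) + k * (g + h + 1) - 2 * f * h + Z [b, c, f] +
      Z [g, h, k]) =
      q ^ (k * (2 * f - 2 * b + k - 1) + (g - h + k) * (a + b - f - h - k) + Z [c, d, e, h]) *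
      q ^ E := by
    obtain ⟨-, ha, hb, he, hc, hd, hf, hh, hk, hg⟩ := H
    rw [← Real.rpow_intCast, ← Real.rpow_add hq, hE]
    congr 1
    subst ha hb he hc hd hf hh hk hg
    simp only [Z, List.map_cons, List.map_nil, List.sum_cons, List.sum_nil]
    push_cast
    ring
  have hs : (-1 : ℝ) ^ (n₃ - z₀ - z₁) * (-1) ^ (s₁ + z₁ : ℤ) = (-1) ^ (s₁ + z₀ - n₃) := by
    rw [← zpow_add₀ (by norm_num), show n₃ - z₀ - z₁ + (s₁ + z₁) = s₁ + z₀ - n₃ + 2 * (n₃ - z₀)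
      by ring, zpow_add₀ (by norm_num), zpow_mul]
    norm_num
  rw [nineJ_eq_prefactor_mul_sum_dblE hq h_abe h_cdf h_hkg h_ach h_bdk h_efg H,
    sgn_of_eq (show b - a + f + h - k = (s₁ + z₀ - n₃ : ℤ) by
      rw [H.b_eq, H.a_eq, H.f_eq, H.h_eq, H.k_eq]; push_cast; ring),
    natFloor_of_eq (show c + h - a = s₁ by rw [H.a_eq, H.c_eq, H.h_eq]; ring),
    natFloor_of_eq (show b + d - k = z₀ by rw [H.b_eq, H.d_eq, H.k_eq]; ring),
    sum_dblE_eq_sum_dblB hq h1b hs0 h3b hg3 h1a h3a, ← H.nabla_cah hq, ← H.nabla_bdk hq, hz, ← hs]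
  simp only [termB_eq_dblB H]
  ring

theorem nineJ_eq_sum_termC (hq : 0 < q) (h_abe : Triad a b e) (h_cdf : Triad c d f)
    (h_hkg : Triad h k g) (h_ach : Triad a c h) (h_bdk : Triad b d k) (h_efg : Triad e f g)
    (H : StretchedSpins a b e c d f h k g α β n₁ n₃ s₀ s₁ z₀ z₁) :
    nineJ q a b e c d f h k g =
      sgn (d + f - c) *
          √(qFact q (2 * e) * qFact q (2 * f) / qFact q (2 * g + 1)) *
          (nabla q c a h * nabla q g h k / (nabla q f c d * nabla q e a b * nabla q b d k)) *
          q ^ ((b - c + e + h + 1) * (g - h + k) - (e + k) * (e + k + 1) + Z [b, c, g]) *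
          ∑ s ∈ range (⌊a + c - h⌋₊ + 1), ∑ z ∈ range (⌊d + k - b⌋₊ + 1),
            termC q a b e c d f h k g s z := by
  obtain ⟨h1, h3, h1a, h1b, hs0, hz0, h3a, h3b, hg1, hg2, hg3⟩ := H.toStretchedParams
  have hz : q ^ ((b - c + e + h + 1) * (g - h + k) - (e + k) * (e + k + 1) + Z [b, c, g]) =
      q ^ (k * (2 * f - 2 * b + k - 1) + (g - h + k) * (a + b - f - h - k) + Z [c, d, e, h]) *
      q ^ ((z₁ : ℤ) * (z₀ + 1) - s₀ * (β + z₁ + s₀ - n₁ - n₃)) := by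
    obtain ⟨-, ha, hb, he, hc, hd, hf, hh, hk, hg⟩ := H
    rw [← Real.rpow_intCast, ← Real.rpow_add hq]
    congr 1
    subst ha hb he hc hd hf hh hk hg
    simp only [Z, List.map_cons, List.map_nil, List.sum_cons, List.sum_nil]
    push_cast
    ring
  have hs : (-1 : ℝ) ^ (z₀ + z₁ - n₃) = (-1) ^ (n₃ - z₀ - z₁) := by
    rw [show z₀ + z₁ - n₃ = n₃ - z₀ - z₁ + 2 * (z₀ + z₁ - n₃) by ring,
      zpow_add₀ (by norm_num), zpow_mul]
    norm_num
  rw [nineJ_eq_prefactor_mul_sum_dblE hq h_abe h_cdf h_hkg h_ach h_bdk h_efg H,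
    sgn_of_eq (show d + f - c = (z₀ + z₁ - n₃ : ℤ) by
      rw [H.d_eq, H.f_eq, H.c_eq]; push_cast; ring),
    natFloor_of_eq (show a + c - h = s₀ by rw [H.a_eq, H.c_eq, H.h_eq]; ring),
    natFloor_of_eq (show d + k - b = z₁ by rw [H.b_eq, H.d_eq, H.k_eq]; ring),
    sum_dblE_eq_sum_dblC hq h1b hs0 hz0, hz, hs, div_eq_mul_inv _ (_ * nabla q b d k),
    mul_inv _ (nabla q b d k), ← H.nabla_bdk_inv hq, ← H.nabla_cah hq]
  simp only [termC_eq_dblC H]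
  ring

theorem nineJ_eq_sum_termD (hq : 0 < q) (h_abe : Triad a b e) (h_cdf : Triad c d f)
    (h_hkg : Triad h k g) (h_ach : Triad a c h) (h_bdk : Triad b d k) (h_efg : Triad e f g)
    (H : StretchedSpins a b e c d f h k g α β n₁ n₃ s₀ s₁ z₀ z₁) :
    nineJ q a b e c d f h k g =
      q ^ (2 * a * f - (a + b - e) * (a + d + f - h) + Z [b, d, g, h]) *
          √(qFact q (2 * e) * qFact q (2 * f) / qFact q (2 * g + 1)) *
          (nabla q g h k * nabla q d b k / (nabla q h a c * nabla q f c d * nabla q e a b)) *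
          ∑ s ∈ range (⌊a + c - h⌋₊ + 1), ∑ z ∈ range (⌊b + d - k⌋₊ + 1),
            termD q a b e c d f h k g s z := by
  obtain ⟨h1, h3, h1a, h1b, hs0, hz0, h3a, h3b, hg1, hg2, hg3⟩ := H.toStretchedParams
  set E : ℤ := z₁ * (z₀ + β - n₁ - n₃ + z₁ + s₀ + 1) -
        z₀ * (β - z₀ + n₃ - s₀ + 1) + (n₃ - z₁ - s₀) * (β + 1 + z₁) + s₀ * (s₁ + 1) -
        z₀ * (z₀ + z₁ + s₀ - n₃) with hE
  have hz : q ^ (2 * a * f - (a + b - e) * (a + d + f - h) + Z [b, d, g, h]) =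
      q ^ (k * (2 * f - 2 * b + k - 1) + (g - h + k) * (a + b - f - h - k) + Z [c, d, e, h]) *
      q ^ E := by
    obtain ⟨-, ha, hb, he, hc, hd, hf, hh, hk, hg⟩ := H
    rw [← Real.rpow_intCast, ← Real.rpow_add hq, hE]
    congr 1
    subst ha hb he hc hd hf hh hk hg
    simp only [Z, List.map_cons, List.map_nil, List.sum_cons, List.sum_nil]
    push_cast
    ring
  have hs : (-1 : ℝ) ^ (n₃ - z₀ - z₁) * (-1) ^ (n₃ - z₁ + z₀) = 1 := by
    rw [← zpow_add₀ (by norm_num), show n₃ - z₀ - z₁ + (n₃ - z₁ + z₀) = 2 * (n₃ - z₁) by ring,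
      zpow_mul]
    norm_num
  rw [nineJ_eq_prefactor_mul_sum_dblE hq h_abe h_cdf h_hkg h_ach h_bdk h_efg H,
    natFloor_of_eq (show a + c - h = s₀ by rw [H.a_eq, H.c_eq, H.h_eq]; ring),
    natFloor_of_eq (show b + d - k = z₀ by rw [H.b_eq, H.d_eq, H.k_eq]; ring),
    sum_dblE_eq_sum_dblD hq h1b hs0 h3b hg3 hz0, hz, mul_assoc (nabla q h a c),
    div_eq_mul_inv _ (nabla q h a c * _), mul_inv (nabla q h a c), ← H.nabla_hac_inv hq,
    ← H.nabla_dbk hq]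
  simp only [termD_eq_dblD H]
  generalize ∑ s ∈ range (s₀ + 1), ∑ z ∈ range (z₀ + 1), dblD q α β n₁ n₃ s₀ s₁ z₀ z₁ s z = S
  linear_combination (q ^ (k * (2 * f - 2 * b + k - 1) + (g - h + k) * (a + b - f - h - k) +
    Z [c, d, e, h]) * √(qFact q (2 * e) * qFact q (2 * f) / qFact q (2 * g + 1)) *
    (nabla q g h k * nabla q k b d * nabla q a c h / (nabla q f c d * nabla q e a b)) * q ^ E *
    (fac q z₀ * ifac q (β - z₀) * ifac q (α - s₀) * ifac q (α + s₁ + 1)) * S) * hs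

end

/-! ### The separate sums as `₃F₂` series -/

lemma fac_succ_eq {q : ℝ} {A : ℤ} (hA : 0 ≤ A) (n : ℕ) :
    fac q (A + (n + 1 : ℕ)) = qInt q (A + 1 + n) * fac q (A + n) := by
  rw [fac_step q (m := A + n) (n := A + (n + 1 : ℕ)) (by omega) (by push_cast; ring),
    show A + ((n + 1 : ℕ) : ℤ) = A + 1 + n by push_cast; ring]

lemma ifac_add_eq {q : ℝ} (hq : 0 < q) (C : ℤ) (n : ℕ) :
    ifac q (C + n) = qInt q (C + 1 + n) * ifac q (C + (n + 1 : ℕ)) := by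
  rw [ifac_step hq (m := C + n) (n := C + (n + 1 : ℕ)) (by push_cast; ring),
    show C + ((n + 1 : ℕ) : ℤ) = C + 1 + n by push_cast; ring]

lemma ifac_sub_eq {q : ℝ} (hq : 0 < q) (M : ℤ) (n : ℕ) :
    ifac q (M - (n + 1 : ℕ)) = -qInt q (-M + n) * ifac q (M - n) := by
  rw [ifac_step hq (m := M - (n + 1 : ℕ)) (n := M - n) (by push_cast; ring), ← qInt_neg,
    show -(-M + n) = M - (n : ℤ) by ring]

/-- For a decreasing numerator factorial the term ratio breaks down once `[A - n]!` passes from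
`[0]!` to the conventional value `0`. Since `M ≤ A`, the factor `[-M + n]/[M - n]!` is already zero
at that point. -/
lemma fac_sub_mul_eq {q : ℝ} {A M : ℤ} (hA : M ≤ A) (n : ℕ) :
    fac q (A - (n + 1 : ℕ)) * qInt q (-A + n) * (ifac q (M - n) * qInt q (-M + n)) =
      -(fac q (A - n) * (ifac q (M - n) * qInt q (-M + n))) := by
  rcases lt_trichotomy (A - n) 0 with h | h | h
  · rw [fac_neg q h, fac_neg q (show A - (n + 1 : ℕ) < 0 by push_cast; omega)]
    ring
  · rcases eq_or_lt_of_le hA with rfl | h'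
    · rw [show -M + (n : ℤ) = 0 by omega, qInt_zero]
      ring
    · rw [ifac_neg q (show M - (n : ℤ) < 0 by omega)]
      ring
  · rw [fac_step q (m := A - (n + 1 : ℕ)) (n := A - n) (by push_cast; omega)
      (by push_cast; ring), show A - (n : ℤ) = -(-A + n) by ring, qInt_neg]
    ring

lemma isThreeFTwo_of_int {q : ℝ} {t : ℕ → ℝ} {a₁ a₂ a₃ b₁ b₂ e : ℤ}
    (he : e = a₁ + a₂ + a₃ - b₁ - b₂ + 1 ∨ e = -(a₁ + a₂ + a₃ - b₁ - b₂ + 1))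
    (h : ∀ n : ℕ, t (n + 1) * (qInt q (b₁ + n) * qInt q (b₂ + n) * qInt q (1 + n)) =
      t n * (qInt q (a₁ + n) * qInt q (a₂ + n) * qInt q (a₃ + n)) * q ^ e) :
    IsThreeFTwo q t := by
  refine ⟨a₁, a₂, a₃, b₁, b₂, q ^ e, ?_, fun n => ?_⟩
  · rcases he with rfl | rfl
    · left; rw [← Real.rpow_intCast]; push_cast; rfl
    · right; rw [← Real.rpow_intCast]; push_cast; rfl
  · have hc : ∀ m : ℤ, qNum q (m + n) = qInt q (m + n) := fun m =>
      qNum_of_eq q (by push_cast; rfl)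
    rw [hc, hc, hc, hc, hc, qNum_of_eq q (show (1 : ℝ) + n = (1 + n : ℤ) by push_cast; rfl), h]

lemma zpow_succ_mul {q : ℝ} (hq : 0 < q) (n : ℕ) (e : ℤ) :
    q ^ (((n + 1 : ℕ) : ℤ) * e) = q ^ ((n : ℤ) * e) * q ^ e := by
  rw [← zpow_add₀ hq.ne']
  congr 1
  push_cast
  ring

/-- A numerator `[A + n]!` contributes the parameter `A + 1`, and a denominator `[C + n]!` the lower
parameter `C + 1`. A denominator `[M - n]!` contributes the upper parameter `-M`, with a sign change
from `[M - n] = -[-M + n]` that `(-1)^n` compensates. -/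
lemma isThreeFTwo_alt {q : ℝ} (hq : 0 < q) {t : ℕ → ℝ} {A B C D M e : ℤ} (c : ℝ) (hA : 0 ≤ A)
    (hB : 0 ≤ B) (he : e = A + B - M - C - D + 1 ∨ e = -(A + B - M - C - D + 1))
    (h : ∀ n : ℕ, t n = c * ((-1) ^ n * q ^ ((n : ℤ) * e) * (fac q (A + n) * fac q (B + n) *
      ifac q n * ifac q (M - n) * ifac q (C + n) * ifac q (D + n)))) : IsThreeFTwo q t := by
  refine isThreeFTwo_of_int (a₁ := A + 1) (a₂ := B + 1) (a₃ := -M) (b₁ := C + 1)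
    (b₂ := D + 1) (e := e) (he.imp (fun h => by omega) fun h => by omega) fun n => ?_
  have i0 := ifac_add_eq hq 0 n
  simp only [zero_add] at i0
  rw [h, h, fac_succ_eq hA, fac_succ_eq hB, ifac_sub_eq hq M, ifac_add_eq hq C n,
    ifac_add_eq hq D n, i0, zpow_succ_mul hq]
  ring

/-- A decreasing numerator `[B - n]!` contributes the lower parameter `-B` and one more sign change,
hence three in all. -/
lemma isThreeFTwo_mix {q : ℝ} (hq : 0 < q) {t : ℕ → ℝ} {A B C M L e : ℤ} (c : ℝ) (hA : 0 ≤ A)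
    (hB : M ≤ B) (he : e = A - M - L - C + B + 1 ∨ e = -(A - M - L - C + B + 1))
    (h : ∀ n : ℕ, t n = c * ((-1) ^ n * q ^ ((n : ℤ) * e) * (fac q (A + n) * fac q (B - n) *
      ifac q n * ifac q (M - n) * ifac q (L - n) * ifac q (C + n)))) : IsThreeFTwo q t := by
  refine isThreeFTwo_of_int (a₁ := A + 1) (a₂ := -M) (a₃ := -L) (b₁ := C + 1)
    (b₂ := -B) (e := e) (he.imp (fun h => by omega) fun h => by omega) fun n => ?_
  have i0 := ifac_add_eq hq 0 n
  simp only [zero_add] at i0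
  have i1 := fac_sub_mul_eq (q := q) hB n
  rw [h, h, fac_succ_eq hA, ifac_sub_eq hq M, ifac_sub_eq hq L, ifac_add_eq hq C n,
    i0, zpow_succ_mul hq]
  linear_combination (c * (-1) ^ (n + 1) * q ^ ((n : ℤ) * e) * q ^ e * (qInt q (A + 1 + n) *
    fac q (A + n) * qInt q (-L + n) * ifac q (L - n) * ifac q (C + (n + 1 : ℕ)) *
    ifac q ((n + 1 : ℕ)) * qInt q (C + 1 + n) * qInt q (1 + n))) * i1

/-- The two decreasing denominator factorials give two sign changes, so there is no alternating
sign. -/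
lemma isThreeFTwo_pos {q : ℝ} (hq : 0 < q) {t : ℕ → ℝ} {A C D M L e : ℤ} (c : ℝ) (hA : 0 ≤ A)
    (he : e = A - M - L - C - D ∨ e = -(A - M - L - C - D))
    (h : ∀ n : ℕ, t n = c * (q ^ ((n : ℤ) * e) * (fac q (A + n) *
      ifac q n * ifac q (M - n) * ifac q (L - n) * ifac q (C + n) * ifac q (D + n)))) :
    IsThreeFTwo q t := by
  refine isThreeFTwo_of_int (a₁ := A + 1) (a₂ := -M) (a₃ := -L) (b₁ := C + 1)
    (b₂ := D + 1) (e := e) (he.imp (fun h => by omega) fun h => by omega) fun n => ?_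
  have i0 := ifac_add_eq hq 0 n
  simp only [zero_add] at i0
  rw [h, h, fac_succ_eq hA, ifac_sub_eq hq M, ifac_sub_eq hq L, ifac_add_eq hq C n,
    ifac_add_eq hq D n, i0, zpow_succ_mul hq]
  ring

lemma isThreeFTwo_desc {q : ℝ} (hq : 0 < q) {t : ℕ → ℝ} {A B K L M e : ℤ} (c : ℝ) (hA : M ≤ A)
    (hB : M ≤ B) (he : e = -M - L - K + A + B + 1 ∨ e = -(-M - L - K + A + B + 1))
    (h : ∀ n : ℕ, t n = c * ((-1) ^ n * q ^ ((n : ℤ) * e) * (fac q (A - n) * fac q (B - n) *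
      ifac q n * ifac q (M - n) * ifac q (L - n) * ifac q (K - n)))) : IsThreeFTwo q t := by
  refine isThreeFTwo_of_int (a₁ := -M) (a₂ := -L) (a₃ := -K) (b₁ := -A)
    (b₂ := -B) (e := e) (he.imp (fun h => by omega) fun h => by omega) fun n => ?_
  have i0 := ifac_add_eq hq 0 n
  simp only [zero_add] at i0
  have i1 := fac_sub_mul_eq (q := q) hA n
  have i2 := fac_sub_mul_eq (q := q) hB n
  rw [h, h, ifac_sub_eq hq M, ifac_sub_eq hq L, ifac_sub_eq hq K, i0, zpow_succ_mul hq]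
  have e1 : fac q (A - (n + 1 : ℕ)) * qInt q (-A + n) * (fac q (B - (n + 1 : ℕ)) *
      qInt q (-B + n)) * (ifac q (M - n) * qInt q (-M + n)) =
      fac q (A - n) * fac q (B - n) * (ifac q (M - n) * qInt q (-M + n)) := by
    linear_combination (fac q (B - (n + 1 : ℕ)) * qInt q (-B + n)) * i1 - fac q (A - n) * i2
  linear_combination (c * (-1) ^ n * q ^ ((n : ℤ) * e) * q ^ e * (qInt q (-L + n) *
    ifac q (L - n) * qInt q (-K + n) * ifac q (K - n) * ifac q ((n + 1 : ℕ)) *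
    qInt q (1 + n))) * e1

/-! ### The ten separate sums, and the signs of the terms in the second and fifth expressions -/

section

variable {q a b e c d f h k g : ℝ} {α β n₁ n₃ : ℤ} {s₀ s₁ z₀ z₁ : ℕ}

lemma isThreeFTwo_termA_fst (hq : 0 < q)
    (H : StretchedSpins a b e c d f h k g α β n₁ n₃ s₀ s₁ z₀ z₁) (z : ℕ) :
    IsThreeFTwo q (fun s => termA q a b e c d f h k g s z) := by
  obtain ⟨_, _, _, _, _, _, _, _, _, _, _⟩ := H.toStretchedParams
  refine isThreeFTwo_alt hq (A := α - s₀) (B := n₁ + n₃ - s₀ - z₀ + z) (M := s₀) (C := n₁ - s₀)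
    (D := α + s₁ - s₀ + 1)
    (e := s₀ + s₁ + z₀ - n₃ - z)
    ((-1) ^ z * q ^ ((z : ℤ) * (β - n₁ + s₀)) * (fac q (z₁ + z) * ifac q z * ifac q (z₀ - z) *
      ifac q (n₃ - z₀ + z) * ifac q (β + z₁ - z₀ + 1 + z)))
    (by omega) (by omega) (by omega) fun n => ?_
  have hz : q ^ ((n : ℤ) * (s₀ + s₁ + z₀ - n₃ - z) + z * (β - n₁ + s₀)) =
      q ^ ((z : ℤ) * (β - n₁ + s₀)) * q ^ ((n : ℤ) * (s₀ + s₁ + z₀ - n₃ - z)) := by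
    rw [← zpow_add₀ hq.ne']
    congr 1
    ring
  have h1 : (-1 : ℝ) ≠ 0 := by norm_num
  simp only [termA_eq_dblA H, dblA, hz, show n₁ + n₃ - s₀ - z₀ + (n : ℤ) + z = n₁ + n₃ - s₀ - z₀ +
    z + n by ring, zpow_add₀ h1, zpow_natCast]
  ring

lemma isThreeFTwo_termA_snd (hq : 0 < q)
    (H : StretchedSpins a b e c d f h k g α β n₁ n₃ s₀ s₁ z₀ z₁) (s : ℕ) :
    IsThreeFTwo q (fun z => termA q a b e c d f h k g s z) := by
  obtain ⟨_, _, _, _, _, _, _, _, _, _, _⟩ := H.toStretchedParams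
  refine isThreeFTwo_alt hq (A := z₁) (B := n₁ + n₃ - s₀ - z₀ + s) (M := z₀) (C := n₃ - z₀)
    (D := β + z₁ - z₀ + 1)
    (e := β - n₁ + s₀ - s)
    ((-1) ^ s * q ^ ((s : ℤ) * (s₀ + s₁ + z₀ - n₃)) * (fac q (α - s₀ + s) * ifac q s *
      ifac q (s₀ - s) * ifac q (n₁ - s₀ + s) * ifac q (α + s₁ - s₀ + 1 + s)))
    (by omega) (by omega) (by omega) fun n => ?_
  have hz : q ^ ((s : ℤ) * (s₀ + s₁ + z₀ - n₃ - n) + n * (β - n₁ + s₀)) =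
      q ^ ((s : ℤ) * (s₀ + s₁ + z₀ - n₃)) * q ^ ((n : ℤ) * (β - n₁ + s₀ - s)) := by
    rw [← zpow_add₀ hq.ne']
    congr 1
    ring
  have h1 : (-1 : ℝ) ≠ 0 := by norm_num
  simp only [termA_eq_dblA H, dblA, hz, zpow_add₀ h1, zpow_natCast]
  ring

lemma isThreeFTwo_termB_fst (hq : 0 < q)
    (H : StretchedSpins a b e c d f h k g α β n₁ n₃ s₀ s₁ z₀ z₁) (z : ℕ) :
    IsThreeFTwo q (fun s => termB q a b e c d f h k g s z) := by
  obtain ⟨_, _, _, _, _, _, _, _, _, _, _⟩ := H.toStretchedParams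
  refine isThreeFTwo_desc hq (A := α + s₁ - s₀) (B := α + s₁ - n₁) (M := s₁) (L := α + s₁ + 1)
    (K := α + s₁ + z₀ - n₁ - n₃ - z)
    (e := s₀ + s₁ + z₀ - n₃ - z)
    (q ^ ((z : ℤ) * (α + β - n₁ + s₁ + 1)) * (fac q (z₁ + z) * ifac q z * ifac q (z₀ - z) *
      ifac q (n₃ - z₀ + z) * ifac q (β + z₁ - z₀ + 1 + z)))
    (by omega) (by omega) (by omega) fun n => ?_
  have hz : q ^ ((n : ℤ) * (s₀ + s₁ + z₀ - n₃ - z) + z * (α + β - n₁ + s₁ + 1)) =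
      q ^ ((z : ℤ) * (α + β - n₁ + s₁ + 1)) * q ^ ((n : ℤ) * (s₀ + s₁ + z₀ - n₃ - z)) := by
    rw [← zpow_add₀ hq.ne']
    congr 1
    ring
  simp only [termB_eq_dblB H, dblB, hz, show α + s₁ + z₀ - n₁ - n₃ - (n : ℤ) - z = α + s₁ +
    z₀ - n₁ - n₃ - z - n by ring, zpow_natCast]
  ring

lemma isThreeFTwo_termB_snd (hq : 0 < q)
    (H : StretchedSpins a b e c d f h k g α β n₁ n₃ s₀ s₁ z₀ z₁) (s : ℕ) :
    IsThreeFTwo q (fun z => termB q a b e c d f h k g s z) := by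
  obtain ⟨_, _, _, _, _, _, _, _, _, _, _⟩ := H.toStretchedParams
  refine isThreeFTwo_pos hq (A := z₁) (M := z₀) (L := α + s₁ + z₀ - n₁ - n₃ - s) (C := n₃ - z₀)
    (D := β + z₁ - z₀ + 1)
    (e := α + β - n₁ + s₁ + 1 - s)
    ((-1) ^ s * q ^ ((s : ℤ) * (s₀ + s₁ + z₀ - n₃)) * (fac q (α + s₁ - s₀ - s) * fac q (α +
      s₁ - n₁ - s) * ifac q s * ifac q (s₁ - s) * ifac q (α + s₁ + 1 - s)))
    (by omega) (by omega) fun n => ?_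
  have hz : q ^ ((s : ℤ) * (s₀ + s₁ + z₀ - n₃ - n) + n * (α + β - n₁ + s₁ + 1)) =
      q ^ ((s : ℤ) * (s₀ + s₁ + z₀ - n₃)) * q ^ ((n : ℤ) * (α + β - n₁ + s₁ + 1 - s)) := by
    rw [← zpow_add₀ hq.ne']
    congr 1
    ring
  simp only [termB_eq_dblB H, dblB, hz, zpow_natCast]
  ring

lemma isThreeFTwo_termC_fst (hq : 0 < q)
    (H : StretchedSpins a b e c d f h k g α β n₁ n₃ s₀ s₁ z₀ z₁) (z : ℕ) :
    IsThreeFTwo q (fun s => termC q a b e c d f h k g s z) := by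
  obtain ⟨_, _, _, _, _, _, _, _, _, _, _⟩ := H.toStretchedParams
  refine isThreeFTwo_mix hq (A := α - s₀) (B := β - n₁ + s₀) (M := s₀) (L := β + z₁ +
    s₀ - n₁ - n₃ - z) (C := α + s₁ - s₀ + 1)
    (e := s₀ + s₁ + z₁ - n₃ - z)
    ((-1) ^ z * q ^ (-(z : ℤ) * (n₁ - s₀ + 1)) * (fac q (z₀ + z) * fac q (β + z₁ - z₀ - z) *
      ifac q z * ifac q (z₁ - z) * ifac q (n₃ - z₁ + z)))
    (by omega) (by omega) (by omega) fun n => ?_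
  have hz : q ^ ((n : ℤ) * (s₀ + s₁ + z₁ - n₃ - z) - z * (n₁ - s₀ + 1)) =
      q ^ (-(z : ℤ) * (n₁ - s₀ + 1)) * q ^ ((n : ℤ) * (s₀ + s₁ + z₁ - n₃ - z)) := by
    rw [← zpow_add₀ hq.ne']
    congr 1
    ring
  have h1 : (-1 : ℝ) ≠ 0 := by norm_num
  simp only [termC_eq_dblC H, dblC, hz, show β + z₁ + s₀ - n₁ - n₃ - (n : ℤ) - z = β + z₁ +
    s₀ - n₁ - n₃ - z - n by ring, zpow_add₀ h1, zpow_natCast]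
  ring

lemma isThreeFTwo_termC_snd (hq : 0 < q)
    (H : StretchedSpins a b e c d f h k g α β n₁ n₃ s₀ s₁ z₀ z₁) (s : ℕ) :
    IsThreeFTwo q (fun z => termC q a b e c d f h k g s z) := by
  obtain ⟨_, _, _, _, _, _, _, _, _, _, _⟩ := H.toStretchedParams
  refine isThreeFTwo_mix hq (A := z₀) (B := β + z₁ - z₀) (M := z₁) (L := β + z₁ + s₀ - n₁ - n₃ - s)
    (C := n₃ - z₁)
    (e := -(s + n₁ - s₀ + 1))
    ((-1) ^ s * q ^ ((s : ℤ) * (s₀ + s₁ + z₁ - n₃)) * (fac q (α - s₀ + s) * fac q (β - n₁ +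
      s₀ - s) * ifac q s * ifac q (s₀ - s) * ifac q (α + s₁ - s₀ + 1 + s)))
    (by omega) (by omega) (by omega) fun n => ?_
  have hz : q ^ ((s : ℤ) * (s₀ + s₁ + z₁ - n₃ - n) - n * (n₁ - s₀ + 1)) =
      q ^ ((s : ℤ) * (s₀ + s₁ + z₁ - n₃)) * q ^ ((n : ℤ) * (-(s + n₁ - s₀ + 1))) := by
    rw [← zpow_add₀ hq.ne']
    congr 1
    ring
  have h1 : (-1 : ℝ) ≠ 0 := by norm_num
  simp only [termC_eq_dblC H, dblC, hz, zpow_add₀ h1, zpow_natCast]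
  ring

lemma isThreeFTwo_termD_fst (hq : 0 < q)
    (H : StretchedSpins a b e c d f h k g α β n₁ n₃ s₀ s₁ z₀ z₁) (z : ℕ) :
    IsThreeFTwo q (fun s => termD q a b e c d f h k g s z) := by
  obtain ⟨_, _, _, _, _, _, _, _, _, _, _⟩ := H.toStretchedParams
  refine isThreeFTwo_mix hq (A := s₁) (B := α) (M := s₀) (L := n₁ - z) (C := n₃ - s₀)
    (e := -(z + α + s₁ - n₁ - n₃ + 1))
    ((-1) ^ (s₀ + z) * q ^ ((z : ℤ) * (z₀ + z₁ + s₀ - n₃)) * (fac q (β - z) * fac q (n₁ +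
      n₃ - s₀ - z) * ifac q z * ifac q (z₀ - z) * ifac q (β + z₁ - z + 1)))
    (by omega) (by omega) (by omega) fun n => ?_
  have hz : q ^ (z * (z₀ + z₁ + s₀ - n₃ - (n : ℤ)) - (n : ℤ) * (α + s₁ - n₁ - n₃ + 1)) =
      q ^ ((z : ℤ) * (z₀ + z₁ + s₀ - n₃)) * q ^ ((n : ℤ) * (-(z + α + s₁ - n₁ - n₃ + 1))) := by
    rw [← zpow_add₀ hq.ne']
    congr 1
    ring
  have h1 : (-1 : ℝ) ≠ 0 := by norm_num
  simp only [termD_eq_dblD H, dblD, hz, zpow_add₀ h1, zpow_natCast]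
  ring

lemma isThreeFTwo_termD_snd (hq : 0 < q)
    (H : StretchedSpins a b e c d f h k g α β n₁ n₃ s₀ s₁ z₀ z₁) (s : ℕ) :
    IsThreeFTwo q (fun z => termD q a b e c d f h k g s z) := by
  obtain ⟨_, _, _, _, _, _, _, _, _, _, _⟩ := H.toStretchedParams
  refine isThreeFTwo_desc hq (A := β) (B := n₁ + n₃ - s₀) (M := z₀) (L := β + z₁ + 1) (K := n₁ - s)
    (e := z₀ + z₁ + s₀ - n₃ - s)
    ((-1) ^ (s₀ + s) * q ^ (-(s : ℤ) * (α + s₁ - n₁ - n₃ + 1)) * (ifac q s * fac q (α - s) *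
      fac q (s₁ + s) * ifac q (s₀ - s) * ifac q (n₃ - s₀ + s)))
    (by omega) (by omega) (by omega) fun n => ?_
  have hz : q ^ (n * (z₀ + z₁ + s₀ - n₃ - (s : ℤ)) - (s : ℤ) * (α + s₁ - n₁ - n₃ + 1)) =
      q ^ (-(s : ℤ) * (α + s₁ - n₁ - n₃ + 1)) * q ^ ((n : ℤ) * (z₀ + z₁ + s₀ - n₃ - s)) := by
    rw [← zpow_add₀ hq.ne']
    congr 1
    ring
  have h1 : (-1 : ℝ) ≠ 0 := by norm_num
  simp only [termD_eq_dblD H, dblD, hz, show β + z₁ - (n : ℤ) + 1 = β + z₁ + 1 - n by ring,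
    show n₁ - (n : ℤ) - s = n₁ - s - n by ring, zpow_add₀ h1, zpow_natCast]
  ring

lemma isThreeFTwo_termE_fst (hq : 0 < q)
    (H : StretchedSpins a b e c d f h k g α β n₁ n₃ s₀ s₁ z₀ z₁) (z : ℕ) :
    IsThreeFTwo q (fun s => termE q a b e c d f h k g s z) := by
  obtain ⟨_, _, _, _, _, _, _, _, _, _, _⟩ := H.toStretchedParams
  refine isThreeFTwo_pos hq (A := s₁) (M := β + z₁ + s₀ - n₁ - n₃) (L := s₀) (C := α + s₁ - s₀ + 1)
    (D := n₃ - z₁ - s₀ + z)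
    (e := -(α + β - n₁ + z + 1))
    ((-1) ^ (n₃ - z₀ - z₁) * (-1) ^ z * q ^ (-(z : ℤ) * (n₁ + n₃ - s₀ - z₀)) * (fac q (z₀ + z) *
      fac q (β - n₁ + z) * ifac q z * ifac q (z₁ - z) * ifac q (β + 1 + z)))
    (by omega) (by omega) fun n => ?_
  have hz : q ^ (-(n : ℤ) * (α + β - n₁ + z + 1) - z * (n₁ + n₃ - s₀ - z₀)) =
      q ^ (-(z : ℤ) * (n₁ + n₃ - s₀ - z₀)) * q ^ ((n : ℤ) * (-(α + β - n₁ + z + 1))) := by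
    rw [← zpow_add₀ hq.ne']
    congr 1
    ring
  simp only [termE_eq_dblE H, dblE, hz, show n₃ - z₁ - s₀ + (n : ℤ) + z = n₃ - z₁ - s₀ + z +
    n by ring, zpow_natCast]
  ring

lemma isThreeFTwo_termE_snd (hq : 0 < q)
    (H : StretchedSpins a b e c d f h k g α β n₁ n₃ s₀ s₁ z₀ z₁) (s : ℕ) :
    IsThreeFTwo q (fun z => termE q a b e c d f h k g s z) := by
  obtain ⟨_, _, _, _, _, _, _, _, _, _, _⟩ := H.toStretchedParams
  refine isThreeFTwo_alt hq (A := z₀) (B := β - n₁) (M := z₁) (C := n₃ - z₁ - s₀ + s) (D := β + 1)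
    (e := -(s + n₁ + n₃ - s₀ - z₀))
    ((-1) ^ (n₃ - z₀ - z₁) * q ^ (-(s : ℤ) * (α + β - n₁ + 1)) * (fac q (s₁ + s) * ifac q s *
      ifac q (β + z₁ + s₀ - n₁ - n₃ - s) * ifac q (s₀ - s) * ifac q (α + s₁ - s₀ + 1 + s)))
    (by omega) (by omega) (by omega) fun n => ?_
  have hz : q ^ (-(s : ℤ) * (α + β - n₁ + n + 1) - n * (n₁ + n₃ - s₀ - z₀)) =
      q ^ (-(s : ℤ) * (α + β - n₁ + 1)) * q ^ ((n : ℤ) * (-(s + n₁ + n₃ - s₀ - z₀))) := by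
    rw [← zpow_add₀ hq.ne']
    congr 1
    ring
  simp only [termE_eq_dblE H, dblE, hz, zpow_natCast]
  ring

/-- Once the explicit power of `-1` is squared away, only factorials, reciprocal factorials and
powers of `q` remain, all nonnegative. -/
lemma termB_mul_sign_nonneg (hq : 0 < q)
    (H : StretchedSpins a b e c d f h k g α β n₁ n₃ s₀ s₁ z₀ z₁) (s z : ℕ) :
    0 ≤ (-1 : ℝ) ^ s * termB q a b e c d f h k g s z := by
  rw [termB_eq_dblB H, dblB, zpow_natCast, mul_assoc, ← mul_assoc, ← mul_pow]
  norm_num only [one_pow, one_mul]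
  repeat' first
    | exact fac_nonneg hq _
    | exact ifac_nonneg hq _
    | exact (zpow_pos hq _).le
    | apply mul_nonneg

lemma termE_mul_sgn_nonneg (hq : 0 < q)
    (H : StretchedSpins a b e c d f h k g α β n₁ n₃ s₀ s₁ z₀ z₁) (s z : ℕ) :
    0 ≤ sgn (c - d + e - g + z) * termE q a b e c d f h k g s z := by
  have h1 : (-1 : ℝ) ≠ 0 := by norm_num
  have hs : sgn (c - d + e - g + z) = (-1) ^ (n₃ - z₀ - z₁ + z) := by
    refine sgn_of_eq ?_
    rw [H.c_eq, H.d_eq, H.e_eq, H.g_eq]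
    push_cast
    ring
  have hm : ∀ m : ℤ, (-1 : ℝ) ^ m * (-1) ^ m = 1 := fun m => by rw [← mul_zpow]; norm_num
  rw [termE_eq_dblE H, dblE, hs, ← mul_assoc, mul_assoc _ (q ^ _) _, ← mul_assoc,
    mul_assoc _ _ ((-1) ^ (z : ℤ)),
    ← zpow_add₀ h1 _ (z : ℤ), hm, one_mul]
  repeat' first
    | exact fac_nonneg hq _
    | exact ifac_nonneg hq _
    | exact (zpow_pos hq _).le
    | apply mul_nonneg

end

end QNineJ

theorem mainTheorem3 (q : ℝ) (hq : 0 < q) (a b e c d f h k g : ℝ)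
    (h_abe : QNineJ.Triad a b e) (h_cdf : QNineJ.Triad c d f) (h_hkg : QNineJ.Triad h k g)
    (h_ach : QNineJ.Triad a c h) (h_bdk : QNineJ.Triad b d k) (h_efg : QNineJ.Triad e f g)
    (h_stretched : g = e + f) :
    -- the first expression
    (QNineJ.nineJ q a b e c d f h k g =
        √(QNineJ.qFact q (2 * e) * QNineJ.qFact q (2 * f) / QNineJ.qFact q (2 * g + 1)) *
          (QNineJ.nabla q g h k * QNineJ.nabla q b d k * QNineJ.nabla q c a h /
            (QNineJ.nabla q e a b * QNineJ.nabla q f c d)) *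
          q ^ ((h - b - c - e) * (b + c + f - k) + 2 * b * c + QNineJ.Z [e, f, h, k]) *
          ∑ s ∈ Finset.range (⌊a + c - h⌋₊ + 1), ∑ z ∈ Finset.range (⌊b + d - k⌋₊ + 1),
            QNineJ.termA q a b e c d f h k g s z) ∧
    -- the second expression
    (QNineJ.nineJ q a b e c d f h k g =
        QNineJ.sgn (b - a + f + h - k) *
          √(QNineJ.qFact q (2 * e) * QNineJ.qFact q (2 * f) / QNineJ.qFact q (2 * g + 1)) *
          (QNineJ.nabla q g h k * QNineJ.nabla q b d k * QNineJ.nabla q c a h /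
            (QNineJ.nabla q e a b * QNineJ.nabla q f c d)) *
          q ^ ((b + c - f) * (k - g - h) + k * (g + h + 1) - 2 * f * h +
            QNineJ.Z [b, c, f] + QNineJ.Z [g, h, k]) *
          ∑ s ∈ Finset.range (⌊c + h - a⌋₊ + 1), ∑ z ∈ Finset.range (⌊b + d - k⌋₊ + 1),
            QNineJ.termB q a b e c d f h k g s z) ∧
    -- the third expression
    (QNineJ.nineJ q a b e c d f h k g =
        QNineJ.sgn (d + f - c) *
          √(QNineJ.qFact q (2 * e) * QNineJ.qFact q (2 * f) / QNineJ.qFact q (2 * g + 1)) *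
          (QNineJ.nabla q c a h * QNineJ.nabla q g h k /
            (QNineJ.nabla q f c d * QNineJ.nabla q e a b * QNineJ.nabla q b d k)) *
          q ^ ((b - c + e + h + 1) * (g - h + k) - (e + k) * (e + k + 1) + QNineJ.Z [b, c, g]) *
          ∑ s ∈ Finset.range (⌊a + c - h⌋₊ + 1), ∑ z ∈ Finset.range (⌊d + k - b⌋₊ + 1),
            QNineJ.termC q a b e c d f h k g s z) ∧
    -- the fourth expression
    (QNineJ.nineJ q a b e c d f h k g =
        q ^ (2 * a * f - (a + b - e) * (a + d + f - h) + QNineJ.Z [b, d, g, h]) *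
          √(QNineJ.qFact q (2 * e) * QNineJ.qFact q (2 * f) / QNineJ.qFact q (2 * g + 1)) *
          (QNineJ.nabla q g h k * QNineJ.nabla q d b k /
            (QNineJ.nabla q h a c * QNineJ.nabla q f c d * QNineJ.nabla q e a b)) *
          ∑ s ∈ Finset.range (⌊a + c - h⌋₊ + 1), ∑ z ∈ Finset.range (⌊b + d - k⌋₊ + 1),
            QNineJ.termD q a b e c d f h k g s z) ∧
    -- the fifth expression
    (QNineJ.nineJ q a b e c d f h k g =
        q ^ (k * (2 * f - 2 * b + k - 1) + (g - h + k) * (a + b - f - h - k) +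
            QNineJ.Z [c, d, e, h]) *
          √(QNineJ.qFact q (2 * e) * QNineJ.qFact q (2 * f) / QNineJ.qFact q (2 * g + 1)) *
          (QNineJ.nabla q g h k * QNineJ.nabla q k b d * QNineJ.nabla q a c h /
            (QNineJ.nabla q f c d * QNineJ.nabla q e a b)) *
          ∑ s ∈ Finset.range (⌊a + c - h⌋₊ + 1), ∑ z ∈ Finset.range (⌊d + k - b⌋₊ + 1),
            QNineJ.termE q a b e c d f h k g s z) ∧
    -- in each of the five expressions both separate sums are of type ₃F₂
    (∀ t ∈ [QNineJ.termA q a b e c d f h k g, QNineJ.termB q a b e c d f h k g,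
          QNineJ.termC q a b e c d f h k g, QNineJ.termD q a b e c d f h k g,
          QNineJ.termE q a b e c d f h k g],
        (∀ z : ℕ, QNineJ.IsThreeFTwo q fun s => t s z) ∧
        (∀ s : ℕ, QNineJ.IsThreeFTwo q fun z => t s z)) ∧
    -- the sum over `z` in the second and the sum over `s` in the fifth expression do not alternate
    (∀ s z : ℕ, 0 ≤ (-1 : ℝ) ^ s * QNineJ.termB q a b e c d f h k g s z) ∧
    (∀ s z : ℕ, 0 ≤ QNineJ.sgn (c - d + e - g + z) * QNineJ.termE q a b e c d f h k g s z) := by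
  obtain ⟨α, β, n₁, n₃, s₀, s₁, z₀, z₁, H⟩ :=
    QNineJ.exists_stretchedSpins h_abe h_cdf h_hkg h_ach h_bdk h_stretched
  refine ⟨QNineJ.nineJ_eq_sum_termA hq h_abe h_cdf h_hkg h_ach h_bdk h_efg H,
    QNineJ.nineJ_eq_sum_termB hq h_abe h_cdf h_hkg h_ach h_bdk h_efg H,
    QNineJ.nineJ_eq_sum_termC hq h_abe h_cdf h_hkg h_ach h_bdk h_efg H,
    QNineJ.nineJ_eq_sum_termD hq h_abe h_cdf h_hkg h_ach h_bdk h_efg H,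
    QNineJ.nineJ_eq_sum_termE hq h_abe h_cdf h_hkg h_ach h_bdk h_efg H, ?_,
    QNineJ.termB_mul_sign_nonneg hq H, QNineJ.termE_mul_sgn_nonneg hq H⟩
  simp only [List.forall_mem_cons, List.not_mem_nil, false_imp_iff, implies_true, and_true]
  exact ⟨⟨QNineJ.isThreeFTwo_termA_fst hq H, QNineJ.isThreeFTwo_termA_snd hq H⟩,
    ⟨QNineJ.isThreeFTwo_termB_fst hq H, QNineJ.isThreeFTwo_termB_snd hq H⟩,
    ⟨QNineJ.isThreeFTwo_termC_fst hq H, QNineJ.isThreeFTwo_termC_snd hq H⟩,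
    ⟨QNineJ.isThreeFTwo_termD_fst hq H, QNineJ.isThreeFTwo_termD_snd hq H⟩,
    ⟨QNineJ.isThreeFTwo_termE_fst hq H, QNineJ.isThreeFTwo_termE_snd hq H⟩⟩
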